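/- **Setting.** An instance $\mathcal I=(G,k,p,c,P,B)$ of Budgeted Conflict Free Egalitarian Allocation (BCFEA, with identical additive utilities and costs) consists of a conflict graph $G$ on a set $V$ of $n$ items, a number $k$ of agents, a utility function $p:V\to\mathbb Z_{\ge 0}$ and a cost function $c:V\to\mathbb Z_{\ge 0}$, a target utility $P\in\mathbb Z_{\ge 0}$ and a budget $B\in\mathbb Z_{\ge 0}$, all numbers being written in binary. A set $S\subseteq V$ is a *feasible bundle* if it is independent in $G$, $\sum_{v\in S}c(v)\le B$ and $\sum_{v\in S}p(v)\ge P$. A *solution* is an ordered partition $(S_1,\dots,S_k)$ of $V$ into feasible bundles (empty parts are allowed; they are feasible only if $P=0$). **Theorem.** BCFEA with bundle size $s=2$ is polynomial-time solvable: there is a deterministic algorithm (a program for a random access machine with addition and subtraction, under the logarithmic cost measure) which decides, in time polynomial in the length of the binary encoding of $\mathcal I$, whether $\mathcal I$ has a solution in which every bundle has at most two items; and there is such an algorithm which outputs a solution of this kind if one exists and reports "no" otherwise. Moreover, let $H$ be the graph on $V$ in which two distinct items $a,b$ are adjacent if and only if $\{a,b\}$ is a feasible bundle. Then $\mathcal I$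 has a solution in which every bundle has exactly two items if and only if $n=2k$ and $H$ has a perfect matching. -/

import Mathlib

/-! ## Logarithmic-cost random access machines -/

namespace RAM

/-- Random access machine programs, in structured form. A machine has registers (named by the
numbers that occur in the program, so a program only uses finitely many of them) and an infinite
memory, which is accessed by indirect addressing. The arithmetic is limited to addition and
truncated subtraction. -/
inductive Prog : Type
  /-- `x := c` -/
  | const (x c : ℕ)
  /-- `x := y + z` -/
  | add (x y z : ℕ)
  /-- `x := y - z` (truncated) -/
  | sub (x y z : ℕ)
  /-- `x := mem[y]` -/
  | load (x y : ℕ)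
  /-- `mem[x] := y` -/
  | store (x y : ℕ)
  /-- `p; q` -/
  | seq (p q : Prog)
  /-- `if x ≠ 0 then p else q` -/
  | ite (x : ℕ) (p q : Prog)
  /-- `while x ≠ 0 do p` -/
  | loop (x : ℕ) (p : Prog)

/-- The contents of the registers and of the memory cells. -/
@[ext] structure State : Type where
  reg : ℕ → ℕ
  mem : ℕ → ℕ

/-- Assign the value `v` to the register `x`. -/
def State.setReg (σ : State) (x v : ℕ) : State :=
  { σ with reg := Function.update σ.reg x v }

/-- Write the value `v` into the memory cell with address `a`. -/
def State.setMem (σ : State) (a v : ℕ) : State :=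
  { σ with mem := Function.update σ.mem a v }

/-- `Exec p σ t τ`: started in state `σ`, the program `p` halts in state `τ` after time `t`.
The time is the logarithmic cost: every executed instruction and every executed test costs
one plus the binary lengths of the numbers (values and memory addresses) it works on. -/
inductive Exec : Prog → State → ℕ → State → Prop
  | const (σ : State) (x c : ℕ) :
      Exec (.const x c) σ (1 + c.size) (σ.setReg x c)
  | add (σ : State) (x y z : ℕ) :
      Exec (.add x y z) σ (1 + (σ.reg y).size + (σ.reg z).size)
        (σ.setReg x (σ.reg y + σ.reg z))
  | sub (σ : State) (x y z : ℕ) :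
      Exec (.sub x y z) σ (1 + (σ.reg y).size + (σ.reg z).size)
        (σ.setReg x (σ.reg y - σ.reg z))
  | load (σ : State) (x y : ℕ) :
      Exec (.load x y) σ (1 + (σ.reg y).size + (σ.mem (σ.reg y)).size)
        (σ.setReg x (σ.mem (σ.reg y)))
  | store (σ : State) (x y : ℕ) :
      Exec (.store x y) σ (1 + (σ.reg x).size + (σ.reg y).size)
        (σ.setMem (σ.reg x) (σ.reg y))
  | seq {p q : Prog} {σ τ υ : State} {t u : ℕ} :
      Exec p σ t τ → Exec q τ u υ → Exec (.seq p q) σ (t + u) υ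
  | ite_true {x : ℕ} {p q : Prog} {σ τ : State} {t : ℕ} :
      σ.reg x ≠ 0 → Exec p σ t τ → Exec (.ite x p q) σ (1 + (σ.reg x).size + t) τ
  | ite_false {x : ℕ} {p q : Prog} {σ τ : State} {t : ℕ} :
      σ.reg x = 0 → Exec q σ t τ → Exec (.ite x p q) σ (1 + (σ.reg x).size + t) τ
  | loop_done {x : ℕ} {p : Prog} {σ : State} :
      σ.reg x = 0 → Exec (.loop x p) σ (1 + (σ.reg x).size) σ
  | loop_step {x : ℕ} {p : Prog} {σ τ υ : State} {t u : ℕ} :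
      σ.reg x ≠ 0 → Exec p σ t τ → Exec (.loop x p) τ u υ →
      Exec (.loop x p) σ (1 + (σ.reg x).size + t + u) υ

/-- The machine is deterministic: the final state and the running time are unique. -/
theorem Exec.unique {p : Prog} {σ τ τ' : State} {t t' : ℕ} (h : Exec p σ t τ)
    (h' : Exec p σ t' τ') : t = t' ∧ τ = τ' := by
  induction h generalizing t' τ' with
  | const | add | sub | load | store => cases h'; exact ⟨rfl, rfl⟩
  | seq _ _ ih₁ ih₂ =>
    cases h' with
    | seq a b =>
      obtain ⟨rfl, rfl⟩ := ih₁ a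
      obtain ⟨rfl, rfl⟩ := ih₂ b
      exact ⟨rfl, rfl⟩
  | ite_true hx _ ih =>
    cases h' with
    | ite_true _ a => obtain ⟨rfl, rfl⟩ := ih a; exact ⟨rfl, rfl⟩
    | ite_false hx' _ => exact absurd hx' hx
  | ite_false hx _ ih =>
    cases h' with
    | ite_true hx' _ => exact absurd hx hx'
    | ite_false _ a => obtain ⟨rfl, rfl⟩ := ih a; exact ⟨rfl, rfl⟩
  | loop_done hx =>
    cases h' with
    | loop_done _ => exact ⟨rfl, rfl⟩
    | loop_step hx' _ _ => exact absurd hx hx'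
  | loop_step hx _ _ ih₁ ih₂ =>
    cases h' with
    | loop_done hx' => exact absurd hx' hx
    | loop_step _ a b =>
      obtain ⟨rfl, rfl⟩ := ih₁ a
      obtain ⟨rfl, rfl⟩ := ih₂ b
      exact ⟨rfl, rfl⟩

/-- The initial state on the input `w`: register `0` holds the length of `w`, the memory cells
`0, …, w.length - 1` hold its entries, and everything else is `0`. -/
def init (w : List ℕ) : State where
  reg := fun x => if x = 0 then w.length else 0
  mem := fun a => w.getD a 0

/-- The output in a final state: the contents of the memory cells `0, …, m - 1`, where `m` is the
value of register `0`. -/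
def output (σ : State) : List ℕ := (List.range (σ.reg 0)).map σ.mem

/-- The length of a sequence of natural numbers that are written in binary, with one separator
symbol for each of them. -/
def bitLength (w : List ℕ) : ℕ := (w.map fun x => x.size + 1).sum

/-- On the input `w`, the program `p` halts within time `T` with the output `v`. -/
def ComputesWithin (p : Prog) (w v : List ℕ) (T : ℕ) : Prop :=
  ∃ (t : ℕ) (τ : State), Exec p (init w) t τ ∧ t ≤ T ∧ output τ = v

/-- A search problem (given `x`, find some `y` with `R x y`) is solvable in polynomial time: some
program outputs on every instance `x` the encoding of such a `y`, within time polynomial in the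
length of the encoding of `x`. -/
def SolvableInPolyTime {α : Type*} {β : α → Type*} (encIn : α → List ℕ)
    (encOut : ∀ x, β x → List ℕ) (R : ∀ x, β x → Prop) : Prop :=
  ∃ (p : Prog) (q : Polynomial ℕ), ∀ x : α, ∃ y : β x, R x y ∧
    ComputesWithin p (encIn x) (encOut x y) (q.eval (bitLength (encIn x)))

open Classical in
/-- A decision problem is decidable in polynomial time: some program outputs `1` on the
yes-instances and `0` on the no-instances, within time polynomial in the length of the
encoding. -/
def DecidableInPolyTime {α : Type*} (encIn : α → List ℕ) (Q : α → Prop) : Prop :=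
  ∃ (p : Prog) (q : Polynomial ℕ), ∀ x : α,
    ComputesWithin p (encIn x) [if Q x then 1 else 0] (q.eval (bitLength (encIn x)))

end RAM

/-! ## Budgeted conflict free egalitarian allocation -/

namespace BCFEA

/-- An instance `(G, k, p, c, P, B)`: a conflict graph `G` on `n` items, `k` agents, additive
utility and cost functions `p` and `c` that are given by their values on the items and are the
same for all agents, a target utility `P` and a budget `B`. -/
structure Instance : Type where
  n : ℕ
  k : ℕ
  G : SimpleGraph (Fin n)
  p : Fin n → ℕ
  c : Fin n → ℕ
  P : ℕ
  B : ℕ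

namespace Instance

variable (I : Instance)

/-- A set of items is a feasible bundle if it is independent in the conflict graph, has cost at
most `B` and utility at least `P`. -/
def Feasible (S : Finset (Fin I.n)) : Prop :=
  I.G.IsIndepSet (S : Set (Fin I.n)) ∧ ∑ v ∈ S, I.c v ≤ I.B ∧ I.P ≤ ∑ v ∈ S, I.p v

/-- An ordered partition of the items into `k` bundles is given by the map that sends every item
to the agent who receives it. -/
abbrev Allocation : Type := Fin I.n → Fin I.k

/-- The bundle of agent `i`. -/
def bundle (a : I.Allocation) (i : Fin I.k) : Finset (Fin I.n) :=
  Finset.univ.filter fun v => a v = i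

/-- Every bundle is feasible. -/
def IsSolution (a : I.Allocation) : Prop := ∀ i, I.Feasible (I.bundle a i)

/-- A solution in which every bundle has at most `s` items. -/
def IsSolutionOfSize (s : ℕ) (a : I.Allocation) : Prop :=
  I.IsSolution a ∧ ∀ i, (I.bundle a i).card ≤ s

open Classical in
/-- An instance as a sequence of numbers: `n, k, P, B`, the utilities, the costs, and the adjacency
matrix of the conflict graph, row by row. -/
noncomputable def encode : List ℕ :=
  [I.n, I.k, I.P, I.B] ++ List.ofFn I.p ++ List.ofFn I.c ++
    (List.ofFn fun u => List.ofFn fun v => if I.G.Adj u v then 1 else 0).flatten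

/-- The answer of an algorithm: `0` stands for "no", and `1` followed by the list of the agents
who receive the items `0, …, n - 1` stands for "yes" with that allocation. -/
def encodeAnswer : Option I.Allocation → List ℕ
  | none => [0]
  | some a => 1 :: List.ofFn fun v => (a v : ℕ)

/-- An answer is correct for the bundle size `s` if it is a solution with bundles of at most `s`
items, or if it is "no" and there is no such solution. -/
def CorrectAnswer (s : ℕ) : Option I.Allocation → Prop
  | none => ¬ ∃ a, I.IsSolutionOfSize s a
  | some a => I.IsSolutionOfSize s a

/-- The auxiliary graph of feasible pairs: two distinct items are adjacent if together they form a
feasible bundle. -/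
def pairGraph : SimpleGraph (Fin I.n) where
  Adj u v := u ≠ v ∧ I.Feasible {u, v}
  symm := ⟨fun u v h => ⟨h.1.symm, by rw [Finset.pair_comm]; exact h.2⟩⟩
  loopless := ⟨fun _ h => h.1 rfl⟩

end Instance

end BCFEA

/-! ## Unit-cost running times -/

namespace RAM

/-- All registers and memory cells hold numbers of binary length at most `b`. -/
def State.SizeLE (σ : State) (b : ℕ) : Prop :=
  (∀ x, (σ.reg x).size ≤ b) ∧ ∀ a, (σ.mem a).size ≤ b

/-- The largest binary length of a constant that occurs in a program. -/
def Prog.constSize : Prog → ℕ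
  | .const _ c => c.size
  | .seq p q => max p.constSize q.constSize
  | .ite _ p q => max p.constSize q.constSize
  | .loop _ p => p.constSize
  | _ => 0

/-- The program `p` leads from `σ` to `τ` in at most `s` steps. Since a step increases the binary
lengths of the numbers in the machine by at most one, a number of steps bounds the logarithmic
cost. -/
def Run (p : Prog) (σ : State) (s : ℕ) (τ : State) : Prop :=
  ∀ b, p.constSize ≤ b → σ.SizeLE b →
    τ.SizeLE (b + s) ∧ ∃ t ≤ s * (1 + 2 * (b + s)), Exec p σ t τ

theorem State.SizeLE.mono {σ : State} {b b' : ℕ} (h : σ.SizeLE b) (hb : b ≤ b') : σ.SizeLE b' :=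
  ⟨fun x => (h.1 x).trans hb, fun a => (h.2 a).trans hb⟩

theorem State.SizeLE.setReg {σ : State} {b x v : ℕ} (h : σ.SizeLE b) (hv : v.size ≤ b) :
    (σ.setReg x v).SizeLE b := by
  refine ⟨fun y => ?_, h.2⟩
  by_cases hy : y = x
  · subst hy; simpa [State.setReg] using hv
  · simpa [State.setReg, hy] using h.1 y

theorem State.SizeLE.setMem {σ : State} {b x v : ℕ} (h : σ.SizeLE b) (hv : v.size ≤ b) :
    (σ.setMem x v).SizeLE b := by
  refine ⟨h.1, fun y => ?_⟩
  by_cases hy : y = x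
  · subst hy; simpa [State.setMem] using hv
  · simpa [State.setMem, hy] using h.2 y

theorem size_add_le {x y b : ℕ} (hx : x.size ≤ b) (hy : y.size ≤ b) : (x + y).size ≤ b + 1 := by
  rw [Nat.size_le] at *
  rw [pow_succ]; omega

theorem size_sub_le {x y b : ℕ} (hx : x.size ≤ b) : (x - y).size ≤ b :=
  (Nat.size_le_size (Nat.sub_le x y)).trans hx

theorem Run.mono {p : Prog} {σ τ : State} {s s' : ℕ} (h : Run p σ s τ) (hs : s ≤ s') :
    Run p σ s' τ := by
  intro b hb hσ
  obtain ⟨h1, t, ht, h2⟩ := h b hb hσ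
  refine ⟨h1.mono (by omega), t, ht.trans ?_, h2⟩
  gcongr

theorem Run.const (σ : State) (x c : ℕ) : Run (.const x c) σ 1 (σ.setReg x c) := by
  intro b hb hσ
  simp only [Prog.constSize] at hb
  exact ⟨(hσ.mono (by omega)).setReg (by omega), _, by omega, Exec.const σ x c⟩

theorem Run.add (σ : State) (x y z : ℕ) :
    Run (.add x y z) σ 1 (σ.setReg x (σ.reg y + σ.reg z)) := by
  intro b _ hσ
  have h1 := hσ.1 y
  have h2 := hσ.1 z
  exact ⟨(hσ.mono (by omega)).setReg (size_add_le h1 h2), _, by omega, Exec.add σ x y z⟩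

theorem Run.sub (σ : State) (x y z : ℕ) :
    Run (.sub x y z) σ 1 (σ.setReg x (σ.reg y - σ.reg z)) := by
  intro b _ hσ
  have h1 := hσ.1 y
  have h2 := hσ.1 z
  exact ⟨(hσ.mono (by omega)).setReg ((size_sub_le h1).trans (by omega)), _, by omega,
    Exec.sub σ x y z⟩

theorem Run.load (σ : State) (x y : ℕ) :
    Run (.load x y) σ 1 (σ.setReg x (σ.mem (σ.reg y))) := by
  intro b _ hσ
  have h1 := hσ.1 y
  have h2 := hσ.2 (σ.reg y)
  exact ⟨(hσ.mono (by omega)).setReg (by omega), _, by omega, Exec.load σ x y⟩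

theorem Run.store (σ : State) (x y : ℕ) :
    Run (.store x y) σ 1 (σ.setMem (σ.reg x) (σ.reg y)) := by
  intro b _ hσ
  have h1 := hσ.1 x
  have h2 := hσ.1 y
  exact ⟨(hσ.mono (by omega)).setMem (by omega), _, by omega, Exec.store σ x y⟩

theorem Run.seq {p q : Prog} {σ τ υ : State} {s t : ℕ} (h : Run p σ s τ) (h' : Run q τ t υ) :
    Run (.seq p q) σ (s + t) υ := by
  intro b hb hσ
  simp only [Prog.constSize, max_le_iff] at hb
  obtain ⟨h1, t1, ht1, e1⟩ := h b hb.1 hσ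
  obtain ⟨h2, t2, ht2, e2⟩ := h' (b + s) (by omega) h1
  refine ⟨h2.mono (by omega), _, (add_le_add ht1 ht2).trans ?_, e1.seq e2⟩
  rw [add_mul]
  exact add_le_add (Nat.mul_le_mul_left _ (by omega)) (Nat.mul_le_mul_left _ (by omega))

theorem Run.ite_true {x : ℕ} {p q : Prog} {σ τ : State} {s : ℕ} (hx : σ.reg x ≠ 0)
    (h : Run p σ s τ) : Run (.ite x p q) σ (1 + s) τ := by
  intro b hb hσ
  simp only [Prog.constSize, max_le_iff] at hb
  obtain ⟨h1, t1, ht1, e1⟩ := h b hb.1 hσ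
  refine ⟨h1.mono (by omega), _, ?_, Exec.ite_true hx e1⟩
  have := hσ.1 x
  have h3 : s * (1 + 2 * (b + s)) ≤ s * (1 + 2 * (b + (1 + s))) :=
    Nat.mul_le_mul_left _ (by omega)
  rw [add_mul]; omega

theorem Run.ite_false {x : ℕ} {p q : Prog} {σ τ : State} {s : ℕ} (hx : σ.reg x = 0)
    (h : Run q σ s τ) : Run (.ite x p q) σ (1 + s) τ := by
  intro b hb hσ
  simp only [Prog.constSize, max_le_iff] at hb
  obtain ⟨h1, t1, ht1, e1⟩ := h b hb.2 hσ
  refine ⟨h1.mono (by omega), _, ?_, Exec.ite_false hx e1⟩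
  have := hσ.1 x
  have h3 : s * (1 + 2 * (b + s)) ≤ s * (1 + 2 * (b + (1 + s))) :=
    Nat.mul_le_mul_left _ (by omega)
  rw [add_mul]; omega

theorem Run.loop_done {x : ℕ} {p : Prog} {σ : State} (hx : σ.reg x = 0) :
    Run (.loop x p) σ 1 σ := by
  intro b _ hσ
  have := hσ.1 x
  exact ⟨hσ.mono (by omega), _, by omega, Exec.loop_done hx⟩

theorem Run.loop_step {x : ℕ} {p : Prog} {σ τ υ : State} {s t : ℕ} (hx : σ.reg x ≠ 0)
    (h : Run p σ s τ) (h' : Run (.loop x p) τ t υ) : Run (.loop x p) σ (1 + s + t) υ := by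
  intro b hb hσ
  have hb' := hb
  simp only [Prog.constSize] at hb
  obtain ⟨h1, t1, ht1, e1⟩ := h b hb hσ
  obtain ⟨h2, t2, ht2, e2⟩ := h' (b + s) (by simp only [Prog.constSize]; omega) h1
  refine ⟨h2.mono (by omega), _, ?_, Exec.loop_step hx e1 e2⟩
  have := hσ.1 x
  have h3 : s * (1 + 2 * (b + s)) ≤ s * (1 + 2 * (b + (1 + s + t))) :=
    Nat.mul_le_mul_left _ (by omega)
  have h4 : t * (1 + 2 * (b + s + t)) ≤ t * (1 + 2 * (b + (1 + s + t))) :=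
    Nat.mul_le_mul_left _ (by omega)
  rw [add_mul, add_mul]; omega

end RAM

/-! ## A structured language with arrays and bounded loops -/

namespace RAM

/-- Expressions over the variables, the input and eight arrays. -/
inductive Expr : Type
  | lit (c : ℕ)
  | var (x : ℕ)
  | add (e f : Expr)
  | sub (e f : Expr)
  /-- the product of an expression and a variable -/
  | mul (e : Expr) (y : ℕ)
  /-- an entry of the input -/
  | inp (e : Expr)
  /-- an entry of an array -/
  | arr (j : Fin 8) (e : Expr)

/-- Commands. -/
inductive Cmd : Type
  | skip
  /-- `x := e` -/
  | assign (x : ℕ) (e : Expr)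
  /-- overwrite an entry of the input -/
  | put (e f : Expr)
  /-- assign to an entry of an array -/
  | set (j : Fin 8) (e f : Expr)
  | seq (p q : Cmd)
  /-- `if e ≠ 0 then p else q` -/
  | ite (e : Expr) (p q : Cmd)
  /-- `for x := y - 1, …, 0 do p` -/
  | loop (x y : ℕ) (p : Cmd)

/-- The state of a structured program. -/
@[ext] structure Env : Type where
  len : ℕ
  var : ℕ → ℕ
  inp : ℕ → ℕ
  arr : Fin 8 → ℕ → ℕ

namespace Env

def setVar (h : Env) (x v : ℕ) : Env := { h with var := Function.update h.var x v }

def setInp (h : Env) (a v : ℕ) : Env :=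
  { h with inp := if a < h.len then Function.update h.inp a v else h.inp }

def setArr (h : Env) (j : Fin 8) (i v : ℕ) : Env :=
  { h with arr := Function.update h.arr j (Function.update (h.arr j) i v) }

/-- The initial state on the input `w`. -/
def start (w : List ℕ) : Env where
  len := w.length
  var := fun _ => 0
  inp := fun a => w.getD a 0
  arr := fun _ _ => 0

end Env

def Expr.eval (h : Env) : Expr → ℕ
  | .lit c => c
  | .var x => h.var x
  | .add e f => e.eval h + f.eval h
  | .sub e f => e.eval h - f.eval h
  | .mul e y => e.eval h * h.var y
  | .inp e => h.inp (e.eval h)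
  | .arr j e => h.arr j (e.eval h)

/-- The effect of the last `m` rounds of a loop. -/
def loopEval (f : Env → Env) (x : ℕ) : ℕ → Env → Env
  | 0, h => h.setVar x 0
  | m + 1, h => loopEval f x m (f (h.setVar x m))

def Cmd.eval : Cmd → Env → Env
  | .skip, h => h
  | .assign x e, h => h.setVar x (e.eval h)
  | .put e f, h => h.setInp (e.eval h) (f.eval h)
  | .set j e f, h => h.setArr j (e.eval h) (f.eval h)
  | .seq p q, h => q.eval (p.eval h)
  | .ite e p q, h => if e.eval h ≠ 0 then p.eval h else q.eval h
  | .loop x y p, h => loopEval p.eval x (h.var y) h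

/-- A loop over the remaining rounds preserves an invariant. -/
theorem loopEval_induction {f : Env → Env} {x : ℕ} (P : ℕ → Env → Prop)
    (step : ∀ i h, P (i + 1) h → P i (f (h.setVar x i)))
    (last : ∀ h, P 0 h → P 0 (h.setVar x 0)) :
    ∀ (m : ℕ) (h : Env), P m h → P 0 (loopEval f x m h)
  | 0, h, hm => last h hm
  | m + 1, h, hm => loopEval_induction P step last m _ (step m h hm)

/-! ### Compilation -/

/-- Evaluate an expression into the register `2 * d + 1`, using only registers with larger odd
names as auxiliary registers. -/
def Expr.compile : Expr → ℕ → Prog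
  | .lit c, d => .const (2 * d + 1) c
  | .var x, d => .seq (.const (2 * d + 1) 0) (.add (2 * d + 1) (2 * x + 2) (2 * d + 1))
  | .add e f, d => .seq (e.compile d) (.seq (f.compile (d + 1))
      (.add (2 * d + 1) (2 * d + 1) (2 * d + 3)))
  | .sub e f, d => .seq (e.compile d) (.seq (f.compile (d + 1))
      (.sub (2 * d + 1) (2 * d + 1) (2 * d + 3)))
  | .mul e y, d => .seq (e.compile d) (.seq (.const (2 * d + 3) 0) (.seq (.const (2 * d + 7) 1)
      (.seq (.add (2 * d + 5) (2 * y + 2) (2 * d + 3)) (.seq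
        (.loop (2 * d + 5) (.seq (.add (2 * d + 3) (2 * d + 3) (2 * d + 1))
          (.sub (2 * d + 5) (2 * d + 5) (2 * d + 7))))
        (.add (2 * d + 1) (2 * d + 3) (2 * d + 5))))))
  | .inp e, d => .seq (e.compile d) (.seq (.sub (2 * d + 3) 0 (2 * d + 1))
      (.ite (2 * d + 3) (.load (2 * d + 1) (2 * d + 1)) (.const (2 * d + 1) 0)))
  | .arr j e, d => .seq (e.compile d) (.seq (address j d) (.load (2 * d + 1) (2 * d + 1)))
where
  /-- Replace the index in register `2 * d + 1` by the address of this entry of the `j`-th array. -/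
  address (j : Fin 8) (d : ℕ) : Prog :=
    .seq (.add (2 * d + 1) (2 * d + 1) (2 * d + 1)) (.seq (.add (2 * d + 1) (2 * d + 1) (2 * d + 1))
      (.seq (.add (2 * d + 1) (2 * d + 1) (2 * d + 1)) (.seq (.const (2 * d + 3) j)
        (.seq (.add (2 * d + 1) (2 * d + 1) (2 * d + 3)) (.add (2 * d + 1) (2 * d + 1) 0)))))

def Cmd.compile : Cmd → Prog
  | .skip => .const 1 0
  | .assign x e => .seq (e.compile 0) (.seq (.const 3 0) (.add (2 * x + 2) 1 3))
  | .put e f => .seq (e.compile 0) (.seq (f.compile 1) (.seq (.sub 5 0 1)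
      (.ite 5 (.store 1 3) (.const 1 0))))
  | .set j e f => .seq (e.compile 0) (.seq (Expr.compile.address j 0) (.seq (f.compile 1)
      (.store 1 3)))
  | .seq p q => .seq p.compile q.compile
  | .ite e p q => .seq (e.compile 0) (.ite 1 p.compile q.compile)
  | .loop x y p => .seq (.const 1 0) (.seq (.add (2 * x + 2) (2 * y + 2) 1)
      (.loop (2 * x + 2) (.seq (.const 1 1) (.seq (.sub (2 * x + 2) (2 * x + 2) 1) p.compile))))

/-- The machine state `σ` represents the state `h` of a structured program. -/
structure Sim (h : Env) (σ : State) : Prop where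
  base : σ.reg 0 = h.len
  var : ∀ x, σ.reg (2 * x + 2) = h.var x
  arr : ∀ (j : Fin 8) i, σ.mem (h.len + (8 * i + j)) = h.arr j i
  inp : ∀ a < h.len, σ.mem a = h.inp a
  out : ∀ a, h.len ≤ a → h.inp a = 0

theorem Sim.start (w : List ℕ) : Sim (Env.start w) (init w) where
  base := rfl
  var x := by simp [init, Env.start]
  arr j i := by simp [init, Env.start]
  inp a _ := rfl
  out a ha := List.getD_eq_default _ _ ha

/-- The two states agree up to the auxiliary registers from `2 * d + 1` on. -/
def State.Agree (d : ℕ) (σ τ : State) : Prop :=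
  τ.mem = σ.mem ∧ ∀ x, (x % 2 = 0 ∨ x < 2 * d + 1) → τ.reg x = σ.reg x

theorem State.Agree.refl (d : ℕ) (σ : State) : σ.Agree d σ := ⟨rfl, fun _ _ => rfl⟩

theorem State.Agree.trans {d d' : ℕ} {σ τ υ : State} (h : σ.Agree d τ) (h' : τ.Agree d' υ)
    (hd : d ≤ d') : σ.Agree d υ :=
  ⟨h'.1.trans h.1, fun x hx => (h'.2 x (by omega)).trans (h.2 x hx)⟩

theorem State.Agree.setReg {d x : ℕ} (σ : State) (v : ℕ) (h1 : x % 2 = 1) (h2 : 2 * d + 1 ≤ x) :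
    σ.Agree d (σ.setReg x v) :=
  ⟨rfl, fun y hy => by simp only [State.setReg, Function.update_apply]; rw [if_neg (by omega)]⟩

theorem Sim.agree {h : Env} {σ τ : State} {d : ℕ} (hs : Sim h σ) (ha : σ.Agree d τ) : Sim h τ where
  base := (ha.2 0 (by omega)).trans hs.base
  var x := (ha.2 _ (by omega)).trans (hs.var x)
  arr j i := by rw [ha.1]; exact hs.arr j i
  inp a h := by rw [ha.1]; exact hs.inp a h
  out := hs.out

/-- A bound for the number of steps of the evaluation of an expression, if the second factors of
products are at most `β`. -/
def Expr.steps (β : ℕ) : Expr → ℕ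
  | .lit _ => 1
  | .var _ => 2
  | .add e f => e.steps β + f.steps β + 1
  | .sub e f => e.steps β + f.steps β + 1
  | .mul e _ => e.steps β + 3 * β + 5
  | .inp e => e.steps β + 3
  | .arr _ e => e.steps β + 7

/-- The second factors of products are at most `β`. -/
def Expr.FactorsLE (β : ℕ) (h : Env) : Expr → Prop
  | .add e f => e.FactorsLE β h ∧ f.FactorsLE β h
  | .sub e f => e.FactorsLE β h ∧ f.FactorsLE β h
  | .mul e y => e.FactorsLE β h ∧ h.var y ≤ β
  | .inp e => e.FactorsLE β h
  | .arr _ e => e.FactorsLE β h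
  | _ => True

/-- In at most `s` steps, the program `p` puts `v` into the auxiliary register `2 * d + 1` and
changes otherwise only later auxiliary registers. -/
def Computes (p : Prog) (d : ℕ) (σ : State) (s v : ℕ) : Prop :=
  ∃ τ, Run p σ s τ ∧ τ.reg (2 * d + 1) = v ∧ σ.Agree d τ

theorem run_mul_loop (d : ℕ) : ∀ (m : ℕ) (σ : State), σ.reg (2 * d + 5) = m →
    σ.reg (2 * d + 7) = 1 →
    ∃ τ, Run (.loop (2 * d + 5) (.seq (.add (2 * d + 3) (2 * d + 3) (2 * d + 1))
          (.sub (2 * d + 5) (2 * d + 5) (2 * d + 7)))) σ (3 * m + 1) τ ∧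
      τ.reg (2 * d + 5) = 0 ∧ τ.reg (2 * d + 3) = σ.reg (2 * d + 3) + σ.reg (2 * d + 1) * m ∧
      σ.Agree (d + 1) τ
  | 0, σ, h1, _ => ⟨σ, Run.loop_done h1, h1, by simp, .refl _ _⟩
  | m + 1, σ, h1, h2 => by
    obtain ⟨τ, r, e1, e2, e3⟩ := run_mul_loop d m
      ((σ.setReg (2 * d + 3) (σ.reg (2 * d + 3) + σ.reg (2 * d + 1))).setReg (2 * d + 5) m)
      (by simp [State.setReg]) (by simpa [State.setReg] using h2)
    refine ⟨τ, (Run.loop_step (by omega) (Run.seq (Run.add _ _ _ _) (Run.sub _ _ _ _))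
      (t := 3 * m + 1) ?_).mono (by omega), e1, ?_, ?_⟩
    · simpa [State.setReg, h1, h2] using r
    · rw [e2]; simp [State.setReg]; ring
    · exact (((State.Agree.setReg σ _ (by omega) (by omega)).trans
        (State.Agree.setReg _ m (by omega) (by omega)) le_rfl)).trans e3 le_rfl

theorem run_address (j : Fin 8) (d : ℕ) (σ : State) :
    Computes (Expr.compile.address j d) d σ 6 (σ.reg 0 + (8 * σ.reg (2 * d + 1) + j)) := by
  refine ⟨_, (Run.seq (Run.add _ _ _ _) (Run.seq (Run.add _ _ _ _) (Run.seq (Run.add _ _ _ _)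
    (Run.seq (Run.const _ _ _) (Run.seq (Run.add _ _ _ _) (Run.add _ _ _ _)))))), ?_, ?_⟩
  · simp [State.setReg]; ring
  · refine ⟨rfl, fun x hx => ?_⟩
    have h1 : x ≠ 2 * d + 1 := by omega
    have h2 : x ≠ 2 * d + 3 := by omega
    simp [State.setReg, h1, h2]

theorem Expr.run_compile {β : ℕ} {h : Env} : ∀ (e : Expr) (d : ℕ) (σ : State), Sim h σ →
    e.FactorsLE β h → Computes (e.compile d) d σ (e.steps β) (e.eval h)
  | .lit c, d, σ, _, _ => ⟨_, Run.const _ _ _, by simp [State.setReg, Expr.eval],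
      .setReg _ _ (by omega) (by omega)⟩
  | .var x, d, σ, hs, _ => by
    refine ⟨_, (Run.seq (Run.const _ _ _) (Run.add _ _ _ _)), ?_,
      (State.Agree.setReg _ _ (by omega) (by omega)).trans
        (.setReg _ _ (by omega) (by omega)) le_rfl⟩
    have : 2 * x + 2 ≠ 2 * d + 1 := by omega
    simp [State.setReg, Expr.eval, this, hs.var]
  | .add e f, d, σ, hs, hf => by
    obtain ⟨τ, r1, v1, a1⟩ := e.run_compile d σ hs hf.1
    obtain ⟨υ, r2, v2, a2⟩ := f.run_compile (d + 1) τ (hs.agree a1) hf.2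
    refine ⟨_, (r1.seq (r2.seq (Run.add _ _ _ _))).mono (by simp only [Expr.steps]; omega), ?_,
      (a1.trans a2 (by omega)).trans (.setReg _ _ (by omega) (by omega)) le_rfl⟩
    have h1 : υ.reg (2 * d + 1) = e.eval h := (a2.2 _ (by omega)).trans v1
    have h2 : υ.reg (2 * d + 3) = f.eval h := v2
    simp [State.setReg, Expr.eval, h1, h2]
  | .sub e f, d, σ, hs, hf => by
    obtain ⟨τ, r1, v1, a1⟩ := e.run_compile d σ hs hf.1
    obtain ⟨υ, r2, v2, a2⟩ := f.run_compile (d + 1) τ (hs.agree a1) hf.2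
    refine ⟨_, (r1.seq (r2.seq (Run.sub _ _ _ _))).mono (by simp only [Expr.steps]; omega), ?_,
      (a1.trans a2 (by omega)).trans (.setReg _ _ (by omega) (by omega)) le_rfl⟩
    have h1 : υ.reg (2 * d + 1) = e.eval h := (a2.2 _ (by omega)).trans v1
    have h2 : υ.reg (2 * d + 3) = f.eval h := v2
    simp [State.setReg, Expr.eval, h1, h2]
  | .mul e y, d, σ, hs, hf => by
    obtain ⟨τ, r1, v1, a1⟩ := e.run_compile d σ hs hf.1
    have hy := (hs.agree a1).var y
    have n1 : 2 * y + 2 ≠ 2 * d + 7 := by omega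
    have n2 : 2 * y + 2 ≠ 2 * d + 3 := by omega
    obtain ⟨υ, r2, w1, w2, a2⟩ := run_mul_loop d (h.var y)
      (((τ.setReg (2 * d + 3) 0).setReg (2 * d + 7) 1).setReg (2 * d + 5) (h.var y))
      (by simp [State.setReg]) (by simp [State.setReg])
    refine ⟨_, (r1.seq ((Run.const _ _ _).seq ((Run.const _ _ _).seq ((Run.add _ _ _ _).seq
      (Run.seq (s := 3 * h.var y + 1) (τ := υ) ?_ (Run.add _ _ _ _)))))).mono
        (by simp only [Expr.steps]; have := hf.2; omega), ?_, ?_⟩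
    · have e : ((τ.setReg (2 * d + 3) 0).setReg (2 * d + 7) 1).reg (2 * y + 2) +
          ((τ.setReg (2 * d + 3) 0).setReg (2 * d + 7) 1).reg (2 * d + 3) = h.var y := by
        simp only [State.setReg, Function.update_apply]
        rw [if_neg n1, if_neg n2, hy]; simp
      rw [e]; exact r2
    · simp [State.setReg, w1, w2, v1, Expr.eval]
    · refine (a1.trans (State.Agree.trans (State.Agree.trans (State.Agree.trans
        (State.Agree.trans (d := d) (d' := d)
        (.setReg _ _ ?_ ?_) (.setReg _ _ ?_ ?_) le_rfl) (.setReg _ _ ?_ ?_) le_rfl) a2 ?_)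
        (d' := d) (.setReg _ _ ?_ ?_) ?_) le_rfl) <;> omega
  | .inp e, d, σ, hs, hf => by
    obtain ⟨τ, r1, v1, a1⟩ := e.run_compile d σ hs hf
    have hs' := hs.agree a1
    have a2 : τ.Agree d (τ.setReg (2 * d + 3) (h.len - e.eval h)) :=
      .setReg _ _ (by omega) (by omega)
    have r2 := Run.sub τ (2 * d + 3) 0 (2 * d + 1)
    rw [v1, hs'.base] at r2
    by_cases hlt : e.eval h < h.len
    · refine ⟨_, (r1.seq (r2.seq (Run.ite_true ?_ (Run.load _ _ _)))).mono ?_, ?_,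
        (a1.trans a2 le_rfl).trans (.setReg _ _ (by omega) (by omega)) le_rfl⟩
      · simp [State.setReg]; omega
      · simp only [Expr.steps]; omega
      · simp [State.setReg, v1, Expr.eval, hs'.inp _ hlt]
    · refine ⟨_, (r1.seq (r2.seq (Run.ite_false ?_ (Run.const _ _ _)))).mono ?_, ?_,
        (a1.trans a2 le_rfl).trans (.setReg _ _ (by omega) (by omega)) le_rfl⟩
      · simp [State.setReg]; omega
      · simp only [Expr.steps]; omega
      · simp [State.setReg, Expr.eval, hs'.out _ (not_lt.mp hlt)]
  | .arr j e, d, σ, hs, hf => by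
    obtain ⟨τ, r1, v1, a1⟩ := e.run_compile d σ hs hf
    obtain ⟨υ, r2, v2, a2⟩ := run_address j d τ
    have hs' := (hs.agree a1).agree a2
    refine ⟨_, (r1.seq (r2.seq (Run.load _ _ _))).mono (by simp only [Expr.steps]; omega), ?_,
      (a1.trans a2 le_rfl).trans (.setReg _ _ (by omega) (by omega)) le_rfl⟩
    rw [v1, (hs.agree a1).base] at v2
    simp [State.setReg, Expr.eval, v2, hs'.arr]

theorem Sim.setVar {h : Env} {σ : State} (hs : Sim h σ) (x v : ℕ) :
    Sim (h.setVar x v) (σ.setReg (2 * x + 2) v) where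
  base := hs.base
  var y := by
    by_cases hy : y = x
    · subst hy; simp [State.setReg, Env.setVar]
    · have : 2 * y + 2 ≠ 2 * x + 2 := by omega
      simp [State.setReg, Env.setVar, hy, hs.var]
  arr := hs.arr
  inp := hs.inp
  out := hs.out

theorem Sim.setArr {h : Env} {σ : State} (hs : Sim h σ) (j : Fin 8) (i v : ℕ) :
    Sim (h.setArr j i v) (σ.setMem (h.len + (8 * i + j)) v) where
  base := hs.base
  var := hs.var
  arr j' i' := by
    simp only [State.setMem, Env.setArr, Function.update_apply]
    by_cases hj : j' = j
    · subst hj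
      by_cases hi : i' = i
      · subst hi; simp
      · rw [if_neg (by omega)]; simp [hi, hs.arr]
    · have := Fin.val_ne_of_ne hj
      rw [if_neg (by omega)]; simp [hj, hs.arr]
  inp a ha := by
    have ha' : a < h.len := ha
    simp only [State.setMem, Env.setArr, Function.update_apply]
    rw [if_neg (by omega)]; exact hs.inp a ha
  out := hs.out

theorem Sim.setInp {h : Env} {σ : State} (hs : Sim h σ) {a : ℕ} (ha : a < h.len) (v : ℕ) :
    Sim (h.setInp a v) (σ.setMem a v) where
  base := hs.base
  var := hs.var
  arr j' i' := by
    simp only [State.setMem, Env.setInp, Function.update_apply]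
    rw [if_neg (by omega)]; exact hs.arr j' i'
  inp b hb := by
    simp only [State.setMem, Env.setInp, ha, if_true, Function.update_apply]
    split_ifs <;> [rfl; exact hs.inp b hb]
  out b hb := by
    have hb' : h.len ≤ b := hb
    simp only [Env.setInp, ha, if_true, Function.update_apply]
    rw [if_neg (by omega)]; exact hs.out b hb

/-- The command assigns to the variable `x`. -/
def Cmd.assigns (x : ℕ) : Cmd → Bool
  | .assign y _ => x == y
  | .seq p q => p.assigns x || q.assigns x
  | .ite _ p q => p.assigns x || q.assigns x
  | .loop y _ p => x == y || p.assigns x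
  | _ => false

theorem loopEval_var {f : Env → Env} {x z : ℕ} (hf : ∀ h, (f h).var z = h.var z) (hz : z ≠ x) :
    ∀ (m : ℕ) (h : Env), (loopEval f x m h).var z = h.var z
  | 0, h => by simp [loopEval, Env.setVar, hz]
  | m + 1, h => by rw [loopEval, loopEval_var hf hz m, hf]; simp [Env.setVar, hz]

theorem Cmd.eval_var {z : ℕ} : ∀ (p : Cmd) (h : Env), p.assigns z = false →
    (p.eval h).var z = h.var z
  | .skip, h, _ => rfl
  | .assign x e, h, hz => by
    have : z ≠ x := by simpa [Cmd.assigns] using hz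
    simp [Cmd.eval, Env.setVar, this]
  | .put e f, h, _ => rfl
  | .set j e f, h, _ => rfl
  | .seq p q, h, hz => by
    simp only [Cmd.assigns, Bool.or_eq_false_iff] at hz
    rw [Cmd.eval, q.eval_var _ hz.2, p.eval_var _ hz.1]
  | .ite e p q, h, hz => by
    simp only [Cmd.assigns, Bool.or_eq_false_iff] at hz
    rw [Cmd.eval]; split_ifs
    · exact p.eval_var _ hz.1
    · exact q.eval_var _ hz.2
  | .loop x y p, h, hz => by
    simp only [Cmd.assigns, Bool.or_eq_false_iff, beq_eq_false_iff_ne] at hz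
    exact loopEval_var (fun h => p.eval_var h hz.2) hz.1 _ _

theorem loopEval_len {f : Env → Env} {x : ℕ} (hf : ∀ h, (f h).len = h.len) :
    ∀ (m : ℕ) (h : Env), (loopEval f x m h).len = h.len
  | 0, h => rfl
  | m + 1, h => by rw [loopEval, loopEval_len hf m, hf]; rfl

theorem Cmd.eval_len : ∀ (p : Cmd) (h : Env), (p.eval h).len = h.len
  | .skip, h => rfl
  | .assign x e, h => rfl
  | .put e f, h => rfl
  | .set j e f, h => rfl
  | .seq p q, h => by rw [Cmd.eval, q.eval_len, p.eval_len]
  | .ite e p q, h => by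
    rw [Cmd.eval]; split_ifs
    · exact p.eval_len _
    · exact q.eval_len _
  | .loop x y p, h => loopEval_len p.eval_len _ _

/-- Only the variables `0` and `1` serve as second factors. -/
def Expr.ok : Expr → Bool
  | .add e f => e.ok && f.ok
  | .sub e f => e.ok && f.ok
  | .mul e y => e.ok && (y == 0 || y == 1)
  | .inp e => e.ok
  | .arr _ e => e.ok
  | _ => true

/-- The variables `0` and `1` are never changed, only they serve as second factors and as loop
bounds, and loop variables are not changed within the loop. -/
def Cmd.ok : Cmd → Bool
  | .skip => true
  | .assign x e => x != 0 && x != 1 && e.ok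
  | .put e f => e.ok && f.ok
  | .set _ e f => e.ok && f.ok
  | .seq p q => p.ok && q.ok
  | .ite e p q => e.ok && p.ok && q.ok
  | .loop x y p => x != 0 && x != 1 && (y == 0 || y == 1) && !p.assigns x && p.ok

theorem Expr.ok.factorsLE {β : ℕ} {h : Env} (h0 : h.var 0 ≤ β) (h1 : h.var 1 ≤ β) :
    ∀ (e : Expr), e.ok → e.FactorsLE β h
  | .lit _, _ => trivial
  | .var _, _ => trivial
  | .add e f, hok => by
    simp only [Expr.ok, Bool.and_eq_true] at hok
    exact ⟨factorsLE h0 h1 e hok.1, factorsLE h0 h1 f hok.2⟩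
  | .sub e f, hok => by
    simp only [Expr.ok, Bool.and_eq_true] at hok
    exact ⟨factorsLE h0 h1 e hok.1, factorsLE h0 h1 f hok.2⟩
  | .mul e y, hok => by
    simp only [Expr.ok, Bool.and_eq_true, Bool.or_eq_true, beq_iff_eq] at hok
    refine ⟨factorsLE h0 h1 e hok.1, ?_⟩
    obtain rfl | rfl := hok.2 <;> assumption
  | .inp e, hok => factorsLE h0 h1 e hok
  | .arr _ e, hok => factorsLE h0 h1 e hok

theorem Cmd.ok.assigns : ∀ (p : Cmd), p.ok → p.assigns 0 = false ∧ p.assigns 1 = false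
  | .skip, _ => ⟨rfl, rfl⟩
  | .assign x e, h => by
    simp only [Cmd.ok, Bool.and_eq_true, bne_iff_ne, ne_eq] at h
    simp only [Cmd.assigns, beq_eq_false_iff_ne, ne_eq]
    omega
  | .put _ _, _ => ⟨rfl, rfl⟩
  | .set _ _ _, _ => ⟨rfl, rfl⟩
  | .seq p q, h => by
    simp only [Cmd.ok, Bool.and_eq_true] at h
    have := Cmd.ok.assigns p h.1
    have := Cmd.ok.assigns q h.2
    simp [Cmd.assigns, *]
  | .ite e p q, h => by
    simp only [Cmd.ok, Bool.and_eq_true] at h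
    have := Cmd.ok.assigns p h.1.2
    have := Cmd.ok.assigns q h.2
    simp [Cmd.assigns, *]
  | .loop x y p, h => by
    simp only [Cmd.ok, Bool.and_eq_true, bne_iff_ne, ne_eq] at h
    have := Cmd.ok.assigns p h.2
    simp [Cmd.assigns, this, Ne.symm h.1.1.1.1, Ne.symm h.1.1.1.2]

/-- A bound for the number of steps of a command. -/
noncomputable def Cmd.steps (β : ℕ) : Cmd → ℕ
  | .skip => 1
  | .assign _ e => e.steps β + 2
  | .put e f => e.steps β + f.steps β + 3
  | .set _ e f => e.steps β + f.steps β + 7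
  | .seq p q => p.steps β + q.steps β
  | .ite e p q => e.steps β + p.steps β + q.steps β + 1
  | .loop _ _ p => 3 + β * (p.steps β + 3)

theorem run_assign {β : ℕ} {h : Env} {σ : State} (hs : Sim h σ) (x : ℕ) {e : Expr}
    (he : e.FactorsLE β h) :
    ∃ τ, Run (Cmd.assign x e).compile σ (e.steps β + 2) τ ∧ Sim ((Cmd.assign x e).eval h) τ := by
  obtain ⟨τ, r, v, a⟩ := e.run_compile 0 σ hs he
  refine ⟨_, r.seq ((Run.const _ _ _).seq (Run.add _ _ _ _)), ?_⟩
  have := ((hs.agree a).agree (.setReg (d := 0) (x := 3) τ 0 (by omega) (by omega))).setVar x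
    (e.eval h)
  have hv : τ.reg 1 = e.eval h := v
  have he : (τ.setReg 3 0).reg 1 + (τ.setReg 3 0).reg 3 = e.eval h := by simp [State.setReg, hv]
  rw [he]; exact this

theorem run_loop {f : Env → Env} {x s : ℕ} {c : Prog} {Q : Env → Prop}
    (hQ : ∀ h v, Q h → Q (h.setVar x v))
    (hc : ∀ h σ, Q h → Sim h σ → ∃ τ, Run c σ s τ ∧ Sim (f h) τ ∧ Q (f h))
    (hx : ∀ h, (f h).var x = h.var x) : ∀ (m : ℕ) (h : Env) (σ : State), Q h → Sim h σ →
      h.var x = m → ∃ τ, Run (.loop (2 * x + 2) (.seq (.const 1 1)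
        (.seq (.sub (2 * x + 2) (2 * x + 2) 1) c))) σ (m * (s + 3) + 1) τ ∧ Sim (loopEval f x m h) τ
  | 0, h, σ, _, hs, hm => by
    refine ⟨σ, (Run.loop_done ?_).mono (by omega), ?_⟩
    · rw [hs.var, hm]
    · convert hs using 1
      ext z <;> simp only [loopEval, Env.setVar, Function.update_apply]
      split_ifs with hz
      · rw [hz, hm]
      · rfl
  | m + 1, h, σ, hq, hs, hm => by
    have hs1 : Sim (h.setVar x m) ((σ.setReg 1 1).setReg (2 * x + 2) m) :=
      (hs.agree (.setReg (d := 0) (x := 1) σ 1 (by omega) (by omega))).setVar x m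
    obtain ⟨τ, r1, s1, q1⟩ := hc _ _ (hQ h m hq) hs1
    obtain ⟨υ, r2, s2⟩ := run_loop hQ hc hx m _ τ q1 s1 (by simp [hx, Env.setVar])
    refine ⟨υ, (Run.loop_step (by rw [hs.var, hm]; omega) ((Run.const _ _ _).seq
      ((Run.sub _ _ _ _).seq ?_)) r2).mono (s := 1 + (1 + (1 + s)) + (m * (s + 3) + 1))
      (by rw [add_mul]; omega), s2⟩
    convert r1 using 2
    simp [State.setReg, hs.var, hm]

theorem Cmd.run_compile {β : ℕ} : ∀ (p : Cmd), p.ok → ∀ (h : Env) (σ : State), h.var 0 ≤ β →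
    h.var 1 ≤ β → Sim h σ → ∃ τ, Run p.compile σ (p.steps β) τ ∧ Sim (p.eval h) τ
  | .skip, _, h, σ, _, _, hs =>
    ⟨_, Run.const _ _ _, hs.agree (.setReg (d := 0) _ _ (by omega) (by omega))⟩
  | .assign x e, hok, h, σ, h0, h1, hs => by
    simp only [Cmd.ok, Bool.and_eq_true] at hok
    exact run_assign hs x (Expr.ok.factorsLE h0 h1 e hok.2)
  | .put e f, hok, h, σ, h0, h1, hs => by
    simp only [Cmd.ok, Bool.and_eq_true] at hok
    obtain ⟨τ, r1, v1, a1⟩ := e.run_compile 0 σ hs (Expr.ok.factorsLE h0 h1 e hok.1)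
    obtain ⟨υ, r2, v2, a2⟩ :=
      f.run_compile 1 τ (hs.agree a1) (Expr.ok.factorsLE h0 h1 f hok.2)
    have hs2 := (hs.agree a1).agree a2
    have v1' : υ.reg 1 = e.eval h := (a2.2 _ (by omega)).trans v1
    have v2' : υ.reg 3 = f.eval h := v2
    have r3 := Run.sub υ 5 0 1
    rw [v1', hs2.base] at r3
    have hs3 : Sim h (υ.setReg 5 (h.len - e.eval h)) :=
      hs2.agree (.setReg (d := 0) _ _ (by omega) (by omega))
    by_cases hlt : e.eval h < h.len
    · refine ⟨_, (r1.seq (r2.seq (r3.seq (Run.ite_true ?_ (Run.store _ _ _))))).mono ?_, ?_⟩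
      · simp [State.setReg]; omega
      · simp only [Cmd.steps]; omega
      · simpa [Cmd.eval, State.setReg, v1', v2'] using hs3.setInp hlt (f.eval h)
    · refine ⟨_, (r1.seq (r2.seq (r3.seq (Run.ite_false ?_ (Run.const _ _ _))))).mono ?_, ?_⟩
      · simp [State.setReg]; omega
      · simp only [Cmd.steps]; omega
      · simpa [Cmd.eval, Env.setInp, hlt] using
          hs3.agree (.setReg (d := 0) (x := 1) _ 0 (by omega) (by omega))
  | .set j e f, hok, h, σ, h0, h1, hs => by
    simp only [Cmd.ok, Bool.and_eq_true] at hok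
    obtain ⟨τ, r1, v1, a1⟩ := e.run_compile 0 σ hs (Expr.ok.factorsLE h0 h1 e hok.1)
    obtain ⟨τ', r1', v1', a1'⟩ := run_address j 0 τ
    rw [v1, (hs.agree a1).base] at v1'
    have hs1 := (hs.agree a1).agree a1'
    obtain ⟨υ, r2, v2, a2⟩ := f.run_compile 1 τ' hs1 (Expr.ok.factorsLE h0 h1 f hok.2)
    have w1 : υ.reg 1 = h.len + (8 * e.eval h + j) := (a2.2 _ (by omega)).trans v1'
    have w2 : υ.reg 3 = f.eval h := v2
    refine ⟨_, (r1.seq (r1'.seq (r2.seq (Run.store _ _ _)))).mono ?_, ?_⟩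
    · simp only [Cmd.steps]; omega
    · simpa [Cmd.eval, w1, w2] using (hs1.agree a2).setArr j (e.eval h) (f.eval h)
  | .seq p q, hok, h, σ, h0, h1, hs => by
    simp only [Cmd.ok, Bool.and_eq_true] at hok
    obtain ⟨a0, a1⟩ := Cmd.ok.assigns p hok.1
    obtain ⟨τ, r1, s1⟩ := p.run_compile hok.1 h σ h0 h1 hs
    obtain ⟨υ, r2, s2⟩ := q.run_compile hok.2 _ τ ((p.eval_var h a0).le.trans h0)
      ((p.eval_var h a1).le.trans h1) s1
    exact ⟨υ, r1.seq r2, s2⟩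
  | .ite e p q, hok, h, σ, h0, h1, hs => by
    simp only [Cmd.ok, Bool.and_eq_true] at hok
    obtain ⟨τ, r1, v1, a1⟩ := e.run_compile 0 σ hs (Expr.ok.factorsLE h0 h1 e hok.1.1)
    simp only [Cmd.eval]
    by_cases he : e.eval h = 0
    · obtain ⟨υ, r2, s2⟩ := q.run_compile hok.2 h τ h0 h1 (hs.agree a1)
      rw [if_neg (by simpa using he)]
      exact ⟨υ, (r1.seq (Run.ite_false (v1.trans he) r2)).mono (by simp only [Cmd.steps]; omega),
        s2⟩
    · obtain ⟨υ, r2, s2⟩ := p.run_compile hok.1.2 h τ h0 h1 (hs.agree a1)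
      rw [if_pos he]
      exact ⟨υ, (r1.seq (Run.ite_true (v1.trans_ne he) r2)).mono (by simp only [Cmd.steps]; omega),
        s2⟩
  | .loop x y p, hok, h, σ, h0, h1, hs => by
    simp only [Cmd.ok, Bool.and_eq_true, bne_iff_ne, Bool.not_eq_true', Bool.or_eq_true,
      beq_iff_eq] at hok
    obtain ⟨⟨⟨⟨hx0, hx1⟩, hy⟩, hx⟩, hp⟩ := hok
    obtain ⟨a0, a1⟩ := Cmd.ok.assigns p hp
    have hyβ : h.var y ≤ β := by obtain rfl | rfl := hy <;> assumption
    have hs1 : Sim (h.setVar x (h.var y)) ((σ.setReg 1 0).setReg (2 * x + 2) (h.var y)) :=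
      (hs.agree (.setReg (d := 0) (x := 1) σ 0 (by omega) (by omega))).setVar x _
    obtain ⟨τ, r, s⟩ := run_loop (f := p.eval) (x := x) (s := p.steps β) (c := p.compile)
      (Q := fun h => h.var 0 ≤ β ∧ h.var 1 ≤ β)
      (fun h v hq => by simpa [Env.setVar, Ne.symm hx0, Ne.symm hx1] using hq)
      (fun h σ hq hs => by
        obtain ⟨τ, r, s⟩ := p.run_compile hp h σ hq.1 hq.2 hs
        exact ⟨τ, r, s, (p.eval_var h a0).le.trans hq.1, (p.eval_var h a1).le.trans hq.2⟩)
      (fun h => p.eval_var h hx) (h.var y) _ _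
      (by simpa [Env.setVar, Ne.symm hx0, Ne.symm hx1] using And.intro h0 h1) hs1
      (by simp [Env.setVar])
    refine ⟨τ, ((Run.const _ _ _).seq ((Run.add _ _ _ _).seq
      (t := h.var y * (p.steps β + 3) + 1) (υ := τ) ?_)).mono ?_, ?_⟩
    · convert r using 2
      simp [State.setReg, hs.var]
    · have : h.var y * (p.steps β + 3) ≤ β * (p.steps β + 3) := Nat.mul_le_mul_right _ hyβ
      simp only [Cmd.steps]; omega
    · have key : ∀ m, loopEval p.eval x m (h.setVar x (h.var y)) = loopEval p.eval x m h := by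
        rintro (_ | m) <;> simp [loopEval, Env.setVar]
      rwa [key] at s

end RAM

namespace RAM

/-- The bound for the number of steps of a command as a polynomial. -/
noncomputable def Expr.stepsPoly : Expr → Polynomial ℕ
  | .lit _ => 1
  | .var _ => 2
  | .add e f => e.stepsPoly + f.stepsPoly + 1
  | .sub e f => e.stepsPoly + f.stepsPoly + 1
  | .mul e _ => e.stepsPoly + 3 * .X + 5
  | .inp e => e.stepsPoly + 3
  | .arr _ e => e.stepsPoly + 7

noncomputable def Cmd.stepsPoly : Cmd → Polynomial ℕ
  | .skip => 1
  | .assign _ e => e.stepsPoly + 2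
  | .put e f => e.stepsPoly + f.stepsPoly + 3
  | .set _ e f => e.stepsPoly + f.stepsPoly + 7
  | .seq p q => p.stepsPoly + q.stepsPoly
  | .ite e p q => e.stepsPoly + p.stepsPoly + q.stepsPoly + 1
  | .loop _ _ p => 3 + .X * (p.stepsPoly + 3)

theorem Expr.eval_stepsPoly (β : ℕ) (e : Expr) : e.stepsPoly.eval β = e.steps β := by
  induction e <;> simp [Expr.stepsPoly, Expr.steps, *]

theorem Cmd.eval_stepsPoly (β : ℕ) (p : Cmd) : p.stepsPoly.eval β = p.steps β := by
  induction p <;> simp [Cmd.stepsPoly, Cmd.steps, Expr.eval_stepsPoly, *]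

theorem eval_mono (q : Polynomial ℕ) {a b : ℕ} (h : a ≤ b) : q.eval a ≤ q.eval b := by
  rw [Polynomial.eval_eq_sum, Polynomial.eval_eq_sum]
  exact Finset.sum_le_sum fun i _ => Nat.mul_le_mul_left _ (Nat.pow_le_pow_left h i)

theorem length_le_bitLength (w : List ℕ) : w.length ≤ bitLength w := by
  induction w with
  | nil => simp
  | cons x w ih => simp only [bitLength, List.map_cons, List.sum_cons, List.length_cons] at *; omega

theorem size_le_bitLength {w : List ℕ} {x : ℕ} (hx : x ∈ w) : x.size ≤ bitLength w :=
  (Nat.le_succ _).trans (List.single_le_sum (fun _ _ => Nat.zero_le _) _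
    (List.mem_map.mpr ⟨x, hx, rfl⟩))

theorem size_le_self (x : ℕ) : x.size ≤ x := Nat.size_le.mpr Nat.lt_two_pow_self

theorem init_sizeLE (w : List ℕ) : (init w).SizeLE (bitLength w) := by
  refine ⟨fun x => ?_, fun a => ?_⟩
  · simp only [init]
    split_ifs
    · exact (size_le_self _).trans (length_le_bitLength w)
    · simp
  · simp only [init]
    by_cases h : a < w.length
    · rw [List.getD_eq_getElem _ _ h]; exact size_le_bitLength (List.getElem_mem h)
    · rw [List.getD_eq_default _ _ (not_lt.mp h)]; simp

/-- A sequence of assignments. -/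
def assignAll : List (ℕ × Expr) → Cmd
  | [] => .skip
  | (x, e) :: l => .seq (.assign x e) (assignAll l)

theorem run_assignAll : ∀ (l : List (ℕ × Expr)), (∀ a ∈ l, ∀ h, a.2.FactorsLE 0 h) →
    ∀ (h : Env) (σ : State), Sim h σ →
      ∃ τ, Run (assignAll l).compile σ ((assignAll l).steps 0) τ ∧ Sim ((assignAll l).eval h) τ
  | [], _, h, σ, hs =>
    ⟨_, Run.const _ _ _, hs.agree (.setReg (d := 0) _ _ (by omega) (by omega))⟩
  | (x, e) :: l, hl, h, σ, hs => by
    obtain ⟨τ, r1, s1⟩ := run_assign hs x (hl (x, e) (by simp) h)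
    obtain ⟨υ, r2, s2⟩ := run_assignAll l (fun a ha => hl a (by simp [ha])) _ τ s1
    exact ⟨υ, r1.seq r2, s2⟩

/-- The machine program that performs the assignments `l`, then the command `p`, and returns as
many cells as the variable `z` says. -/
def program (l : List (ℕ × Expr)) (p : Cmd) (z : ℕ) : Prog :=
  .seq (assignAll l).compile (.seq p.compile (.seq (.const 1 0) (.add 0 (2 * z + 2) 1)))

/-- A structured program, whose loop bounds are linear in the length of the input, runs in
polynomial time. -/
theorem exists_poly_computesWithin (l : List (ℕ × Expr)) (p : Cmd) (z : ℕ)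
    (hl : ∀ a ∈ l, ∀ h, a.2.FactorsLE 0 h) (hp : p.ok) :
    ∃ q : Polynomial ℕ, ∀ w : List ℕ,
      ((assignAll l).eval (Env.start w)).var 0 ≤ 2 * w.length + 2 →
      ((assignAll l).eval (Env.start w)).var 1 ≤ 2 * w.length + 2 →
      ((p.eval ((assignAll l).eval (Env.start w))).var z ≤ w.length) →
      ComputesWithin (program l p z) w ((List.range
        ((p.eval ((assignAll l).eval (Env.start w))).var z)).map
          (p.eval ((assignAll l).eval (Env.start w))).inp) (q.eval (bitLength w)) := by
  let s : Polynomial ℕ := Polynomial.C ((assignAll l).steps 0) + (p.stepsPoly.comp (2 * .X + 2) + 2)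
  let c := (program l p z).constSize
  refine ⟨s * (1 + 2 * (.X + .C c + s)), fun w h0 h1 hz => ?_⟩
  obtain ⟨τ, r1, s1⟩ := run_assignAll l hl _ _ (Sim.start w)
  obtain ⟨υ, r2, s2⟩ := p.run_compile hp _ τ h0 h1 s1
  have hs : (assignAll l).steps 0 + (p.steps (2 * w.length + 2) + (1 + 1)) ≤
      s.eval (bitLength w) := by
    simp only [s, Polynomial.eval_add, Polynomial.eval_C, Polynomial.eval_comp,
      ← Cmd.eval_stepsPoly, Polynomial.eval_mul, Polynomial.eval_X, Polynomial.eval_ofNat]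
    have := eval_mono p.stepsPoly (a := 2 * w.length + 2) (b := 2 * bitLength w + 2)
      (by have := length_le_bitLength w; omega)
    omega
  obtain ⟨_, t, ht, e⟩ := ((r1.seq (r2.seq ((Run.const _ _ _).seq (Run.add _ _ _ _)))).mono hs)
    (bitLength w + c) (Nat.le_add_left _ _) ((init_sizeLE w).mono (Nat.le_add_right _ _))
  refine ⟨t, _, e, by simpa using ht, ?_⟩
  have hlen : (p.eval ((assignAll l).eval (Env.start w))).len = w.length := by
    rw [Cmd.eval_len, Cmd.eval_len]; rfl
  simp only [output, State.setReg, Function.update_apply, if_true]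
  have hv := s2.var z
  rw [if_neg (by omega), hv, Nat.add_zero]
  refine List.map_congr_left fun a ha => s2.inp a ?_
  have := List.mem_range.mp ha
  omega

end RAM

/-! ## Matchings as involutions -/

section Matching

variable {V : Type*} {G : SimpleGraph V}

/-- A matching of `G`, given by the involution that exchanges the ends of its edges and fixes the
other vertices. -/
structure Mates (G : SimpleGraph V) (f : V → V) : Prop where
  inv : Function.Involutive f
  adj : ∀ x, f x ≠ x → G.Adj x (f x)

theorem Mates.id (G : SimpleGraph V) : Mates G id := ⟨fun _ => rfl, fun _ h => absurd rfl h⟩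

/-- Match `y` with `z`, and expose the former mate of `z`. -/
def exchange [DecidableEq V] (f : V → V) (y z : V) : V → V :=
  Function.update (Function.update (Function.update f z y) y z) (f z) (f z)

theorem exchange_apply [DecidableEq V] (f : V → V) (y z x : V) :
    exchange f y z x = if x = f z then f z else if x = y then z else if x = z then y else f x := by
  simp only [exchange, Function.update_apply]

theorem Mates.exchange_spec [DecidableEq V] {f : V → V} (hf : Mates G f) {y z : V} (hy : f y = y)
    (hz : f z ≠ z) (hyz : G.Adj y z) :
    Mates G (exchange f y z) ∧
      ∀ x, exchange f y z x = x ↔ x = f z ∨ (f x = x ∧ x ≠ y) := by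
  have hne := hyz.ne
  have h1 : f z ≠ y := fun h => hne (by rw [← hf.inv z, h, hy])
  have key : ∀ x, x ≠ f z → x ≠ y → x ≠ z → f x ≠ f z ∧ f x ≠ y ∧ f x ≠ z := by
    intro x a b c
    refine ⟨fun h => c (hf.inv.injective h), fun h => b ?_, fun h => a ?_⟩
    · rw [← hf.inv x, h, hy]
    · rw [← h, hf.inv]
  refine ⟨⟨fun x => ?_, fun x hx => ?_⟩, fun x => ?_⟩
  · by_cases a : x = f z
    · simp [exchange_apply, a]
    · by_cases b : x = y
      · subst b; simp [exchange_apply, a, hne.symm, hz.symm]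
      · by_cases c : x = z
        · subst c; simp [exchange_apply, a, b, h1.symm]
        · obtain ⟨a', b', c'⟩ := key x a b c
          simp [exchange_apply, a, b, c, a', b', c', hf.inv x]
  · rw [exchange_apply] at hx ⊢
    split_ifs at hx ⊢ with a b c
    · exact absurd a.symm hx
    · rw [b]; exact hyz
    · rw [c]; exact hyz.symm
    · exact hf.adj x hx
  · rw [exchange_apply]
    split_ifs with a b c
    · simp [a]
    · subst b; simp [a, hne.symm]
    · subst c; simp [a, hne, hz]
    · simp [a, b]

theorem Mates.join_spec [DecidableEq V] {f : V → V} (hf : Mates G f) {u v : V} (hu : f u = u) (hv : f v = v)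
    (huv : G.Adj u v) :
    Mates G (Function.update (Function.update f u v) v u) ∧
      ∀ x, Function.update (Function.update f u v) v u x = x ↔ f x = x ∧ x ≠ u ∧ x ≠ v := by
  have hne := huv.ne
  have key : ∀ x, x ≠ u → x ≠ v → f x ≠ u ∧ f x ≠ v := fun x a b =>
    ⟨fun h => a (by rw [← hf.inv x, h, hu]), fun h => b (by rw [← hf.inv x, h, hv])⟩
  refine ⟨⟨fun x => ?_, fun x hx => ?_⟩, fun x => ?_⟩
  · by_cases b : x = v
    · subst b; simp [hne]
    · by_cases a : x = u
      · subst a; simp [hne]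
      · obtain ⟨a', b'⟩ := key x a b
        simp [a, b, a', b', hf.inv x]
  · simp only [Function.update_apply] at hx ⊢
    split_ifs at hx ⊢ with a b
    · rw [a]; exact huv.symm
    · rw [b]; exact huv
    · exact hf.adj x hx
  · simp only [Function.update_apply]
    split_ifs with a b
    · subst a; simp [hne]
    · subst b; simp [hne.symm]
    · simp [a, b]

theorem even_card_of_involutive {S : Finset V} {f : V → V} (hf : Function.Involutive f)
    (hS : ∀ x ∈ S, f x ∈ S) (hne : ∀ x ∈ S, f x ≠ x) : Even S.card := by
  have h : ∑ x ∈ S, (1 : ZMod 2) = 0 :=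
    Finset.sum_involution (fun x _ => f x) (fun _ _ => by decide) (fun x hx _ => hne x hx) hS
      (fun x _ => hf x)
  rw [Finset.sum_const, nsmul_eq_mul, mul_one] at h
  exact (ZMod.natCast_eq_zero_iff_even).mp h

/-! ### The odd cycle of two matchings -/

section cycle

variable {a b : Equiv.Perm V}

theorem conj_zpow_of_involutive (ha : a * a = 1) (hb : b * b = 1) (k : ℤ) (x : V) :
    a (((a * b) ^ k) x) = ((a * b) ^ (-k)) (a x) ∧ b (((a * b) ^ k) x) = ((a * b) ^ (-k)) (b x) := by
  have ha' : a⁻¹ = a := inv_eq_of_mul_eq_one_right ha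
  have hb' : b⁻¹ = b := inv_eq_of_mul_eq_one_right hb
  have h1 : a * (a * b) * a⁻¹ = (a * b)⁻¹ := by
    rw [mul_inv_rev, ha', hb', ← mul_assoc, ha, one_mul]
  have h2 : b * (a * b) * b⁻¹ = (a * b)⁻¹ := by
    rw [mul_inv_rev, ha', hb', ← mul_assoc, mul_assoc, hb, mul_one]
  constructor
  · rw [zpow_neg, ← inv_zpow, ← h1, conj_zpow]; simp
  · rw [zpow_neg, ← inv_zpow, ← h2, conj_zpow]; simp

theorem zpow_apply_eq_iff {π : Equiv.Perm V} {v : V} {l : ℤ} (h : ∀ k : ℤ, (π ^ k) v = v ↔ l ∣ k)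
    (i j : ℤ) : (π ^ i) v = (π ^ j) v ↔ l ∣ i - j := by
  rw [← h, sub_eq_neg_add, zpow_add, Equiv.Perm.mul_apply, zpow_neg, Equiv.Perm.inv_eq_iff_eq]

theorem exists_odd_cycle [Finite V] (ha : a * a = 1) (hb : b * b = 1) {Y : V → Prop} {u v : V}
    (hau : ∀ x, a x = x ↔ x = u ∨ Y x) (hbv : ∀ x, b x = x ↔ x = v ∨ Y x) (huv : u ≠ v)
    (hv : a v ≠ v) :
    ∃ q : ℕ, 0 < q ∧ (∀ k : ℤ, ((a * b) ^ k) v = v ↔ ((2 * q + 1 : ℕ) : ℤ) ∣ k) ∧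
      ((a * b) ^ (q + 1 : ℤ)) v = u ∧ ∀ k : ℤ, ¬ Y (((a * b) ^ k) v) := by
  have hbv' : b v = v := (hbv v).2 (.inl rfl)
  have hY : ∀ k : ℤ, ¬ Y (((a * b) ^ k) v) := by
    intro k hk
    have h1 := (hau _).2 (.inr hk)
    have h2 := (hbv _).2 (.inr hk)
    have h3 : (a * b) (((a * b) ^ k) v) = ((a * b) ^ k) v := by rw [Equiv.Perm.mul_apply, h2, h1]
    rw [← Equiv.Perm.mul_apply, ← zpow_one_add, add_comm, zpow_add_one, Equiv.Perm.mul_apply] at h3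
    have h4 := Equiv.injective _ h3
    rw [Equiv.Perm.mul_apply, hbv'] at h4
    exact hv h4
  have hper : ∀ k : ℤ, ((a * b) ^ k) v = v ↔
      ((Function.minimalPeriod (fun x => (a * b) • x) v : ℕ) : ℤ) ∣ k := fun k =>
    MulAction.zpow_smul_eq_iff_minimalPeriod_dvd (a := a * b) (b := v) (n := k)
  have hpos : 0 < Function.minimalPeriod (fun x => (a * b) • x) v := by
    rw [Function.minimalPeriod_pos_iff_mem_periodicPts]
    exact (MulAction.injective (a * b)).mem_periodicPts v
  generalize Function.minimalPeriod (fun x => (a * b) • x) v = l at hper hpos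
  obtain ⟨h, rfl⟩ | ⟨q, rfl⟩ := Nat.even_or_odd l
  · exfalso
    have h1 : b (((a * b) ^ (h : ℤ)) v) = ((a * b) ^ (h : ℤ)) v := by
      rw [(conj_zpow_of_involutive ha hb _ _).2, hbv', zpow_apply_eq_iff hper]
      exact ⟨-1, by push_cast; ring⟩
    rcases (hbv _).1 h1 with h2 | h2
    · rw [hper] at h2
      have := Int.le_of_dvd (by omega) h2
      push_cast at this; omega
    · exact hY _ h2
  · have h1 : a (((a * b) ^ (q + 1 : ℤ)) v) = ((a * b) ^ (q + 1 : ℤ)) v := by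
      have h2 : a v = ((a * b) ^ (1 : ℤ)) v := by rw [zpow_one, Equiv.Perm.mul_apply, hbv']
      rw [(conj_zpow_of_involutive ha hb _ _).1, h2, ← Equiv.Perm.mul_apply, ← zpow_add,
        zpow_apply_eq_iff hper]
      exact ⟨-1, by push_cast; ring⟩
    rcases (hau _).1 h1 with h2 | h2
    · refine ⟨q, Nat.pos_of_ne_zero ?_, hper, h2, hY⟩
      rintro rfl
      refine huv (h2.symm.trans ((hper _).2 (by simp)))
    · exact absurd h2 (hY _)

end cycle

end Matching

/-! ## Alternating forests -/

section Forest

variable {V : Type*} {G : SimpleGraph V}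

/-- `D` is a set of vertices that are reached from the exposed vertex `r` of the matching `f` by
even alternating paths. For `u ∈ D`, the matching `m u` arises by exchanging the edges of such a
path. The set `D` is divided into blossoms by `cls`, and `p` assigns to the vertices outside `D`
that occur on the paths their predecessors. -/
structure Forest (G : SimpleGraph V) (f : V → V) (r : V) (D : Finset V) (m : V → V → V)
    (cls p : V → V) : Prop where
  root : r ∈ D
  root_eq : m r = f
  mates : ∀ u ∈ D, Mates G (m u)
  fixed : ∀ u ∈ D, ∀ x, m u x = x ↔ x = u ∨ (f x = x ∧ x ≠ r)
  exposed : ∀ x ∈ D, f x = x → x = r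
  cls_mem : ∀ x ∈ D, cls x ∈ D
  same : ∀ u ∈ D, ∀ x ∈ D, m u x ∈ D → cls (m u x) = cls x
  base : ∀ u ∈ D, ∀ x ∈ D, ∃! e, e ∈ D ∧ cls e = cls x ∧ (e = u ∨ m u e ∉ D)
  out : ∀ u ∈ D, ∀ x ∉ D, m u x = f x ∨ (m u x = p x ∧ p x ∈ D ∧ f x ∈ D)

variable {f : V → V} {r : V} {D : Finset V} {m : V → V → V} {cls p : V → V}

theorem Forest.base_unique (h : Forest G f r D m cls p) {u e e' : V} (hu : u ∈ D) (he : e ∈ D)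
    (he' : e' ∈ D) (hc : cls e = cls e') (h1 : e = u ∨ m u e ∉ D) (h2 : e' = u ∨ m u e' ∉ D) :
    e = e' :=
  (h.base u hu e he).unique ⟨he, rfl, h1⟩ ⟨he', hc.symm, h2⟩

theorem Forest.init (hf : Mates G f) (hr : f r = r) :
    Forest G f r {r} (fun _ => f) id id where
  root := by simp
  root_eq := rfl
  mates _ _ := hf
  fixed u hu x := by
    rw [Finset.mem_singleton] at hu; subst hu
    constructor
    · intro hx; tauto
    · rintro (rfl | ⟨hx, -⟩) <;> assumption
  exposed x hx _ := by simpa using hx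
  cls_mem x hx := hx
  same u _ x hx hm := by simp only [Finset.mem_singleton, id] at *; rw [hm, hx]
  base u hu x hx := by
    simp only [Finset.mem_singleton, id] at *
    subst hu hx
    exact ⟨_, ⟨rfl, rfl, .inl rfl⟩, fun y hy => hy.1⟩
  out u _ x _ := .inl rfl

/-- Enlarge the forest by an exposed edge and a matching edge. -/
theorem Forest.grow [DecidableEq V] (h : Forest G f r D m cls p) {u v : V} (hu : u ∈ D)
    (huv : G.Adj u v) (hv : v ∉ D) (hne : m u v ≠ v) (hw : m u v ∉ D) {m' : V → V → V}
    (hm : ∀ x ∈ D, m' x = m x) (hm' : m' (m u v) = exchange (m u) u v) :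
    ∃ cls' p', Forest G f r (insert (m u v) D) m' cls' p' := by
  have hfv : m u v = f v := by
    rcases h.out u hu v hv with e | ⟨e, hp, -⟩
    · exact e
    · exact absurd (e ▸ hp) hw
  have huu : m u u = u := (h.fixed u hu u).2 (.inl rfl)
  obtain ⟨hC, hCf⟩ := (h.mates u hu).exchange_spec huu hne huv
  generalize hwd : m u v = w at *
  have hCa : ∀ x, m' w x = if x = w then w else if x = u then v else if x = v then u else m u x := by
    intro x; rw [hm', exchange_apply, hwd]
  have hwv : m u w = v := by rw [← hwd]; exact (h.mates u hu).inv v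
  -- all matchings agree at the new vertices
  have hDw : ∀ x ∈ D, m x w = v := by
    intro x hx
    have hfw : f w = v := by
      rw [hfv]; have := (h.mates r h.root).inv v; rwa [h.root_eq] at this
    rcases h.out x hx w hw with e | ⟨-, -, e⟩
    · rw [e, hfw]
    · exact absurd (hfw ▸ e) hv
  have hDv : ∀ x ∈ D, m x v = w := fun x hx => by rw [← hDw x hx, (h.mates x hx).inv]
  have hD1 : ∀ x ∈ D, ∀ y, m x y = w → y = v := fun x hx y e => by
    rw [← hDw x hx, ← e, (h.mates x hx).inv]
  have hwu : w ≠ u := fun e => hw (e ▸ hu)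
  have hvu : v ≠ u := fun e => hv (e ▸ hu)
  have hD2 : ∀ x ∈ D, x ≠ w := fun x hx e => hw (e ▸ hx)
  have hD3 : ∀ x ∈ D, x ≠ v := fun x hx e => hv (e ▸ hx)
  refine ⟨Function.update cls w w, Function.update p v u, ?_⟩
  have hcl : ∀ x ∈ D, Function.update cls w w x = cls x := fun x hx => by
    simp [hD2 x hx]
  have hcw : ∀ x ∈ D, cls x ≠ w := fun x hx e => hw (e ▸ h.cls_mem x hx)
  have hCD : ∀ x ∈ D, x ≠ u → m' w x = m u x := fun x hx e => by
    rw [hCa, if_neg (hD2 x hx), if_neg e, if_neg (hD3 x hx)]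
  have hv' : v ∉ insert w D := by simp [hv, hne.symm]
  have hCw : m' w w = w := by rw [hCa, if_pos rfl]
  have hCu : m' w u = v := by rw [hCa, if_neg hwu.symm, if_pos rfl]
  constructor
  · exact Finset.mem_insert_of_mem h.root
  · rw [hm r h.root, h.root_eq]
  · intro x hx
    rcases Finset.mem_insert.1 hx with rfl | hx
    · rw [hm']; exact hC
    · rw [hm x hx]; exact h.mates x hx
  · intro x hx y
    rcases Finset.mem_insert.1 hx with rfl | hx
    · rw [hm', hCf, h.fixed u hu]
      constructor
      · rintro (e | ⟨e | e, e'⟩)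
        · exact .inl e
        · exact absurd e e'
        · exact .inr e
      · rintro (e | e)
        · exact .inl e
        · refine .inr ⟨.inr e, ?_⟩
          rintro rfl
          exact e.2 (h.exposed _ hu e.1)
    · rw [hm x hx]; exact h.fixed x hx y
  · intro x hx e
    rcases Finset.mem_insert.1 hx with rfl | hx
    · exfalso
      have := hDw r h.root
      rw [h.root_eq, e] at this
      exact hne this
    · exact h.exposed x hx e
  · intro x hx
    rcases Finset.mem_insert.1 hx with rfl | hx
    · simp
    · rw [hcl x hx]; exact Finset.mem_insert_of_mem (h.cls_mem x hx)
  · intro x hx y hy hxy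
    rcases Finset.mem_insert.1 hx with rfl | hx
    · rcases Finset.mem_insert.1 hy with rfl | hy
      · rw [hCw]
      · by_cases e : y = u
        · subst e; rw [hCu] at hxy; exact absurd hxy hv'
        · rw [hCD y hy e] at hxy ⊢
          rcases Finset.mem_insert.1 hxy with e' | hxy
          · exact absurd (hD1 u hu y e') (hD3 y hy)
          · rw [hcl _ hxy, hcl _ hy, h.same u hu y hy hxy]
    · rw [hm x hx] at hxy ⊢
      rcases Finset.mem_insert.1 hy with rfl | hy
      · rw [hDw x (by assumption)] at hxy; exact absurd hxy hv'
      · rcases Finset.mem_insert.1 hxy with e' | hxy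
        · exact absurd (hD1 x hx y e') (hD3 y hy)
        · rw [hcl _ hxy, hcl _ hy, h.same x hx y hy hxy]
  · intro x hx y hy
    rcases Finset.mem_insert.1 hy with rfl | hyD
    · refine ⟨y, ⟨hy, rfl, ?_⟩, ?_⟩
      · rcases Finset.mem_insert.1 hx with rfl | hxD
        · exact .inl rfl
        · rw [hm x hxD, hDw x hxD]; exact .inr hv'
      · rintro e ⟨he, hce, -⟩
        rcases Finset.mem_insert.1 he with rfl | he
        · rfl
        · rw [hcl e he] at hce; simp at hce; exact absurd hce (hcw e he)
    · rw [hcl y hyD]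
      have key : ∃ x0 ∈ D, ∀ e ∈ D, (e = x ∨ m' x e ∉ insert w D) ↔ (e = x0 ∨ m x0 e ∉ D) := by
        rcases Finset.mem_insert.1 hx with rfl | hx
        · refine ⟨u, hu, fun e he => ?_⟩
          by_cases heu : e = u
          · subst heu; simp [hCu, hv']
          · rw [hCD e he heu]
            have : m u e ≠ x := fun e' => hD3 e he (hD1 u hu e e')
            simp [hD2 e he, heu, this]
        · refine ⟨x, hx, fun e he => ?_⟩
          rw [hm x hx]
          have : m x e ≠ w := fun e' => hD3 e he (hD1 x hx e e')
          simp [this]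
      obtain ⟨x0, hx0, key⟩ := key
      obtain ⟨e, ⟨he, hce, he'⟩, huniq⟩ := h.base x0 hx0 y hyD
      refine ⟨e, ⟨Finset.mem_insert_of_mem he, by rw [hcl e he, hce], (key e he).2 he'⟩, ?_⟩
      rintro e1 ⟨h1, h2, h3⟩
      rcases Finset.mem_insert.1 h1 with rfl | h1
      · simp at h2; exact absurd h2.symm (hcw y hyD)
      · exact huniq e1 ⟨h1, by rw [← h2, hcl e1 h1], (key e1 h1).1 h3⟩
  · intro x hx y hy
    have hy1 : y ≠ w := fun e => hy (e ▸ Finset.mem_insert_self _ _)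
    have hy2 : y ∉ D := fun e => hy (Finset.mem_insert_of_mem e)
    by_cases hyv : y = v
    · subst hyv
      rcases Finset.mem_insert.1 hx with rfl | hx
      · right
        rw [hCa, if_neg hy1, if_neg hvu, if_pos rfl, ← hfv]
        simp [hu]
      · left; rw [hm x hx, hDv x hx, hfv]
    · have hins : ∀ {a}, a ∈ D → a ∈ insert w D := fun ha => Finset.mem_insert_of_mem ha
      have : Function.update p v u y = p y := by simp [hyv]
      rw [this]
      rcases Finset.mem_insert.1 hx with rfl | hx
      · rw [hCa, if_neg hy1, if_neg (fun e : y = u => hy2 (e ▸ hu)), if_neg hyv]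
        exact (h.out u hu y hy2).imp_right fun e => ⟨e.1, hins e.2.1, hins e.2.2⟩
      · rw [hm x hx]
        exact (h.out x hx y hy2).imp_right fun e => ⟨e.1, hins e.2.1, hins e.2.2⟩

/-- If the forest cannot be enlarged, then there is no perfect matching. -/
theorem Forest.not_perfect [Finite V] (h : Forest G f r D m cls p)
    (hD : ∀ u ∈ D, ∀ v, G.Adj u v →
      (v ∉ D → m u v ∈ D) ∧ (v ∈ D → cls u = cls v)) :
    ¬ ∃ g, Mates G g ∧ ∀ x, g x ≠ x := by
  classical
  have := Fintype.ofFinite V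
  rintro ⟨g, hg, hgne⟩
  have hinv := (h.mates r h.root).inv
  -- every blossom has a vertex that `g` matches to a vertex outside `D`
  have h1 : ∀ c ∈ D.image cls, ∃ x ∈ D, cls x = c ∧ g x ∉ D := by
    intro c hc
    obtain ⟨x0, hx0, rfl⟩ := Finset.mem_image.1 hc
    by_contra! hcon
    obtain ⟨e, ⟨he, hce, he'⟩, huniq⟩ := h.base r h.root x0 hx0
    let K := D.filter fun x => cls x = cls x0
    have heK : e ∈ K := by simp [K, he, hce]
    have e1 : Even K.card := by
      refine even_card_of_involutive hg.inv (fun x hx => ?_) (fun x _ => hgne x)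
      simp only [K, Finset.mem_filter] at hx ⊢
      have hgx := hcon x hx.1 hx.2
      exact ⟨hgx, by rw [← (hD x hx.1 (g x) (hg.adj x (hgne x))).2 hgx, hx.2]⟩
    have e2 : Even (K.erase e).card := by
      have hK : ∀ x ∈ K.erase e, x ≠ r ∧ m r x ∈ K := by
        intro x hx
        simp only [K, Finset.mem_erase, Finset.mem_filter] at hx ⊢
        have : ¬ (x = r ∨ m r x ∉ D) := fun hx' => hx.1 (huniq x ⟨hx.2.1, hx.2.2, hx'⟩)
        push Not at this
        exact ⟨this.1, this.2, by rw [h.same r h.root x hx.2.1 this.2, hx.2.2]⟩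
      refine even_card_of_involutive hinv (fun x hx => ?_) (fun x hx hfx => ?_)
      · refine Finset.mem_erase.2 ⟨fun e' => ?_, (hK x hx).2⟩
        rcases he' with he' | he'
        · subst he'
          have h2 := hinv x
          rw [e', (h.fixed _ h.root _).2 (.inl rfl)] at h2
          exact (Finset.mem_erase.1 hx).1 h2.symm
        · rw [← e', hinv] at he'
          exact he' (Finset.mem_filter.1 (Finset.mem_erase.1 hx).2).1
      · rw [h.root_eq] at hfx
        exact (hK x hx).1 (h.exposed x (Finset.mem_filter.1 (Finset.mem_erase.1 hx).2).1 hfx)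
    rw [Finset.card_erase_of_mem heK] at e2
    have : 0 < K.card := Finset.card_pos.2 ⟨e, heK⟩
    obtain ⟨s, hs⟩ := e1
    obtain ⟨t, ht⟩ := e2
    omega
  choose! b hb using h1
  -- the mates outside `D`
  let A := (D.image cls).image fun c => g (b c)
  have hA : A.card = (D.image cls).card := by
    refine Finset.card_image_of_injOn fun c hc c' hc' e => ?_
    rw [← (hb c hc).2.1, ← (hb c' hc').2.1, hg.inv.injective e]
  have hAD : ∀ x ∈ A, x ∉ D ∧ m r x ∈ D := by
    intro x hx
    obtain ⟨c, hc, rfl⟩ := Finset.mem_image.1 hx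
    obtain ⟨hb1, hb2, hb3⟩ := hb c hc
    refine ⟨hb3, ?_⟩
    rw [h.root_eq]
    have := (hD _ hb1 _ (hg.adj _ (hgne _))).1 hb3
    rcases h.out _ hb1 _ hb3 with e | ⟨-, -, e⟩
    · rwa [← e]
    · exact e
  have hlt : (A.image fun x => cls (m r x)).card < (D.image cls).card := by
    refine Finset.card_lt_card ⟨fun c hc => ?_, fun hsub => ?_⟩
    · obtain ⟨x, hx, rfl⟩ := Finset.mem_image.1 hc
      exact Finset.mem_image_of_mem _ (hAD x hx).2
    · obtain ⟨x, hx, hxr⟩ := Finset.mem_image.1 (hsub (Finset.mem_image_of_mem cls h.root))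
      have : m r x = r := h.base_unique h.root (hAD x hx).2 h.root hxr
        (.inr (by rw [hinv]; exact (hAD x hx).1)) (.inl rfl)
      have h2 : x = m r r := by rw [← hinv x, this]
      rw [(h.fixed r h.root r).2 (.inl rfl)] at h2
      exact (hAD x hx).1 (h2 ▸ h.root)
  rw [Finset.card_image_of_injOn, hA] at hlt
  · exact lt_irrefl _ hlt
  · intro x hx y hy hxy
    exact hinv.injective (h.base_unique h.root (hAD x hx).2 (hAD y hy).2 hxy
      (.inr (by rw [hinv]; exact (hAD x hx).1)) (.inr (by rw [hinv]; exact (hAD y hy).1)))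

end Forest

section Blossom

variable {V : Type*} {G : SimpleGraph V} {f : V → V} {r : V} {D : Finset V} {m : V → V → V}
  {cls p : V → V}

/-- The odd cycle that two adjacent vertices `u` and `v` of a forest close: its vertices are
`π ^ k v` for `π = a * b`, where `a` and `b` are the matchings that expose `u` and `v`. -/
structure OddCycle (f : V → V) (r : V) (m : V → V → V) (u v : V) (a b : Equiv.Perm V) (q : ℕ) :
    Prop where
  left : ∀ x, a x = m u x
  right : ∀ x, b x = m v x
  conj_left : ∀ (k : ℤ) x, a (((a * b) ^ k) x) = ((a * b) ^ (-k)) (a x)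
  conj_right : ∀ (k : ℤ) x, b (((a * b) ^ k) x) = ((a * b) ^ (-k)) (b x)
  left_eq : a v = ((a * b) ^ (1 : ℤ)) v
  right_eq : b v = v
  pos : 0 < q
  period : ∀ i j : ℤ, ((a * b) ^ i) v = ((a * b) ^ j) v ↔ ((2 * q + 1 : ℕ) : ℤ) ∣ i - j
  last : ((a * b) ^ (q + 1 : ℤ)) v = u
  covered : ∀ k : ℤ, ¬ (f (((a * b) ^ k) v) = ((a * b) ^ k) v ∧ ((a * b) ^ k) v ≠ r)

theorem Forest.exists_oddCycle [Finite V] (h : Forest G f r D m cls p) {u v : V} (hu : u ∈ D)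
    (hv : v ∈ D) (huv : u ≠ v) (hne : m u v ≠ v) : ∃ a b q, OddCycle f r m u v a b q := by
  have ha : (h.mates u hu).inv.toPerm * (h.mates u hu).inv.toPerm = 1 :=
    Equiv.ext fun x => (h.mates u hu).inv x
  have hb : (h.mates v hv).inv.toPerm * (h.mates v hv).inv.toPerm = 1 :=
    Equiv.ext fun x => (h.mates v hv).inv x
  obtain ⟨q, h1, h2, h3, h4⟩ := exists_odd_cycle ha hb (h.fixed u hu) (h.fixed v hv) huv hne
  refine ⟨_, _, q, fun _ => rfl, fun _ => rfl, fun k x => (conj_zpow_of_involutive ha hb k x).1,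
    fun k x => (conj_zpow_of_involutive ha hb k x).2, ?_, (h.fixed v hv v).2 (.inl rfl), h1,
    zpow_apply_eq_iff h2, h3, h4⟩
  rw [zpow_one, Equiv.Perm.mul_apply]
  congr 1
  exact ((h.fixed v hv v).2 (.inl rfl)).symm

namespace OddCycle

variable {u v : V} {a b : Equiv.Perm V} {q : ℕ}

/-- `x` is a vertex of the cycle. -/
def On (a b : Equiv.Perm V) (v x : V) : Prop := ∃ k : ℤ, x = ((a * b) ^ k) v

theorem on_right (a b : Equiv.Perm V) (v : V) : On a b v v := ⟨0, by simp⟩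

theorem left_apply (c : OddCycle f r m u v a b q) (k : ℤ) :
    m u (((a * b) ^ k) v) = ((a * b) ^ (1 - k)) v := by
  rw [← c.left, c.conj_left, c.left_eq, ← Equiv.Perm.mul_apply, ← zpow_add]
  congr 2; ring

theorem right_apply (c : OddCycle f r m u v a b q) (k : ℤ) :
    m v (((a * b) ^ k) v) = ((a * b) ^ (-k)) v := by
  rw [← c.right, c.conj_right, c.right_eq]

theorem on_left (c : OddCycle f r m u v a b q) : On a b v u := ⟨_, c.last.symm⟩

theorem on_left_apply (c : OddCycle f r m u v a b q) {x : V} (hx : On a b v x) :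
    On a b v (m u x) := by
  obtain ⟨k, rfl⟩ := hx; exact ⟨_, c.left_apply k⟩

theorem on_right_apply (c : OddCycle f r m u v a b q) {x : V} (hx : On a b v x) :
    On a b v (m v x) := by
  obtain ⟨k, rfl⟩ := hx; exact ⟨_, c.right_apply k⟩

theorem ne_apply (c : OddCycle f r m u v a b q) {x : V} (hx : On a b v x) : m u x ≠ m v x := by
  obtain ⟨k, rfl⟩ := hx
  rw [c.left_apply, c.right_apply, Ne, c.period]
  have := c.pos
  intro h
  have := Int.le_of_dvd (by omega) h
  push_cast at this; omega

/-- A nonempty set of vertices of the cycle that is closed under both matchings is everything. -/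
theorem closed_induction (c : OddCycle f r m u v a b q) {P : V → Prop}
    (ha : ∀ x, P x → P (m u x)) (hb : ∀ x, P x → P (m v x)) {x y : V} (hx : On a b v x)
    (hy : On a b v y) (h : P x) : P y := by
  obtain ⟨i, rfl⟩ := hx
  obtain ⟨j, rfl⟩ := hy
  have up : ∀ i : ℤ, P (((a * b) ^ i) v) → P (((a * b) ^ (i + 1)) v) := fun i hi => by
    have := ha _ (hb _ hi)
    rw [c.right_apply, c.left_apply] at this
    convert this using 3; ring
  have down : ∀ i : ℤ, P (((a * b) ^ i) v) → P (((a * b) ^ (i - 1)) v) := fun i hi => by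
    have := hb _ (ha _ hi)
    rw [c.left_apply, c.right_apply] at this
    convert this using 3; ring
  have key : ∀ n : ℕ, P (((a * b) ^ (i + n)) v) ∧ P (((a * b) ^ (i - n)) v) := by
    intro n
    induction n with
    | zero => simpa using h
    | succ n ih =>
      refine ⟨?_, ?_⟩
      · have := up _ ih.1; push_cast; rwa [← add_assoc]
      · have := down _ ih.2; push_cast; rwa [← sub_sub]
  obtain ⟨n, hn | hn⟩ := (j - i).eq_nat_or_neg
  · have := (key n).1; rwa [show i + n = j by omega] at this
  · have := (key n).2; rwa [show i - n = j by omega] at this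

end OddCycle

open OddCycle

variable {u v : V} {a b : Equiv.Perm V} {q : ℕ}

/-- A vertex of the odd cycle outside `D` is always matched to vertices of the cycle in `D`. -/
theorem Forest.cycle_out (h : Forest G f r D m cls p) (c : OddCycle f r m u v a b q)
    (hu : u ∈ D) (hv : v ∈ D) {x w : V} (hx : On a b v x) (hxD : x ∉ D) (hw : w ∈ D) :
    On a b v (m w x) ∧ m w x ∈ D := by
  have h1 := c.ne_apply hx
  have h2 := c.on_left_apply hx
  have h3 := c.on_right_apply hx
  have h4 := h.out u hu x hxD
  have h5 := h.out v hv x hxD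
  have key : On a b v (f x) ∧ f x ∈ D ∧ On a b v (p x) ∧ p x ∈ D := by
    rcases h4 with e | ⟨e, e', e''⟩ <;> rcases h5 with g | ⟨g, g', g''⟩
    · exact absurd (e.trans g.symm) h1
    · exact ⟨e ▸ h2, g'', g ▸ h3, g'⟩
    · exact ⟨g ▸ h3, e'', e ▸ h2, e'⟩
    · exact absurd (e.trans g.symm) h1
  rcases h.out w hw x hxD with e | ⟨e, -, -⟩
  · rw [e]; exact ⟨key.1, key.2.1⟩
  · rw [e]; exact ⟨key.2.2.1, key.2.2.2⟩

/-- In a blossom that the odd cycle meets, the vertex that `m u` matches to the outside is on the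
cycle. -/
theorem Forest.cycle_base [Finite V] (h : Forest G f r D m cls p) (c : OddCycle f r m u v a b q)
    (hu : u ∈ D) (hv : v ∈ D) {y e : V} (hy : On a b v y) (hyD : y ∈ D) (hyu : cls y ≠ cls u)
    (he : e ∈ D) (hey : cls e = cls y) (heD : m u e ∉ D) : On a b v e := by
  classical
  have := Fintype.ofFinite V
  by_contra hcon
  have ha := (h.mates u hu).inv
  have hb := (h.mates v hv).inv
  let S := D.filter fun x => On a b v x ∧ cls x = cls y
  have hS : ∀ x, x ∈ S ↔ x ∈ D ∧ On a b v x ∧ cls x = cls y := by simp [S]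
  have hSa : ∀ x ∈ S, m u x ∈ S := by
    intro x hx
    obtain ⟨h1, h2, h3⟩ := (hS x).1 hx
    have h4 : m u x ∈ D := by
      by_contra h4
      have := h.base_unique hu he h1 (hey.trans h3.symm) (.inr heD) (.inr h4)
      exact hcon (this ▸ h2)
    exact (hS _).2 ⟨h4, c.on_left_apply h2, (h.same u hu x h1 h4).trans h3⟩
  have hcov : ∀ x, On a b v x → ¬ (f x = x ∧ x ≠ r) := by
    rintro x ⟨k, rfl⟩; exact c.covered k
  obtain ⟨e', ⟨he', hey', heD'⟩, huniq⟩ := h.base v hv y hyD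
  have hyS : y ∈ S := (hS y).2 ⟨hyD, hy, rfl⟩
  by_cases heS : e' ∈ S
  · have h1 : Even S.card := by
      refine even_card_of_involutive ha hSa fun x hx hxx => ?_
      obtain ⟨-, h2, h3⟩ := (hS x).1 hx
      rcases (h.fixed u hu x).1 hxx with rfl | h4
      · exact hyu h3.symm
      · exact hcov x h2 h4
    have h2 : Even (S.erase e').card := by
      have hb' : ∀ x ∈ S.erase e', x ≠ v ∧ m v x ∈ S := by
        intro x hx
        obtain ⟨h1, hx⟩ := Finset.mem_erase.1 hx
        obtain ⟨h2, h3, h4⟩ := (hS x).1 hx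
        have : ¬ (x = v ∨ m v x ∉ D) := fun h5 => h1 (huniq x ⟨h2, h4, h5⟩)
        push Not at this
        exact ⟨this.1, (hS _).2 ⟨this.2, c.on_right_apply h3, (h.same v hv x h2 this.2).trans h4⟩⟩
      refine even_card_of_involutive hb (fun x hx => ?_) fun x hx hxx => ?_
      · refine Finset.mem_erase.2 ⟨fun h3 => ?_, (hb' x hx).2⟩
        rcases heD' with h4 | h4
        · have := hb x
          rw [h3, h4, (h.fixed v hv v).2 (.inl rfl)] at this
          exact (hb' x hx).1 this.symm
        · rw [← h3, hb] at h4
          exact h4 ((hS x).1 (Finset.mem_of_mem_erase hx)).1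
      · rcases (h.fixed v hv x).1 hxx with h3 | h3
        · exact (hb' x hx).1 h3
        · exact hcov x ((hS x).1 (Finset.mem_of_mem_erase hx)).2.1 h3
    rw [Finset.card_erase_of_mem heS] at h2
    have : 0 < S.card := Finset.card_pos.2 ⟨_, heS⟩
    obtain ⟨s, hs⟩ := h1
    obtain ⟨t, ht⟩ := h2
    omega
  · have hSb : ∀ x ∈ S, m v x ∈ S := by
      intro x hx
      obtain ⟨h1, h2, h3⟩ := (hS x).1 hx
      have h4 : m v x ∈ D := by
        by_contra h4
        exact heS ((huniq x ⟨h1, h3, .inr h4⟩) ▸ hx)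
      exact (hS _).2 ⟨h4, c.on_right_apply h2, (h.same v hv x h1 h4).trans h3⟩
    have := c.closed_induction (P := (· ∈ S)) hSa hSb hy c.on_left hyS
    exact hyu ((hS u).1 this).2.2.symm

/-- If the odd cycle lies in `D`, then it lies in one blossom. -/
theorem Forest.cls_eq_of_cycle_subset [Finite V] (h : Forest G f r D m cls p)
    (c : OddCycle f r m u v a b q) (hu : u ∈ D) (hv : v ∈ D) (hD : ∀ x, On a b v x → x ∈ D) :
    cls u = cls v := by
  by_contra hne
  obtain ⟨e, ⟨he, hev, he'⟩, -⟩ := h.base u hu v hv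
  have heD : m u e ∉ D := he'.resolve_left fun e' => hne (by rw [← hev, e'])
  exact heD (hD _ (c.on_left_apply
    (h.cycle_base c hu hv (on_right a b v) hv (Ne.symm hne) he hev heD)))

/-- The vertices at even distance from `u` on the odd cycle, up to `v`, belong to `D`. -/
theorem Forest.cycle_even (h : Forest G f r D m cls p) (c : OddCycle f r m u v a b q)
    (hu : u ∈ D) (hv : v ∈ D) : ∀ i : ℕ, i ≤ q → ((a * b) ^ (q + 1 + i : ℤ)) v ∈ D ∧
      ∃ j : ℕ, j ≤ i ∧ ((a * b) ^ (q + 1 + j : ℤ)) v ∈ D ∧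
        cls (((a * b) ^ (q + 1 + j : ℤ)) v) = cls (((a * b) ^ (q + 1 + i : ℤ)) v) ∧
        (((a * b) ^ (q + 1 + j : ℤ)) v = u ∨ m u (((a * b) ^ (q + 1 + j : ℤ)) v) ∉ D)
  | 0, _ => by
    have e : ((a * b) ^ (q + 1 + (0 : ℕ) : ℤ)) v = u := by rw [← c.last]; simp
    rw [e]
    exact ⟨hu, 0, le_rfl, by rw [e]; exact hu, by rw [e], .inl e⟩
  | i + 1, hi => by
    obtain ⟨h1, j, hj, h2, h3, h4⟩ := h.cycle_even c hu hv i (by omega)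
    -- the next two vertices
    let s := ((a * b) ^ (q + 1 + i : ℤ)) v
    have hs : On a b v s := ⟨_, rfl⟩
    have ht : m v s = ((a * b) ^ (-(q + 1 + i) : ℤ)) v := c.right_apply _
    have hn : ((a * b) ^ (q + 1 + (i + 1 : ℕ) : ℤ)) v = m u (m v s) := by
      rw [ht, c.left_apply]; congr 2; push_cast; ring
    rw [hn]
    have hinv := (h.mates u hu).inv
    by_cases htD : m v s ∈ D
    · have hcls := h.same v hv s h1 htD
      have hnot : ¬ (m v s = u ∨ m u (m v s) ∉ D) := by
        intro h5
        have h6 := h.base_unique hu h2 htD (h3.trans hcls.symm) h4 h5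
        rw [ht, c.period] at h6
        obtain ⟨k, hk⟩ := h6
        have hk' : (2 * (q + 1) + i + j : ℤ) = (2 * q + 1) * k := by
          rw [← sub_eq_zero] at hk ⊢; rw [← hk]; push_cast; ring
        have hk1 : 1 < k := by
          by_contra hk1
          have : ((2 * q + 1) * k : ℤ) ≤ (2 * q + 1) * 1 :=
            mul_le_mul_of_nonneg_left (by omega) (by omega)
          omega
        have : ((2 * q + 1) * 2 : ℤ) ≤ (2 * q + 1) * k :=
            mul_le_mul_of_nonneg_left (by omega) (by omega)
        omega
      push Not at hnot
      refine ⟨hnot.2, j, by omega, h2, ?_, h4⟩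
      rw [h3, ← hcls, h.same u hu _ htD hnot.2]
    · have h5 := h.cycle_out c hu hv (c.on_right_apply hs) htD hu
      refine ⟨h5.2, i + 1, le_rfl, ?_⟩
      rw [hn]
      exact ⟨h5.2, rfl, .inr (by rwa [hinv])⟩

/-- The vertices of the odd cycle outside `D` are at odd distance from `u`. -/
theorem Forest.cycle_mem (h : Forest G f r D m cls p) (c : OddCycle f r m u v a b q)
    (hu : u ∈ D) (hv : v ∈ D) {x : V} (hx : On a b v x) :
    x ∈ D ∨ ∃ i : ℕ, 1 ≤ i ∧ i ≤ q ∧ x = ((a * b) ^ (i : ℤ)) v := by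
  obtain ⟨k, rfl⟩ := hx
  have h0 : (0 : ℤ) < ((2 * q + 1 : ℕ) : ℤ) := by omega
  have h1 := Int.emod_nonneg k h0.ne'
  have h2 := Int.emod_lt_of_pos k h0
  have h3 : ((a * b) ^ k) v = ((a * b) ^ (k % ((2 * q + 1 : ℕ) : ℤ))) v := by
    rw [c.period]; exact Int.dvd_self_sub_emod
  obtain ⟨n, hn⟩ := Int.eq_ofNat_of_zero_le h1
  have hlt : n < 2 * q + 1 := by omega
  rw [h3, hn]
  rcases Nat.eq_zero_or_pos n with rfl | hpos
  · left; simpa using hv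
  · by_cases hq : n ≤ q
    · exact .inr ⟨n, hpos, hq, rfl⟩
    · left
      have := (h.cycle_even c hu hv (n - (q + 1)) (by omega)).1
      convert this using 3
      omega

end Blossom

section Merge

variable {V : Type*} {G : SimpleGraph V} {f : V → V} {r : V} {D : Finset V} {m : V → V → V}
  {cls p : V → V} {u v : V} {a b : Equiv.Perm V} {q : ℕ}

open OddCycle

/-- A matching that exposes the vertex `w` of the odd cycle and differs from `m u` only on the
cycle. -/
structure OddCycle.Rotation (G : SimpleGraph V) (f : V → V) (r : V) (m : V → V → V) (u v : V)
    (a b : Equiv.Perm V) (w : V) (C : V → V) : Prop where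
  mates : Mates G C
  fixed : ∀ x, C x = x ↔ x = w ∨ (f x = x ∧ x ≠ r)
  off : ∀ x, ¬ On a b v x → C x = m u x
  on : ∀ x, On a b v x → On a b v (C x)

/-- Unite the blossoms on the odd cycle. -/
theorem Forest.merge [Finite V] (h : Forest G f r D m cls p) (c : OddCycle f r m u v a b q)
    (hu : u ∈ D) (hv : v ∈ D) {D' : Finset V} {m' : V → V → V}
    (hD' : ∀ x, x ∈ D' ↔ x ∈ D ∨ On a b v x) (hm : ∀ x ∈ D, m' x = m x)
    (hm' : ∀ x, On a b v x → x ∉ D → Rotation G f r m u v a b x (m' x)) :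
    ∃ cls' p', Forest G f r D' m' cls' p' := by
  classical
  have := Fintype.ofFinite V
  have hsub : ∀ x ∈ D, x ∈ D' := fun x hx => (hD' x).2 (.inl hx)
  have huo := c.on_left
  -- the blossoms that meet the cycle
  let hit : V → Prop := fun x => On a b v x ∨ (x ∈ D ∧ ∃ y, On a b v y ∧ y ∈ D ∧ cls y = cls x)
  have hhu : hit u := .inl huo
  have hit_cls : ∀ x ∈ D, ∀ y ∈ D, cls x = cls y → hit x → hit y := by
    rintro x hx y hy e (h1 | ⟨-, z, h1, h2, h3⟩)
    · exact .inr ⟨hy, x, h1, hx, e⟩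
    · exact .inr ⟨hy, z, h1, h2, h3.trans e⟩
  have hit_D' : ∀ x, hit x → x ∈ D' := by
    rintro x (h1 | h1)
    · exact (hD' x).2 (.inr h1)
    · exact hsub x h1.1
  have D'_of : ∀ x ∈ D', ¬ hit x → x ∈ D := fun x hx hn =>
    ((hD' x).1 hx).resolve_right fun h1 => hn (.inl h1)
  let cls' : V → V := fun x => if hit x then cls u else cls x
  have cls_hit : ∀ x, hit x → cls' x = cls u := fun x hx => if_pos hx
  have cls_not : ∀ x, ¬ hit x → cls' x = cls x := fun x hx => if_neg hx
  have hit_of : ∀ x ∈ D', cls' x = cls u → hit x := by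
    intro x hx e
    by_contra hn
    rw [cls_not x hn] at e
    exact hn (hit_cls u hu x (D'_of x hx hn) e.symm hhu)
  have cls'_D : ∀ x ∈ D, ∀ y ∈ D, cls x = cls y → cls' x = cls' y := by
    intro x hx y hy e
    by_cases hn : hit x
    · rw [cls_hit x hn, cls_hit y (hit_cls x hx y hy e hn)]
    · rw [cls_not x hn, cls_not y (fun h1 => hn (hit_cls y hy x hx e.symm h1)), e]
  have hout : ∀ {x w}, On a b v x → x ∉ D → w ∈ D → On a b v (m w x) ∧ m w x ∈ D :=
    fun hx hxD hw => h.cycle_out c hu hv hx hxD hw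
  -- for old vertices, exactly one of the united blossoms is not left towards the cycle
  have count : ∀ w ∈ D, ∃ c0, (∃ y, On a b v y ∧ y ∈ D ∧ cls y = c0) ∧
      (∀ x, On a b v x → x ∉ D → cls (m w x) ≠ c0) ∧
      ∀ y, On a b v y → y ∈ D → cls y ≠ c0 → ∃ x, On a b v x ∧ x ∉ D ∧ cls (m w x) = cls y := by
    let O := Finset.univ.filter fun x => On a b v x ∧ x ∉ D
    let H := (Finset.univ.filter fun x => On a b v x ∧ x ∈ D).image cls
    have hO : ∀ x, x ∈ O ↔ On a b v x ∧ x ∉ D := by simp [O]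
    have hH : ∀ z, z ∈ H ↔ ∃ y, On a b v y ∧ y ∈ D ∧ cls y = z := by simp [H, and_assoc]
    have img : ∀ w ∈ D, (O.image fun x => cls (m w x)) ⊆ H ∧
        (O.image fun x => cls (m w x)).card = O.card := by
      intro w hw
      refine ⟨fun z hz => ?_, Finset.card_image_of_injOn fun x hx y hy e => ?_⟩
      · obtain ⟨x, hx, rfl⟩ := Finset.mem_image.1 hz
        obtain ⟨h1, h2⟩ := (hO x).1 hx
        exact (hH _).2 ⟨_, (hout h1 h2 hw).1, (hout h1 h2 hw).2, rfl⟩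
      · obtain ⟨h1, h2⟩ := (hO x).1 hx
        obtain ⟨h3, h4⟩ := (hO y).1 hy
        have hinv := (h.mates w hw).inv
        exact hinv.injective (h.base_unique hw (hout h1 h2 hw).2 (hout h3 h4 hw).2 e
          (.inr (by rwa [hinv])) (.inr (by rwa [hinv])))
    have hcard : H.card = O.card + 1 := by
      have huH : cls u ∈ H := (hH _).2 ⟨u, huo, hu, rfl⟩
      have : (O.image fun x => cls (m u x)) = H.erase (cls u) := by
        have hinv := (h.mates u hu).inv
        ext z
        rw [Finset.mem_erase]
        constructor
        · intro hz
          refine ⟨?_, (img u hu).1 hz⟩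
          rintro rfl
          obtain ⟨x, hx, hxu⟩ := Finset.mem_image.1 hz
          obtain ⟨h1, h2⟩ := (hO x).1 hx
          have h3 : m u x = u := h.base_unique hu (hout h1 h2 hu).2 hu hxu
            (.inr (by rwa [hinv])) (.inl rfl)
          have h4 := hinv x
          rw [h3, (h.fixed u hu u).2 (.inl rfl)] at h4
          exact h2 (h4 ▸ hu)
        · rintro ⟨hzu, hz⟩
          obtain ⟨y, h1, h2, rfl⟩ := (hH z).1 hz
          obtain ⟨e, ⟨he, hey, he'⟩, -⟩ := h.base u hu y h2
          have heD : m u e ∉ D := he'.resolve_left fun e' => hzu (by rw [← hey, e'])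
          have heo := h.cycle_base c hu hv h1 h2 hzu he hey heD
          exact Finset.mem_image.2 ⟨m u e, (hO _).2 ⟨c.on_left_apply heo, heD⟩, by rw [hinv, hey]⟩
      rw [← (img u hu).2, this, Finset.card_erase_of_mem huH]
      have : 0 < H.card := Finset.card_pos.2 ⟨_, huH⟩
      omega
    intro w hw
    have h1 : (H \ O.image fun x => cls (m w x)).card = 1 := by
      rw [Finset.card_sdiff_of_subset (img w hw).1, (img w hw).2, hcard]; omega
    obtain ⟨c0, hc0⟩ := Finset.card_eq_one.1 h1
    have hc1 : ∀ z, (z ∈ H ∧ ∀ x ∈ O, cls (m w x) ≠ z) ↔ z = c0 := by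
      intro z
      rw [← Finset.mem_singleton, ← hc0, Finset.mem_sdiff, Finset.mem_image]
      simp
    refine ⟨c0, (hH c0).1 ((hc1 c0).2 rfl).1, fun x h2 h3 => ((hc1 c0).2 rfl).2 x ((hO x).2 ⟨h2, h3⟩),
      fun y h2 h3 h4 => ?_⟩
    by_contra! hcon
    exact h4 ((hc1 _).1 ⟨(hH _).2 ⟨y, h2, h3, rfl⟩, fun x hx => hcon x ((hO x).1 hx).1
      ((hO x).1 hx).2⟩)
  have new : ∀ {x}, x ∈ D' → x ∉ D → On a b v x := fun hx hn => ((hD' _).1 hx).resolve_left hn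
  refine ⟨cls', p, ⟨hsub r h.root, by rw [hm r h.root, h.root_eq], ?_, ?_, ?_, ?_, ?_, ?_, ?_⟩⟩
  · intro x hx
    by_cases hxD : x ∈ D
    · rw [hm x hxD]; exact h.mates x hxD
    · exact (hm' x (new hx hxD) hxD).mates
  · intro x hx
    by_cases hxD : x ∈ D
    · rw [hm x hxD]; exact h.fixed x hxD
    · exact (hm' x (new hx hxD) hxD).fixed
  · intro x hx e
    by_cases hxD : x ∈ D
    · exact h.exposed x hxD e
    · obtain ⟨k, rfl⟩ := new hx hxD
      by_contra hxr
      exact c.covered k ⟨e, hxr⟩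
  · intro x hx
    by_cases hn : hit x
    · rw [cls_hit x hn]; exact hsub _ (h.cls_mem u hu)
    · rw [cls_not x hn]; exact hsub _ (h.cls_mem x (D'_of x hx hn))
  · intro w hw x hx hwx
    by_cases hwD : w ∈ D
    · rw [hm w hwD] at hwx ⊢
      by_cases hxD : x ∈ D
      · by_cases hwxD : m w x ∈ D
        · exact cls'_D _ hwxD _ hxD (h.same w hwD x hxD hwxD)
        · have h1 := new hwx hwxD
          have h2 := (hout h1 hwxD hwD).1
          rw [(h.mates w hwD).inv] at h2
          rw [cls_hit _ (.inl h1), cls_hit _ (.inl h2)]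
      · have h1 := new hx hxD
        rw [cls_hit _ (.inl h1), cls_hit _ (.inl (hout h1 hxD hwD).1)]
    · have R := hm' w (new hw hwD) hwD
      by_cases hxo : On a b v x
      · rw [cls_hit _ (.inl hxo), cls_hit _ (.inl (R.on x hxo))]
      · have hxD : x ∈ D := ((hD' x).1 hx).resolve_right hxo
        rw [R.off x hxo] at hwx ⊢
        by_cases hwxD : m u x ∈ D
        · exact cls'_D _ hwxD _ hxD (h.same u hu x hxD hwxD)
        · refine absurd (c.on_left_apply (new hwx hwxD)) ?_
          rwa [(h.mates u hu).inv]
  · intro w hw x hx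
    by_cases hwD : w ∈ D
    · rw [hm w hwD]
      have hinv := (h.mates w hwD).inv
      by_cases hn : hit x
      · rw [cls_hit x hn]
        obtain ⟨c0, ⟨y, h1, h2, rfl⟩, h3, h4⟩ := count w hwD
        obtain ⟨e, ⟨he, hey, he'⟩, huniq⟩ := h.base w hwD y h2
        have hhe : hit e := hit_cls y h2 e he hey.symm (.inl h1)
        refine ⟨e, ⟨hsub e he, cls_hit e hhe, ?_⟩, ?_⟩
        · refine he'.imp_right fun h5 h6 => ?_
          have := h3 _ (new h6 h5) h5
          rw [hinv] at this
          exact this hey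
        · rintro e1 ⟨h5, h6, h7⟩
          have hhe1 := hit_of e1 h5 h6
          by_cases he1 : e1 ∈ D
          · have h7' : e1 = w ∨ m w e1 ∉ D := h7.imp_right fun h8 h9 => h8 (hsub _ h9)
            by_cases hc : cls e1 = cls y
            · exact huniq e1 ⟨he1, hc, h7'⟩
            · exfalso
              obtain ⟨y1, g1, g2, g3⟩ : ∃ y1, On a b v y1 ∧ y1 ∈ D ∧ cls y1 = cls e1 := by
                rcases hhe1 with h8 | h8
                · exact ⟨e1, h8, he1, rfl⟩
                · exact h8.2
              obtain ⟨x1, g4, g5, g6⟩ := h4 y1 g1 g2 (g3.trans_ne hc)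
              have g7 : m w x1 = e1 := h.base_unique hwD (hout g4 g5 hwD).2 he1 (g6.trans g3)
                (.inr (by rwa [hinv])) h7'
              rcases h7 with h8 | h8
              · have h9 := hinv x1
                rw [g7, h8, (h.fixed w hwD w).2 (.inl rfl)] at h9
                exact g5 (h9 ▸ hwD)
              · rw [← g7, hinv] at h8
                exact h8 ((hD' _).2 (.inr g4))
          · exfalso
            have h8 := hout (new h5 he1) he1 hwD
            rcases h7 with h9 | h9
            · exact he1 (h9 ▸ hwD)
            · exact h9 (hsub _ h8.2)
      · rw [cls_not x hn]
        have hxD := D'_of x hx hn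
        obtain ⟨e, ⟨he, hex, he'⟩, huniq⟩ := h.base w hwD x hxD
        have hne : ¬ hit e := fun h1 => hn (hit_cls e he x hxD hex h1)
        refine ⟨e, ⟨hsub e he, (cls_not e hne).trans hex, he'.imp_right fun h1 h2 => ?_⟩, ?_⟩
        · have := (hout (new h2 h1) h1 hwD).1
          rw [hinv] at this
          exact hne (.inl this)
        · rintro e1 ⟨h1, h2, h3⟩
          have hne1 : ¬ hit e1 := fun h4 => by
            rw [cls_hit e1 h4] at h2
            exact hn (hit_cls u hu x hxD h2 hhu)
          rw [cls_not e1 hne1] at h2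
          exact huniq e1 ⟨D'_of e1 h1 hne1, h2, h3.imp_right fun h4 h5 => h4 (hsub _ h5)⟩
    · have hwo := new hw hwD
      have R := hm' w hwo hwD
      have hinv := (h.mates u hu).inv
      by_cases hn : hit x
      · rw [cls_hit x hn]
        refine ⟨w, ⟨hw, cls_hit w (.inl hwo), .inl rfl⟩, ?_⟩
        rintro e1 ⟨h1, h2, h3⟩
        refine h3.resolve_right fun h4 => ?_
        have hhe1 := hit_of e1 h1 h2
        by_cases ho : On a b v e1
        · exact h4 ((hD' _).2 (.inr (R.on e1 ho)))
        · obtain ⟨he1, y, g1, g2, g3⟩ := hhe1.resolve_left ho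
          rw [R.off e1 ho] at h4
          have h5 : m u e1 ∉ D := fun h5 => h4 (hsub _ h5)
          by_cases hc : cls y = cls u
          · have := h.base_unique hu he1 hu (g3.symm.trans hc) (.inr h5) (.inl rfl)
            exact ho (this ▸ huo)
          · exact ho (h.cycle_base c hu hv g1 g2 hc he1 g3.symm h5)
      · rw [cls_not x hn]
        have hxD := D'_of x hx hn
        obtain ⟨e, ⟨he, hex, he'⟩, huniq⟩ := h.base u hu x hxD
        have hne : ¬ hit e := fun h1 => hn (hit_cls e he x hxD hex h1)
        have heu : m u e ∉ D := he'.resolve_left fun h1 => hne (h1 ▸ hhu)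
        refine ⟨e, ⟨hsub e he, (cls_not e hne).trans hex, .inr ?_⟩, ?_⟩
        · rw [R.off e fun h1 => hne (.inl h1)]
          intro h1
          have := c.on_left_apply (new h1 heu)
          rw [hinv] at this
          exact hne (.inl this)
        · rintro e1 ⟨h1, h2, h3⟩
          have hne1 : ¬ hit e1 := fun h4 => by
            rw [cls_hit e1 h4] at h2
            exact hn (hit_cls u hu x hxD h2 hhu)
          rw [cls_not e1 hne1] at h2
          have h4 := h3.resolve_left fun h4 => hne1 (.inl (h4 ▸ hwo))
          rw [R.off e1 fun h1 => hne1 (.inl h1)] at h4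
          exact huniq e1 ⟨D'_of e1 h1 hne1, h2, .inr fun h5 => h4 (hsub _ h5)⟩
  · intro w hw x hx
    have hxD : x ∉ D := fun h1 => hx (hsub x h1)
    by_cases hwD : w ∈ D
    · rw [hm w hwD]
      exact (h.out w hwD x hxD).imp_right fun h1 => ⟨h1.1, hsub _ h1.2.1, hsub _ h1.2.2⟩
    · rw [(hm' w (new hw hwD) hwD).off x fun h1 => hx ((hD' x).2 (.inr h1))]
      exact (h.out u hu x hxD).imp_right fun h1 => ⟨h1.1, hsub _ h1.2.1, hsub _ h1.2.2⟩

end Merge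

section Trace

variable {V : Type*} {G : SimpleGraph V} {f : V → V} {r : V} {D₀ : Finset V} {m₀ : V → V → V}
  {cls p : V → V} {u v : V} {a b : Equiv.Perm V} {q : ℕ}

open OddCycle

theorem OddCycle.zpow_ne (c : OddCycle f r m₀ u v a b q) {i j : ℤ} (h : i ≠ j)
    (h1 : i - j < 2 * q + 1) (h2 : j - i < 2 * q + 1) : ((a * b) ^ i) v ≠ ((a * b) ^ j) v := by
  rw [Ne, c.period]
  rintro ⟨k, hk⟩
  push_cast at hk
  have h3 : k < 1 := by
    by_contra h4
    have : (2 * q + 1 : ℤ) * 1 ≤ (2 * q + 1) * k := mul_le_mul_of_nonneg_left (by omega) (by omega)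
    omega
  have h5 : -1 < k := by
    by_contra h4
    have : (2 * q + 1 : ℤ) * k ≤ (2 * q + 1) * (-1) :=
      mul_le_mul_of_nonneg_left (by omega) (by omega)
    omega
  have : k = 0 := by omega
  subst this
  omega

/-- The search has gone around the odd cycle for `i` steps, starting at `u` with the edge to `v`.
Now `C` is a matching that exposes `y`, and `z` is the vertex to match `y` with. -/
structure OddCycle.Trace (G : SimpleGraph V) (f : V → V) (r : V) (D₀ : Finset V) (m₀ : V → V → V)
    (u v : V) (a b : Equiv.Perm V) (q : ℕ) (i : ℕ) (D : Finset V) (m : V → V → V) (C : V → V)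
    (y z : V) : Prop where
  old : ∀ w ∈ D₀, m w = m₀ w
  mem : ∀ x, x ∈ D ↔ x ∈ D₀ ∨ ∃ j : ℕ, 1 ≤ j ∧ j ≤ i ∧ x = ((a * b) ^ (j : ℤ)) v
  new : ∀ w ∈ D, w ∉ D₀ → Rotation G f r m₀ u v a b w (m w)
  rot : Rotation G f r m₀ u v a b y C
  cur : (i = 0 ∧ y = u) ∨ (1 ≤ i ∧ y = ((a * b) ^ (i : ℤ)) v)
  next : z = ((a * b) ^ (-i : ℤ)) v
  adj : i < q → G.Adj y z
  eq : ∀ x, x ≠ u → (∀ k : ℤ, -i < k → k ≤ i → x ≠ ((a * b) ^ k) v) → C x = m₀ u x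

theorem Forest.trace_start (h : Forest G f r D₀ m₀ cls p) (c : OddCycle f r m₀ u v a b q)
    (hu : u ∈ D₀) (huv : G.Adj u v) : Trace G f r D₀ m₀ u v a b q 0 D₀ m₀ (m₀ u) u v where
  old _ _ := rfl
  mem x := by simp only [iff_self_or]; rintro ⟨j, h1, h2, -⟩; omega
  new w h1 h2 := absurd h1 h2
  rot := ⟨h.mates u hu, h.fixed u hu, fun _ _ => rfl, fun _ => c.on_left_apply⟩
  cur := .inl ⟨rfl, rfl⟩
  next := by simp
  adj _ := huv
  eq _ _ _ := rfl

variable {i : ℕ} {D : Finset V} {m : V → V → V} {C : V → V} {y z : V}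

theorem OddCycle.Trace.next_ne (t : Trace G f r D₀ m₀ u v a b q i D m C y z)
    (c : OddCycle f r m₀ u v a b q) (hi : i < q) : z ≠ u := by
  rw [t.next, ← c.last]
  exact c.zpow_ne (by omega) (by omega) (by omega)

theorem OddCycle.Trace.next_eq (t : Trace G f r D₀ m₀ u v a b q q D m C y z)
    (c : OddCycle f r m₀ u v a b q) : z = u := by
  rw [t.next, ← c.last, c.period]
  exact ⟨-1, by push_cast; ring⟩

theorem OddCycle.Trace.step [DecidableEq V] (t : Trace G f r D₀ m₀ u v a b q i D m C y z)
    (c : OddCycle f r m₀ u v a b q) (h : Forest G f r D₀ m₀ cls p) (hu : u ∈ D₀) (hv : v ∈ D₀)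
    (hi : i < q) {m' : V → V → V} (hm : ∀ x ∈ D, m' x = m x)
    (hm' : C z ∉ D → m' (C z) = exchange C y z) :
    Trace G f r D₀ m₀ u v a b q (i + 1) (insert (C z) D) m' (exchange C y z) (C z)
      (m₀ v (C z)) := by
  have hCz : C z = ((a * b) ^ ((i + 1 : ℕ) : ℤ)) v := by
    rw [t.eq z (t.next_ne c hi), t.next, c.left_apply]
    · congr 2; push_cast; ring
    · intro k h1 h2
      rw [t.next]
      exact c.zpow_ne (by omega) (by omega) (by omega)
  have hzo : On a b v z := ⟨_, t.next⟩
  have hyo : On a b v y := by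
    rcases t.cur with ⟨-, rfl⟩ | ⟨-, rfl⟩
    · exact c.on_left
    · exact ⟨_, rfl⟩
  have hyz := t.adj hi
  have hcov : ∀ x, On a b v x → ¬ (f x = x ∧ x ≠ r) := by
    rintro x ⟨k, rfl⟩; exact c.covered k
  have hyC : C y = y := (t.rot.fixed y).2 (.inl rfl)
  have hzC : C z ≠ z := by
    rw [Ne, t.rot.fixed]
    rintro (e | e)
    · exact hyz.ne e.symm
    · exact hcov z hzo e
  obtain ⟨hE, hEf⟩ := t.rot.mates.exchange_spec hyC hzC hyz
  have hrot : Rotation G f r m₀ u v a b (C z) (exchange C y z) := by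
    refine ⟨hE, fun x => ?_, fun x hx => ?_, fun x hx => ?_⟩
    · rw [hEf, t.rot.fixed]
      constructor
      · rintro (e | ⟨e | e, e'⟩)
        · exact .inl e
        · exact absurd e e'
        · exact .inr e
      · rintro (e | e)
        · exact .inl e
        · refine .inr ⟨.inr e, ?_⟩
          rintro rfl
          exact hcov _ hyo e
    · rw [exchange_apply, if_neg, if_neg, if_neg, t.rot.off x hx]
      · rintro rfl; exact hx hzo
      · rintro rfl; exact hx hyo
      · rintro rfl; exact hx (t.rot.on _ hzo)
    · rw [exchange_apply]
      split_ifs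
      · exact t.rot.on _ hzo
      · exact hzo
      · exact hyo
      · exact t.rot.on _ hx
  refine ⟨fun w hw => ?_, fun x => ?_, fun w hw hw' => ?_, hrot, .inr ⟨by omega, hCz⟩, ?_, fun hi' => ?_,
    fun x hxu hx => ?_⟩
  · rw [hm w ((t.mem w).2 (.inl hw)), t.old w hw]
  · rw [Finset.mem_insert, t.mem]
    constructor
    · rintro (rfl | e | ⟨j, h1, h2, e⟩)
      · exact .inr ⟨i + 1, by omega, le_rfl, hCz⟩
      · exact .inl e
      · exact .inr ⟨j, h1, by omega, e⟩
    · rintro (e | ⟨j, h1, h2, e⟩)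
      · exact .inr (.inl e)
      · by_cases hj : j = i + 1
        · subst hj; exact .inl (e.trans hCz.symm)
        · exact .inr (.inr ⟨j, h1, by omega, e⟩)
  · by_cases hwD : w ∈ D
    · rw [hm w hwD]; exact t.new w hwD hw'
    · obtain rfl := (Finset.mem_insert.1 hw).resolve_right hwD
      rw [hm' hwD]; exact hrot
  · rw [hCz, c.right_apply]
  · have h1 : m₀ v (C z) ≠ C z := by
      rw [hCz, c.right_apply]
      exact c.zpow_ne (by push_cast; omega) (by push_cast; omega) (by push_cast; omega)
    exact (h.mates v hv).adj _ h1
  · rw [exchange_apply, if_neg, if_neg, if_neg, t.eq x hxu]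
    · exact fun k h1 h2 => hx k (by push_cast; omega) (by push_cast; omega)
    · rw [t.next]; exact hx _ (by push_cast; omega) (by push_cast; omega)
    · rcases t.cur with ⟨-, rfl⟩ | ⟨-, e⟩
      · exact hxu
      · rw [e]; exact hx _ (by push_cast; omega) (by push_cast; omega)
    · rw [hCz]; exact hx _ (by push_cast; omega) (by push_cast; omega)

/-- After the search has gone around the odd cycle, the forest is enlarged by the cycle. -/
theorem OddCycle.Trace.finish [Finite V] (t : Trace G f r D₀ m₀ u v a b q q D m C y z)
    (c : OddCycle f r m₀ u v a b q) (h : Forest G f r D₀ m₀ cls p) (hu : u ∈ D₀) (hv : v ∈ D₀) :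
    ∃ cls' p', Forest G f r D m cls' p' := by
  have hmem : ∀ x, x ∈ D ↔ x ∈ D₀ ∨ On a b v x := by
    intro x
    rw [t.mem]
    constructor
    · rintro (e | ⟨j, -, -, e⟩)
      · exact .inl e
      · exact .inr ⟨_, e⟩
    · rintro (e | e)
      · exact .inl e
      · exact h.cycle_mem c hu hv e
  exact h.merge c hu hv hmem t.old fun x hx hxD => t.new x ((hmem x).2 (.inr hx)) hxD

/-- If going around the odd cycle discovers no vertices, then the cycle lies in one blossom. -/
theorem OddCycle.Trace.cls_eq [Finite V] (t : Trace G f r D₀ m₀ u v a b q q D₀ m C y z)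
    (c : OddCycle f r m₀ u v a b q) (h : Forest G f r D₀ m₀ cls p) (hu : u ∈ D₀) (hv : v ∈ D₀) :
    cls u = cls v :=
  h.cls_eq_of_cycle_subset c hu hv fun x hx =>
    (h.cycle_mem c hu hv hx).elim id fun e => (t.mem x).2 (.inr e)

end Trace

theorem OddCycle.lt_card {V : Type*} [Fintype V] {f : V → V} {r : V} {m : V → V → V} {u v : V}
    {a b : Equiv.Perm V} {q : ℕ} (c : OddCycle f r m u v a b q) : q < Fintype.card V := by
  have : Function.Injective fun i : Fin (2 * q + 1) => ((a * b) ^ (i : ℤ)) v := by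
    intro i j hij
    by_contra hne
    have := Fin.val_ne_of_ne hne
    exact c.zpow_ne (by omega) (by omega) (by omega) hij
  have := Fintype.card_le_of_injective _ this
  rw [Fintype.card_fin] at this
  omega

/-! ## What a command leaves unchanged -/

namespace RAM

/-- The command changes the array `j`. -/
def Cmd.sets (j : Fin 8) : Cmd → Bool
  | .set i _ _ => j == i
  | .seq p q => p.sets j || q.sets j
  | .ite _ p q => p.sets j || q.sets j
  | .loop _ _ p => p.sets j
  | _ => false

/-- The command changes the input. -/
def Cmd.puts : Cmd → Bool
  | .put _ _ => true
  | .seq p q => p.puts || q.puts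
  | .ite _ p q => p.puts || q.puts
  | .loop _ _ p => p.puts
  | _ => false

theorem loopEval_congr {α : Type*} (g : Env → α) {f : Env → Env} {x : ℕ}
    (hx : ∀ h v, g (h.setVar x v) = g h) (hf : ∀ h, g (f h) = g h) :
    ∀ (m : ℕ) (h : Env), g (loopEval f x m h) = g h
  | 0, h => hx h 0
  | m + 1, h => by rw [loopEval, loopEval_congr g hx hf m, hf, hx]

theorem Cmd.eval_arr {j : Fin 8} : ∀ (p : Cmd) (h : Env), p.sets j = false →
    (p.eval h).arr j = h.arr j
  | .skip, h, _ => rfl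
  | .assign x e, h, _ => rfl
  | .put e f, h, _ => rfl
  | .set i e f, h, hj => by
    have : j ≠ i := by simpa [Cmd.sets] using hj
    simp [Cmd.eval, Env.setArr, this]
  | .seq p q, h, hj => by
    simp only [Cmd.sets, Bool.or_eq_false_iff] at hj
    rw [Cmd.eval, q.eval_arr _ hj.2, p.eval_arr _ hj.1]
  | .ite e p q, h, hj => by
    simp only [Cmd.sets, Bool.or_eq_false_iff] at hj
    rw [Cmd.eval]; split_ifs
    · exact p.eval_arr _ hj.1
    · exact q.eval_arr _ hj.2
  | .loop x y p, h, hj =>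
    loopEval_congr (fun h => h.arr j) (fun _ _ => rfl) (fun h => p.eval_arr h hj) _ _

theorem Cmd.eval_inp : ∀ (p : Cmd) (h : Env), p.puts = false → (p.eval h).inp = h.inp
  | .skip, h, _ => rfl
  | .assign x e, h, _ => rfl
  | .put e f, h, hp => by simp [Cmd.puts] at hp
  | .set i e f, h, hj => rfl
  | .seq p q, h, hj => by
    simp only [Cmd.puts, Bool.or_eq_false_iff] at hj
    rw [Cmd.eval, q.eval_inp _ hj.2, p.eval_inp _ hj.1]
  | .ite e p q, h, hj => by
    simp only [Cmd.puts, Bool.or_eq_false_iff] at hj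
    rw [Cmd.eval]; split_ifs
    · exact p.eval_inp _ hj.1
    · exact q.eval_inp _ hj.2
  | .loop x y p, h, hj =>
    loopEval_congr (fun h => h.inp) (fun _ _ => rfl) (fun h => p.eval_inp h hj) _ _

end RAM

namespace BCFEA.Instance

variable (I : Instance)

/-- The cost of an item, and zero for the dummy items from `n` on. -/
def cost (N : ℕ) (x : Fin N) : ℕ := if h : x < I.n then I.c ⟨x, h⟩ else 0

/-- The utility of an item, and zero for the dummy items from `n` on. -/
def util (N : ℕ) (x : Fin N) : ℕ := if h : x < I.n then I.p ⟨x, h⟩ else 0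

/-- Two items are in conflict; dummy items are never. -/
def Conflict (N : ℕ) (x y : Fin N) : Prop :=
  ∃ (hx : x < I.n) (hy : y < I.n), I.G.Adj ⟨x, hx⟩ ⟨y, hy⟩

/-- The graph of feasible pairs after the addition of dummy items without conflicts. -/
def extGraph (N : ℕ) : SimpleGraph (Fin N) where
  Adj x y := x ≠ y ∧ ¬ I.Conflict N x y ∧ I.cost N x + I.cost N y ≤ I.B ∧
    I.P ≤ I.util N x + I.util N y
  symm := ⟨fun x y h => ⟨h.1.symm, fun ⟨a, b, c⟩ => h.2.1 ⟨b, a, c.symm⟩,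
    by rw [add_comm]; exact h.2.2.1, by rw [add_comm]; exact h.2.2.2⟩⟩
  loopless := ⟨fun _ h => h.1 rfl⟩

theorem length_encode : I.encode.length = 4 + I.n + I.n + I.n * I.n := by
  simp [encode, List.length_flatten, Function.comp_def]
  omega

theorem encode_zero : I.encode.getD 0 0 = I.n := rfl
theorem encode_one : I.encode.getD 1 0 = I.k := rfl
theorem encode_two : I.encode.getD 2 0 = I.P := rfl
theorem encode_three : I.encode.getD 3 0 = I.B := rfl

theorem encode_util {x : ℕ} (hx : x < I.n) : I.encode.getD (4 + x) 0 = I.p ⟨x, hx⟩ := by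
  rw [encode, List.append_assoc, List.append_assoc, List.getD_append_right _ _ _ _ (by simp)]
  simp [List.getElem?_append, hx]

theorem encode_cost {x : ℕ} (hx : x < I.n) : I.encode.getD (4 + I.n + x) 0 = I.c ⟨x, hx⟩ := by
  have h1 : ([I.n, I.k, I.P, I.B] ++ List.ofFn I.p).length = 4 + I.n := by simp; omega
  rw [encode, List.append_assoc, List.getD_append_right _ _ _ _ (by omega), h1]
  simp [List.getElem?_append, hx]

theorem getD_flatten {n y : ℕ} (hy : y < n) : ∀ (L : List (List ℕ)), (∀ l ∈ L, l.length = n) →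
    ∀ x, L.flatten.getD (x * n + y) 0 = (L.getD x []).getD y 0
  | [], _, x => by simp
  | l :: L, hL, x => by
    have hl := hL l (by simp)
    cases x with
    | zero => rw [List.flatten_cons, List.getD_append _ _ _ _ (by omega)]; simp
    | succ x =>
      have e : (x + 1) * n + y - l.length = x * n + y := by rw [hl, add_mul]; omega
      rw [List.flatten_cons, List.getD_append_right _ _ _ _ (by rw [hl, add_mul]; omega), e,
        getD_flatten hy L fun l h => hL l (by simp [h])]
      simp

open Classical in
theorem encode_adj {x y : ℕ} (hx : x < I.n) (hy : y < I.n) :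
    I.encode.getD (4 + I.n + I.n + (x * I.n + y)) 0 =
      if I.G.Adj ⟨x, hx⟩ ⟨y, hy⟩ then 1 else 0 := by
  have h1 : ([I.n, I.k, I.P, I.B] ++ List.ofFn I.p ++ List.ofFn I.c).length = 4 + I.n + I.n := by
    simp; omega
  rw [encode, List.getD_append_right _ _ _ _ (by omega), h1, Nat.add_sub_cancel_left,
    getD_flatten hy _ (by simp [List.mem_ofFn])]
  simp [hx, hy]

end BCFEA.Instance

/-! ## Allocations and perfect matchings -/

namespace BCFEA

/-- The smaller element of the pair of `x`. -/
def pairMin {N : ℕ} (g : Fin N → Fin N) (x : Fin N) : Fin N := min x (g x)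

/-- The number of pairs whose smaller element is larger than that of the pair of `x`. -/
def pairRank {N : ℕ} (g : Fin N → Fin N) (x : Fin N) : ℕ :=
  (Finset.univ.filter fun w => w < g w ∧ pairMin g x < w).card

section Rank

variable {N : ℕ} {g : Fin N → Fin N}

theorem pairMin_lt (h1 : ∀ x, g (g x) = x) (h2 : ∀ x, g x ≠ x) (x : Fin N) :
    pairMin g x < g (pairMin g x) := by
  rcases lt_or_gt_of_ne (h2 x) with h | h
  · rw [pairMin, min_eq_right h.le, h1]; exact h
  · rw [pairMin, min_eq_left h.le]; exact h

theorem pairMin_eq_iff (h1 : ∀ x, g (g x) = x) (x y : Fin N) :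
    pairMin g x = pairMin g y ↔ y = x ∨ y = g x := by
  constructor
  · intro h
    have := h1 y
    unfold pairMin at h
    rcases min_choice x (g x) with hx | hx <;> rcases min_choice y (g y) with hy | hy <;>
      rw [hx, hy] at h
    · exact .inl h.symm
    · right; rw [h, h1]
    · exact .inr h.symm
    · left; rw [← h1 y, ← h, h1]
  · rintro (rfl | rfl)
    · rfl
    · unfold pairMin; rw [h1, min_comm]

theorem pairRank_lt_of_pairMin_lt (h1 : ∀ x, g (g x) = x) (h2 : ∀ x, g x ≠ x) {x y : Fin N}
    (h : pairMin g x < pairMin g y) : pairRank g y < pairRank g x := by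
  refine Finset.card_lt_card ⟨fun w hw => ?_, fun hs => ?_⟩
  · simp only [Finset.mem_filter, Finset.mem_univ, true_and] at hw ⊢
    exact ⟨hw.1, h.trans hw.2⟩
  · have := hs (x := pairMin g y) (by simpa using ⟨pairMin_lt h1 h2 y, h⟩)
    simp at this

theorem pairRank_eq_iff (h1 : ∀ x, g (g x) = x) (h2 : ∀ x, g x ≠ x) (x y : Fin N) :
    pairRank g x = pairRank g y ↔ y = x ∨ y = g x := by
  rw [← pairMin_eq_iff h1]
  refine ⟨fun h => ?_, fun h => by rw [pairRank, pairRank, h]⟩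
  by_contra hne
  rcases lt_or_gt_of_ne hne with h3 | h3
  · exact (pairRank_lt_of_pairMin_lt h1 h2 h3).ne' h
  · exact (pairRank_lt_of_pairMin_lt h1 h2 h3).ne h

theorem two_mul_card_lt_mate (h1 : ∀ x, g (g x) = x) (h2 : ∀ x, g x ≠ x) :
    2 * (Finset.univ.filter fun w => w < g w).card = N := by
  have h3 : (Finset.univ.filter fun w => w < g w).card =
      (Finset.univ.filter fun w => ¬ w < g w).card := by
    refine Finset.card_bij (fun w _ => g w) (fun w hw => ?_) (fun x _ y _ h => ?_)
      fun y hy => ⟨g y, ?_, h1 y⟩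
    · simpa [h1] using (Finset.mem_filter.1 hw).2.le
    · rw [← h1 x, h, h1]
    · simpa [h1] using lt_of_le_of_ne (not_lt.1 (Finset.mem_filter.1 hy).2) (h2 y)
  have := Finset.card_filter_add_card_filter_not (s := Finset.univ) fun w => w < g w
  rw [Finset.card_univ, Fintype.card_fin] at this
  omega

theorem two_mul_pairRank_lt (h1 : ∀ x, g (g x) = x) (h2 : ∀ x, g x ≠ x) (x : Fin N) :
    2 * pairRank g x < N := by
  have h3 : pairRank g x < (Finset.univ.filter fun w => w < g w).card := by
    refine Finset.card_lt_card ⟨fun w hw => ?_, fun hs => ?_⟩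
    · simp only [Finset.mem_filter, Finset.mem_univ, true_and] at hw ⊢
      exact hw.1
    · have := hs (x := pairMin g x) (by simpa using pairMin_lt h1 h2 x)
      simp at this
  have := two_mul_card_lt_mate h1 h2
  omega

end Rank

/-- A map whose fibres have at most two elements extends to one whose fibres have exactly two. -/
theorem exists_extension {m : ℕ} : ∀ (d n : ℕ) (a : Fin n → Fin m), n + d = 2 * m →
    (∀ i, (Finset.univ.filter fun v => a v = i).card ≤ 2) →
    ∃ b : Fin (2 * m) → Fin m, (∀ i, (Finset.univ.filter fun v => b v = i).card = 2) ∧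
      ∀ (x : Fin (2 * m)) (h : x < n), b x = a ⟨x, h⟩
  | 0, n, a, hn, ha => by
    obtain rfl : n = 2 * m := hn
    refine ⟨a, ?_, fun _ _ => rfl⟩
    have h1 := Finset.card_eq_sum_card_fiberwise (s := Finset.univ) (t := Finset.univ) (f := a)
      (by simp)
    have h2 : ∑ i : Fin m, 2 = 2 * m := by simp [mul_comm]
    rw [Finset.card_univ, Fintype.card_fin] at h1
    have h3 := (Finset.sum_eq_sum_iff_of_le fun i _ => ha i).1 (h1.symm.trans h2.symm)
    exact fun i => h3 i (Finset.mem_univ i)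
  | d + 1, n, a, hn, ha => by
    obtain ⟨i, hi⟩ : ∃ i, (Finset.univ.filter fun v => a v = i).card < 2 := by
      by_contra! hcon
      have h1 := Finset.card_eq_sum_card_fiberwise (s := Finset.univ) (t := Finset.univ) (f := a)
        (by simp)
      rw [Finset.card_univ, Fintype.card_fin] at h1
      have h2 : ∑ i : Fin m, 2 ≤ ∑ i : Fin m, (Finset.univ.filter fun v => a v = i).card :=
        Finset.sum_le_sum fun i _ => hcon i
      simp only [Finset.sum_const, Finset.card_univ, Fintype.card_fin, smul_eq_mul] at h2
      omega
    obtain ⟨b, hb, hba⟩ := exists_extension d (n + 1) (Fin.snoc a i) (by omega) fun j => by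
      rw [Finset.card_filter, Fin.sum_univ_castSucc]
      simp only [Fin.snoc_castSucc, Fin.snoc_last, ← Finset.card_filter]
      split_ifs with hj
      · rw [← hj]; omega
      · exact ha j
    exact ⟨b, hb, fun x hx => (hba x (by omega)).trans
      (Fin.snoc_castSucc (α := fun _ => Fin m) i a ⟨x, hx⟩)⟩

/-- If all fibres of `b` have exactly two elements, then `b` induces a pairing. -/
theorem exists_pairing {α β : Type*} [Fintype α] [DecidableEq α] [DecidableEq β] {b : α → β}
    (hb : ∀ i, (Finset.univ.filter fun v => b v = i).card = 2) :
    ∃ g : α → α, (∀ x, g (g x) = x) ∧ (∀ x, g x ≠ x) ∧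
      ∀ x y, b y = b x ↔ y = x ∨ y = g x := by
  have key : ∀ x, ∃ y, y ≠ x ∧ ∀ z, b z = b x ↔ z = x ∨ z = y := fun x => by
    obtain ⟨y, hy, hxy⟩ := Finset.exists_mem_ne (by rw [hb]; omega : 1 < _) x
      (s := Finset.univ.filter fun v => b v = b x)
    have h1 : ({x, y} : Finset α) = Finset.univ.filter fun v => b v = b x := by
      refine Finset.eq_of_subset_of_card_le (fun z hz => ?_) ?_
      · rcases Finset.mem_insert.1 hz with rfl | hz
        · simp
        · rw [Finset.mem_singleton.1 hz]; exact hy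
      · rw [hb, Finset.card_pair hxy.symm]
    exact ⟨y, hxy, fun z => by simpa using (Finset.ext_iff.1 h1 z).symm⟩
  choose g hg1 hg2 using key
  refine ⟨g, fun x => ?_, hg1, hg2⟩
  have h1 : b (g x) = b x := (hg2 x _).2 (.inr rfl)
  exact (((hg2 x _).1 (((hg2 (g x) _).2 (.inr rfl)).trans h1)).resolve_right (hg1 _))

namespace Instance

variable {I : Instance}

/-- A bundle that consists of the items in a pair is feasible if and only if the pair is
an edge. -/
theorem feasible_iff_adj {N : ℕ} (hN : I.n ≤ N) {x y : Fin N} (hxy : x ≠ y)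
    {S : Finset (Fin I.n)} (hS : ∀ v, v ∈ S ↔ Fin.castLE hN v = x ∨ Fin.castLE hN v = y) :
    I.Feasible S ↔ (I.extGraph N).Adj x y := by
  have hsum : ∀ (f : Fin I.n → ℕ), ∑ v ∈ S, f v = (if h : x < I.n then f ⟨x, h⟩ else 0) +
      if h : y < I.n then f ⟨y, h⟩ else 0 := fun f => by
    rw [← Finset.sum_pair (f := fun z : Fin N => if h : z < I.n then f ⟨z, h⟩ else 0) hxy]
    refine Finset.sum_of_injOn (Fin.castLE hN) (Fin.castLE_injective hN).injOn (fun v hv => ?_)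
      (fun z hz hzS => ?_) (fun v _ => by simp)
    · simpa using (hS v).1 hv
    · rw [dif_neg]
      intro h
      exact hzS ⟨⟨z, h⟩, (hS _).2 (by simpa using hz), rfl⟩
  have hind : I.G.IsIndepSet (S : Set (Fin I.n)) ↔ ¬ I.Conflict N x y := by
    constructor
    · rintro h ⟨hx, hy, hadj⟩
      exact h ((hS ⟨x, hx⟩).2 (.inl rfl)) ((hS ⟨y, hy⟩).2 (.inr rfl)) hadj.ne hadj
    · intro h u hu v hv huv hadj
      have hne : Fin.castLE hN u ≠ Fin.castLE hN v := (Fin.castLE_injective hN).ne huv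
      rcases (hS u).1 hu with h1 | h1 <;> rcases (hS v).1 hv with h2 | h2
      · exact hne (h1.trans h2.symm)
      · subst h1 h2; exact h ⟨u.2, v.2, hadj⟩
      · subst h1 h2; exact h ⟨v.2, u.2, hadj.symm⟩
      · exact hne (h1.trans h2.symm)
  rw [Feasible, hind, hsum, hsum]
  exact ⟨fun h => ⟨hxy, h⟩, fun h => h.2⟩

theorem feasible_empty_iff : I.Feasible ∅ ↔ I.P = 0 := by
  simp [Feasible, SimpleGraph.IsIndepSet]

/-- A pairing of the items and the dummy items along edges yields a solution. -/
theorem isSolutionOfSize_of_pairing {m : ℕ} (hm : m = min I.k (I.n + 1)) (hn : I.n ≤ 2 * m)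
    {g : Fin (2 * m) → Fin (2 * m)} (h1 : ∀ x, g (g x) = x)
    (h2 : ∀ x, (I.extGraph (2 * m)).Adj x (g x)) {a : I.Allocation}
    (ha : ∀ v, (a v : ℕ) = pairRank g (Fin.castLE hn v)) : I.IsSolutionOfSize 2 a := by
  have h3 : ∀ x, g x ≠ x := fun x => (h2 x).ne'
  have hpair : ∀ (i : Fin I.k) (x : Fin (2 * m)), pairRank g x = i → ∀ v, v ∈ I.bundle a i ↔
      Fin.castLE hn v = x ∨ Fin.castLE hn v = g x := fun i x hx v => by
    rw [← pairRank_eq_iff h1 h3, hx, ← ha v]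
    simp [bundle, Fin.ext_iff, eq_comm]
  have hempty : ∀ i : Fin I.k, (∀ x : Fin (2 * m), pairRank g x ≠ i) → I.bundle a i = ∅ :=
    fun i hi => Finset.filter_false_of_mem fun v _ h => hi _ ((ha v).symm.trans (by rw [h]))
  refine ⟨fun i => ?_, fun i => ?_⟩ <;> by_cases hi : ∃ x : Fin (2 * m), pairRank g x = i
  · obtain ⟨x, hx⟩ := hi
    exact (feasible_iff_adj hn (h3 x).symm (hpair i x hx)).2 (h2 x)
  · push Not at hi
    rw [hempty i hi, feasible_empty_iff]
    have him : m ≤ i := by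
      by_contra! him
      have hc := Finset.card_le_mul_card_image (s := Finset.univ) (f := pairRank g) 2
        fun b hb => by
          obtain ⟨x, -, rfl⟩ := Finset.mem_image.1 hb
          refine (Finset.card_le_card (t := {x, g x}) fun y hy => ?_).trans Finset.card_le_two
          have := (pairRank_eq_iff h1 h3 x y).1 (Finset.mem_filter.1 hy).2.symm
          simpa using this
      have hs : Finset.univ.image (pairRank g) ⊆ (Finset.range m).erase i := fun b hb => by
        obtain ⟨x, -, rfl⟩ := Finset.mem_image.1 hb
        have := two_mul_pairRank_lt h1 h3 x
        exact Finset.mem_erase.2 ⟨hi x, Finset.mem_range.2 (by omega)⟩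
      have := Finset.card_le_card hs
      rw [Finset.card_erase_of_mem (Finset.mem_range.2 him), Finset.card_range] at this
      rw [Finset.card_univ, Fintype.card_fin] at hc
      omega
    have hik := i.2
    have hmn : m = I.n + 1 := by omega
    let A : Finset (Fin (2 * m)) := Finset.univ.filter fun x => x < I.n
    have hA : A.card ≤ I.n := by
      rw [← Finset.card_map Fin.valEmbedding]
      refine (Finset.card_le_card (t := Finset.range I.n) fun x hx => ?_).trans_eq
        (Finset.card_range _)
      obtain ⟨y, hy, rfl⟩ := Finset.mem_map.1 hx
      exact Finset.mem_range.2 (Finset.mem_filter.1 hy).2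
    have hcompl := Finset.card_add_card_compl A
    rw [Fintype.card_fin] at hcompl
    obtain ⟨x, hx, hgx⟩ : ∃ x ∈ Aᶜ, g x ∉ A := by
      by_contra! hcon
      have := Finset.card_le_card_of_injOn g hcon
        (fun x _ y _ h => by rw [← h1 x, h, h1])
      omega
    have hx' : ¬ x < I.n := fun h => Finset.mem_compl.1 hx (by simpa [A] using h)
    have hgx' : ¬ g x < I.n := fun h => hgx (by simpa [A] using h)
    have := (h2 x).2.2.2
    rw [util, util, dif_neg hx', dif_neg hgx'] at this
    omega
  · obtain ⟨x, hx⟩ := hi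
    rw [← Finset.card_map (Fin.castLEEmb hn)]
    refine (Finset.card_le_card (t := {x, g x}) fun y hy => ?_).trans Finset.card_le_two
    obtain ⟨v, hv, rfl⟩ := Finset.mem_map.1 hy
    simpa using (hpair i x hx v).1 hv
  · push Not at hi
    rw [hempty i hi]; simp

/-- An allocation with feasible bundles of at most two items yields a pairing. -/
theorem exists_pairing_of_allocation {m : ℕ} {a : Fin I.n → Fin m}
    (ha : ∀ i, I.Feasible (Finset.univ.filter fun v => a v = i))
    (ha' : ∀ i, (Finset.univ.filter fun v => a v = i).card ≤ 2) :
    I.n ≤ 2 * m ∧ ∃ g : Fin (2 * m) → Fin (2 * m), (∀ x, g (g x) = x) ∧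
      ∀ x, (I.extGraph (2 * m)).Adj x (g x) := by
  have hn : I.n ≤ 2 * m := by
    have := Finset.card_le_mul_card_image_of_maps_to (s := Finset.univ) (t := Finset.univ) (f := a)
      (by simp) 2 fun i _ => ha' i
    simpa using this
  obtain ⟨b, hb, hba⟩ := exists_extension (2 * m - I.n) I.n a (by omega) ha'
  obtain ⟨g, h1, h2, h3⟩ := exists_pairing hb
  refine ⟨hn, g, h1, fun x => (feasible_iff_adj hn (h2 x).symm fun v => ?_).1 (ha (b x))⟩
  rw [← h3]
  have := hba (Fin.castLE hn v) v.2
  rw [this]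
  simp

theorem exists_pairing_of_solution {m : ℕ} (hm : m = min I.k (I.n + 1)) {a : I.Allocation}
    (ha : I.IsSolutionOfSize 2 a) : I.n ≤ 2 * m ∧ ∃ g : Fin (2 * m) → Fin (2 * m),
      (∀ x, g (g x) = x) ∧ ∀ x, (I.extGraph (2 * m)).Adj x (g x) := by
  by_cases hk : I.k ≤ I.n + 1
  · rw [min_eq_left hk] at hm
    subst hm
    exact exists_pairing_of_allocation ha.1 ha.2
  · obtain rfl : m = I.n + 1 := by omega
    obtain ⟨i, hi⟩ : ∃ i, I.bundle a i = ∅ := by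
      by_contra! hcon
      have hs : Function.Surjective a := fun i => by
        obtain ⟨v, hv⟩ := hcon i
        exact ⟨v, (Finset.mem_filter.1 hv).2⟩
      have := Fintype.card_le_of_surjective a hs
      simp only [Fintype.card_fin] at this
      omega
    have hP : I.P = 0 := by rw [← feasible_empty_iff, ← hi]; exact ha.1 i
    have hsub : ∀ i, (Finset.univ.filter fun v : Fin I.n => v.castSucc = i) = ∅ ∨
        ∃ v, (Finset.univ.filter fun v : Fin I.n => v.castSucc = i) = {v} := fun i => by
      refine Fin.lastCases (.inl ?_) (fun v => .inr ⟨v, ?_⟩) i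
      · exact Finset.filter_false_of_mem fun v _ => (Fin.castSucc_lt_last v).ne
      · ext w; simp
    refine exists_pairing_of_allocation (a := Fin.castSucc) (fun i => ?_) fun i => ?_
    · rcases hsub i with h | ⟨v, h⟩ <;> rw [h]
      · exact feasible_empty_iff.2 hP
      · refine ⟨by simp [SimpleGraph.IsIndepSet], ?_, by omega⟩
        refine (Finset.sum_le_sum_of_subset (t := I.bundle a (a v)) ?_).trans (ha.1 (a v)).2.1
        simp [bundle]
    · rcases hsub i with h | ⟨v, h⟩ <;> rw [h] <;> simp

/-- The feasible allocations with bundles of exactly two items correspond to the perfect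
matchings of the graph of feasible pairs. -/
theorem exists_isSolution_card_eq_two_iff (I : Instance) :
    (∃ a : I.Allocation, I.IsSolution a ∧ ∀ i, (I.bundle a i).card = 2) ↔
      I.n = 2 * I.k ∧ ∃ M : I.pairGraph.Subgraph, M.IsPerfectMatching := by
  constructor
  · rintro ⟨a, h1, h2⟩
    have hn : I.n = 2 * I.k := by
      have := Finset.card_eq_sum_card_fiberwise (s := Finset.univ) (t := Finset.univ) (f := a)
        (by simp)
      rw [Finset.card_univ, Fintype.card_fin] at this
      refine this.trans ((Finset.sum_congr rfl fun i _ => h2 i).trans ?_)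
      simp [mul_comm]
    obtain ⟨g, h3, h4, h5⟩ := exists_pairing h2
    have hadj : ∀ v, I.pairGraph.Adj v (g v) := fun v => by
      refine ⟨(h4 v).symm, ?_⟩
      have : I.bundle a (a v) = {v, g v} := by
        ext w
        simp [bundle, h5]
      rw [← this]
      exact h1 _
    refine ⟨hn, ⟨⟨Set.univ, fun u v => v = g u, ?_, fun _ => trivial, ⟨?_⟩⟩,
      fun v _ => ⟨g v, rfl, fun _ h => h⟩, fun _ => trivial⟩⟩
    · rintro u v rfl; exact hadj u
    · rintro u v rfl; exact (h3 u).symm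
  · rintro ⟨hn, M, hM⟩
    choose g hg hg' using fun v => hM.1 (hM.2 v)
    have h1 : ∀ v, g (g v) = v := fun v => (hg' (g v) v (hg v).symm).symm
    have h2 : ∀ v, g v ≠ v := fun v => (M.adj_sub (hg v)).ne'
    have hlt : ∀ v, pairRank g v < I.k := fun v => by
      have := two_mul_pairRank_lt h1 h2 v
      omega
    let a : I.Allocation := fun v => ⟨pairRank g v, hlt v⟩
    have hav : ∀ u v, a v = a u ↔ v = u ∨ v = g u := fun u v => by
      rw [← pairRank_eq_iff h1 h2]; simp [a, eq_comm]
    have hle : ∀ i, (I.bundle a i).card ≤ 2 := fun i => by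
      rcases (I.bundle a i).eq_empty_or_nonempty with h | ⟨u, hu⟩
      · rw [h]; simp
      · refine (Finset.card_le_card (t := {u, g u}) fun v hv => ?_).trans Finset.card_le_two
        have := (hav u v).1 ((Finset.mem_filter.1 hv).2.trans (Finset.mem_filter.1 hu).2.symm)
        simpa using this
    have hcard : ∀ i, (I.bundle a i).card = 2 := fun i => by
      have h3 := Finset.card_eq_sum_card_fiberwise (s := Finset.univ) (t := Finset.univ) (f := a)
        (by simp)
      have h4 : ∑ i : Fin I.k, 2 = I.n := by simp [hn, mul_comm]
      rw [Finset.card_univ, Fintype.card_fin] at h3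
      exact (Finset.sum_eq_sum_iff_of_le fun i _ => hle i).1 (h3.symm.trans h4.symm) i
        (Finset.mem_univ i)
    refine ⟨a, fun i => ?_, hcard⟩
    obtain ⟨u, hu⟩ := Finset.card_pos.1 (by rw [hcard i]; omega : 0 < (I.bundle a i).card)
    have : I.bundle a i = {u, g u} := by
      rw [← (Finset.mem_filter.1 hu).2]
      ext v
      simp [bundle, hav]
    rw [this]
    exact (M.adj_sub (hg u)).2

end Instance

end BCFEA

namespace RAM

open BCFEA BCFEA.Instance

section Search

local notation "xN" => (0 : ℕ)
local notation "xn" => (1 : ℕ)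
local notation "xk" => (2 : ℕ)
local notation "xP" => (3 : ℕ)
local notation "xB" => (4 : ℕ)
local notation "xr" => (5 : ℕ)
local notation "xu" => (6 : ℕ)
local notation "xv" => (7 : ℕ)
local notation "xx" => (8 : ℕ)
local notation "xy" => (9 : ℕ)
local notation "xz" => (10 : ℕ)
local notation "xw" => (11 : ℕ)
local notation "xfound" => (12 : ℕ)
local notation "xok" => (13 : ℕ)
local notation "xs" => (14 : ℕ)
local notation "xt" => (15 : ℕ)
local notation "xadj" => (16 : ℕ)
local notation "xdv" => (17 : ℕ)
local notation "xutil" => (18 : ℕ)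
local notation "xcost" => (19 : ℕ)
local notation "xconfl" => (20 : ℕ)
local notation "xcnt" => (21 : ℕ)
local notation "xlen" => (22 : ℕ)
local notation "aF" => (0 : Fin 8)
local notation "aD" => (1 : Fin 8)
local notation "aM" => (2 : Fin 8)
local notation "aC" => (3 : Fin 8)
local notation "aG" => (4 : Fin 8)

def Expr.ne (e f : Expr) : Expr := .add (.sub e f) (.sub f e)

theorem Expr.eval_ne (h : Env) (e f : Expr) : (e.ne f).eval h ≠ 0 ↔ e.eval h ≠ f.eval h := by
  simp only [Expr.ne, Expr.eval]; omega

def Cmd.block : List Cmd → Cmd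
  | [] => .skip
  | p :: l => .seq p (block l)

/-- The entry of a matrix with rows of length `N`. -/
def Expr.entry (j : Fin 8) (e f : Expr) : Expr := .arr j (.add (.mul e xN) f)

/-- Copy row `e'` of the matrix `j'` to row `e` of the matrix `j`. -/
def copyRow (j : Fin 8) (e : Expr) (j' : Fin 8) (e' : Expr) : Cmd :=
  .loop xx xN (.set j (.add (.mul e xN) (.var xx)) (.entry j' e' (.var xx)))

/-- Row `c` of the matrix `j` represents the map `C`. -/
def Row (h : Env) (j : Fin 8) (c : ℕ) {N : ℕ} (C : Fin N → Fin N) : Prop :=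
  ∀ x : Fin N, h.arr j (c * N + x) = C x

theorem row_congr {h h' : Env} {j : Fin 8} (hj : h'.arr j = h.arr j) {c N : ℕ}
    {C : Fin N → Fin N} (hC : Row h j c C) : Row h' j c C := fun x => by rw [hj]; exact hC x

theorem copyRow_arr {h : Env} {j j' : Fin 8} (hj : j' ≠ j) {e e' : Expr}
    (he : ∀ g : Env, (∀ x ≠ xx, g.var x = h.var x) → e.eval g = e.eval h)
    (he' : ∀ g : Env, (∀ x ≠ xx, g.var x = h.var x) → e'.eval g = e'.eval h) (i : ℕ) :
    ((copyRow j e j' e').eval h).arr j i =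
      if e.eval h * h.var xN ≤ i ∧ i < e.eval h * h.var xN + h.var xN then
        h.arr j' (e'.eval h * h.var xN + (i - e.eval h * h.var xN)) else h.arr j i := by
  have := loopEval_induction (x := xx)
    (f := (Cmd.set j (.add (.mul e xN) (.var xx)) (.entry j' e' (.var xx))).eval)
    (fun k g => (∀ x ≠ xx, g.var x = h.var x) ∧ g.arr j' = h.arr j' ∧ k ≤ h.var xN ∧
      ∀ i, g.arr j i =
      if e.eval h * h.var xN + k ≤ i ∧ i < e.eval h * h.var xN + h.var xN then
        h.arr j' (e'.eval h * h.var xN + (i - e.eval h * h.var xN)) else h.arr j i)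
    (fun k g hg => ?_) (fun g hg => ?_) (h.var xN) h
    ⟨fun _ _ => rfl, rfl, le_rfl, fun i => ?_⟩
  · exact this.2.2.2 i
  · obtain ⟨h1, h2, hk, h3⟩ := hg
    have h4 : ∀ x ≠ xx, (g.setVar xx k).var x = h.var x := fun x hx => by
      simpa [Env.setVar, hx] using h1 x hx
    have h5 : (g.setVar xx k).var xx = k := by simp [Env.setVar]
    have h6 : (g.setVar xx k).arr j' = h.arr j' := h2
    have h7 : (g.setVar xx k).arr j = g.arr j := rfl
    simp only [Cmd.eval, Expr.eval, Expr.entry, he _ h4, he' _ h4, h4 xN (by decide), h5, h6]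
    refine ⟨h4, ?_, by omega, fun i => ?_⟩
    · simp [Env.setArr, hj, h6]
    · simp only [Env.setArr, Function.update_self, Function.update_apply, h7, h3]
      by_cases hi : i = e.eval h * h.var xN + k
      · rw [if_pos hi, if_pos (by omega)]; congr 1; omega
      · rw [if_neg hi]; congr 1; simp only [eq_iff_iff]; omega
  · obtain ⟨h1, h2, hk, h3⟩ := hg
    refine ⟨fun x hx => ?_, h2, hk, h3⟩
    simpa [Env.setVar, hx] using h1 x hx
  · rw [if_neg (by omega)]

theorem row_index {N c d : ℕ} (hcd : d ≠ c) (x : Fin N) :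
    ¬ (c * N ≤ d * N + x ∧ d * N + x < c * N + N) := by
  rintro ⟨h1, h2⟩
  have := x.2
  rcases lt_or_gt_of_ne hcd with h | h
  · have : (d + 1) * N ≤ c * N := Nat.mul_le_mul_right _ h
    rw [add_mul] at this; omega
  · have : (c + 1) * N ≤ d * N := Nat.mul_le_mul_right _ h
    rw [add_mul] at this; omega

theorem copyRow_spec {h : Env} {j j' : Fin 8} (hj : j' ≠ j) {e e' : Expr}
    (he : ∀ g : Env, (∀ x ≠ xx, g.var x = h.var x) → e.eval g = e.eval h)
    (he' : ∀ g : Env, (∀ x ≠ xx, g.var x = h.var x) → e'.eval g = e'.eval h) {N : ℕ}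
    (hN : h.var xN = N) {C : Fin N → Fin N} (hC : Row h j' (e'.eval h) C) :
    Row ((copyRow j e j' e').eval h) j (e.eval h) C := by
  intro x
  rw [copyRow_arr hj he he', hN, if_pos (by omega), Nat.add_sub_cancel_left, hC x]

theorem copyRow_other {h : Env} {j j' : Fin 8} (hj : j' ≠ j) {e e' : Expr}
    (he : ∀ g : Env, (∀ x ≠ xx, g.var x = h.var x) → e.eval g = e.eval h)
    (he' : ∀ g : Env, (∀ x ≠ xx, g.var x = h.var x) → e'.eval g = e'.eval h) {N : ℕ}
    (hN : h.var xN = N) {C : Fin N → Fin N} {d : ℕ} (hd : d ≠ e.eval h) (hC : Row h j d C) :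
    Row ((copyRow j e j' e').eval h) j d C := by
  intro x
  rw [copyRow_arr hj he he', hN, if_neg (row_index hd x), hC x]

/-- The input registers describe an instance that is extended to `N` items. -/
structure Ctx (I : Instance) (N : ℕ) (h : Env) : Prop where
  N_eq : h.var xN = N
  n_eq : h.var xn = I.n
  P_eq : h.var xP = I.P
  B_eq : h.var xB = I.B
  inp : ∀ a, h.inp a = I.encode.getD a 0

theorem Ctx.eval {I : Instance} {N : ℕ} {h : Env} (c : Ctx I N h) (p : Cmd)
    (h0 : p.assigns xN = false) (h1 : p.assigns xn = false) (h2 : p.assigns xP = false)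
    (h3 : p.assigns xB = false) (h4 : p.puts = false) : Ctx I N (p.eval h) :=
  ⟨(p.eval_var h h0).trans c.N_eq, (p.eval_var h h1).trans c.n_eq, (p.eval_var h h2).trans c.P_eq,
    (p.eval_var h h3).trans c.B_eq, fun a => by rw [p.eval_inp h h4, c.inp]⟩

/-- Compute whether `u` and `v` are adjacent. -/
def adjCmd : Cmd := .block
  [.assign xcost (.lit 0), .assign xutil (.lit 0), .assign xconfl (.lit 0), .assign xadj (.lit 0),
    .ite (.sub (.var xn) (.var xu)) (.block
      [.assign xcost (.inp (.add (.add (.lit 4) (.var xn)) (.var xu))),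
        .assign xutil (.inp (.add (.lit 4) (.var xu))),
        .ite (.sub (.var xn) (.var xv))
          (.assign xconfl (.inp (.add (.add (.add (.lit 4) (.var xn)) (.var xn))
            (.add (.mul (.var xu) xn) (.var xv))))) .skip]) .skip,
    .ite (.sub (.var xn) (.var xv)) (.block
      [.assign xcost (.add (.var xcost) (.inp (.add (.add (.lit 4) (.var xn)) (.var xv)))),
        .assign xutil (.add (.var xutil) (.inp (.add (.lit 4) (.var xv))))]) .skip,
    .ite (.var xconfl) .skip (.ite (.sub (.var xcost) (.var xB)) .skip
      (.ite (.sub (.var xP) (.var xutil)) .skip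
        (.assign xadj (.ne (.var xu) (.var xv)))))]

theorem adjCmd_spec {I : Instance} {N : ℕ} {h : Env} (c : Ctx I N h) {x y : Fin N}
    (hx : h.var xu = x) (hy : h.var xv = y) :
    (adjCmd.eval h).var xadj ≠ 0 ↔ (I.extGraph N).Adj x y := by
  classical
  have hxy : x = y ↔ (x : ℕ) = y := Fin.ext_iff
  have hn := c.n_eq
  have hP := c.P_eq
  have hB := c.B_eq
  have hp : ∀ z : Fin N, (z : ℕ) < I.n → h.inp (4 + z) = I.util N z := fun z hz => by
    rw [c.inp, I.encode_util hz, Instance.util, dif_pos hz]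
  have hc : ∀ z : Fin N, (z : ℕ) < I.n → h.inp (4 + I.n + z) = I.cost N z := fun z hz => by
    rw [c.inp, I.encode_cost hz, Instance.cost, dif_pos hz]
  have hp' : ∀ z : Fin N, ¬ (z : ℕ) < I.n → I.util N z = 0 := fun z hz => dif_neg hz
  have hc' : ∀ z : Fin N, ¬ (z : ℕ) < I.n → I.cost N z = 0 := fun z hz => dif_neg hz
  have hg : (x : ℕ) < I.n → (y : ℕ) < I.n →
      (h.inp (4 + I.n + I.n + (x * I.n + y)) = 0 ↔ ¬ I.Conflict N x y) := fun hx hy => by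
    rw [c.inp, I.encode_adj hx hy, Instance.Conflict]
    simp [hx, hy]
  have hE : (I.extGraph N).Adj x y ↔ x ≠ y ∧ ¬ I.Conflict N x y ∧
    I.cost N x + I.cost N y ≤ I.B ∧ I.P ≤ I.util N x + I.util N y := Iff.rfl
  simp only [adjCmd, Cmd.block, Cmd.eval, Expr.eval, Expr.ne, Env.setVar, Function.update_apply]
  by_cases h1 : (x : ℕ) < I.n <;> by_cases h2 : (y : ℕ) < I.n
  · have h3 : I.n - (x : ℕ) ≠ 0 := by omega
    have h4 : I.n - (y : ℕ) ≠ 0 := by omega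
    by_cases hC : I.Conflict N x y
    · simp [hn, hx, hy, h3, h4, hg h1 h2, hC, hE]
    · simp [hn, hx, hy, hP, hB, h3, h4, hp x h1, hc x h1, hp y h2, hc y h2, (hg h1 h2).2 hC, hC, hE, apply_ite Env.var, ite_apply, hxy]
      omega
  · have h3 : I.n - (x : ℕ) ≠ 0 := by omega
    have h4 : I.n - (y : ℕ) = 0 := by omega
    have hC : ¬ I.Conflict N x y := fun ⟨h5, h6, _⟩ => h2 h6
    simp [hn, hx, hy, hP, hB, h3, h4, hp x h1, hc x h1, hp' y h2, hc' y h2, hC, hE, apply_ite Env.var, ite_apply, hxy]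
    omega
  · have h3 : I.n - (x : ℕ) = 0 := by omega
    have h4 : I.n - (y : ℕ) ≠ 0 := by omega
    have hC : ¬ I.Conflict N x y := fun ⟨h5, h6, _⟩ => h1 h5
    simp [hn, hx, hy, hP, hB, h3, h4, hp' x h1, hc' x h1, hp y h2, hc y h2, hC, hE, apply_ite Env.var, ite_apply, hxy]
    omega
  · have h3 : I.n - (x : ℕ) = 0 := by omega
    have h4 : I.n - (y : ℕ) = 0 := by omega
    have hC : ¬ I.Conflict N x y := fun ⟨h5, h6, _⟩ => h1 h5
    simp [hn, hx, hy, hP, hB, h3, h4, hp' x h1, hc' x h1, hp' y h2, hc' y h2, hC, hE, apply_ite Env.var, ite_apply, hxy]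
    omega

/-- The array `aD` marks the elements of `D`. -/
def Flags {N : ℕ} (h : Env) (D : Finset (Fin N)) : Prop := ∀ x : Fin N, h.arr aD x ≠ 0 ↔ x ∈ D

/-- The matrix `aM` contains the matchings `m u` for `u ∈ D`. -/
def Rows {N : ℕ} (h : Env) (D : Finset (Fin N)) (m : Fin N → Fin N → Fin N) : Prop :=
  ∀ u ∈ D, Row h aM u (m u)

theorem flags_congr {N : ℕ} {h h' : Env} {D : Finset (Fin N)} (e : h'.arr aD = h.arr aD)
    (H : Flags h D) : Flags h' D := fun x => by rw [e]; exact H x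

theorem rows_congr {N : ℕ} {h h' : Env} {D : Finset (Fin N)} {m : Fin N → Fin N → Fin N}
    (e : h'.arr aM = h.arr aM) (H : Rows h D m) : Rows h' D m := fun u hu => row_congr e (H u hu)

/-- Match `y` with `z` in `aC`, and let `y` be the new exposed vertex. -/
def exchangeCmd : Cmd := .block
  [.assign xw (.arr aC (.var xz)), .set aC (.var xz) (.var xy), .set aC (.var xy) (.var xz),
    .set aC (.var xw) (.var xw), .assign xy (.var xw)]

/-- Record `aC` as the matching that exposes `y`, if there was none. -/
def saveCmd : Cmd := .ite (.arr aD (.var xy)) .skip (.block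
  [.set aD (.var xy) (.lit 1), copyRow aM (.var xy) aC (.lit 0)])

def traceCmd : Cmd := .ite (.ne (.var xz) (.var xu)) (.block
  [exchangeCmd, saveCmd,
    .ite (.var xdv) (.assign xz (.entry aM (.var xv) (.var xy))) (.assign xz (.var xu))]) .skip

theorem exchangeCmd_spec {N : ℕ} {h : Env} {C : Fin N → Fin N} {y z : Fin N} (hy : h.var xy = y)
    (hz : h.var xz = z) (hC : Row h aC 0 C) :
    Row (exchangeCmd.eval h) aC 0 (exchange C y z) ∧ (exchangeCmd.eval h).var xy = C z := by
  have hCz : h.arr aC z = C z := by have := hC z; rwa [Nat.zero_mul, Nat.zero_add] at this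
  refine ⟨fun x => ?_, ?_⟩
  · have hCx : h.arr aC x = C x := by have := hC x; rwa [Nat.zero_mul, Nat.zero_add] at this
    simp only [exchangeCmd, Cmd.block, Cmd.eval, Expr.eval, Env.setVar, Env.setArr,
      Function.update_apply, exchange_apply, Nat.zero_mul, Nat.zero_add, hy, hz, hCz, if_true,
      Fin.ext_iff]
    simp [hCx, apply_ite Fin.val]
  · simp [exchangeCmd, Cmd.block, Cmd.eval, Expr.eval, Env.setVar, Env.setArr, hz, hCz]

theorem saveCmd_spec {N : ℕ} {h : Env} {C : Fin N → Fin N} {w : Fin N} {D : Finset (Fin N)}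
    {m : Fin N → Fin N → Fin N} (hN : h.var xN = N) (hw : h.var xy = w) (hC : Row h aC 0 C)
    (hD : Flags h D) (hm : Rows h D m) :
    ∃ m', Flags (saveCmd.eval h) (insert w D) ∧ Rows (saveCmd.eval h) (insert w D) m' ∧
      (∀ x ∈ D, m' x = m x) ∧ (w ∉ D → m' w = C) := by
  by_cases hwD : w ∈ D
  · have e : saveCmd.eval h = h := by
      rw [saveCmd, Cmd.eval, if_pos]; · rfl
      rw [Expr.eval, Expr.eval, hw]; exact (hD w).2 hwD
    rw [e, Finset.insert_eq_of_mem hwD]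
    exact ⟨m, hD, hm, fun _ _ => rfl, fun h => absurd hwD h⟩
  · have hc : ¬ (Expr.arr aD (.var xy)).eval h ≠ 0 := by
      rw [Expr.eval, Expr.eval, hw]; exact fun h1 => hwD ((hD w).1 h1)
    have e : saveCmd.eval h = (copyRow aM (.var xy) aC (.lit 0)).eval (h.setArr aD w 1) := by
      rw [saveCmd, Cmd.eval, if_neg hc]; simp only [Cmd.block, Cmd.eval, Expr.eval, hw]
    have he : ∀ g : Env, (∀ x ≠ xx, g.var x = (h.setArr aD w 1).var x) →
        (Expr.var xy).eval g = (Expr.var xy).eval (h.setArr aD w 1) := fun g hg => hg xy (by decide)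
    have hev : (Expr.var xy).eval (h.setArr aD w 1) = w := hw
    have hC' : Row (h.setArr aD w 1) aC 0 C := row_congr (by simp [Env.setArr]) hC
    rw [e]
    refine ⟨Function.update m w C, fun x => ?_, fun x hx => ?_, fun x hx => ?_, fun _ => by simp⟩
    · rw [Cmd.eval_arr _ _ (by rfl)]
      simp only [Env.setArr, Function.update_self, Function.update_apply, Finset.mem_insert,
        Fin.ext_iff]
      have := hD x
      split_ifs with h1 <;> simp [h1, this]
    · by_cases hxw : x = w
      · subst hxw
        have h1 := copyRow_spec (j := aM) (j' := aC) (by decide) he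
          (e' := .lit 0) (fun _ _ => rfl) hN hC'
        rw [hev] at h1
        rw [Function.update_self]
        exact h1
      · rw [Function.update_of_ne hxw]
        refine copyRow_other (j := aM) (j' := aC) (by decide) he (e' := .lit 0) (fun _ _ => rfl) hN ?_
          (row_congr (by simp [Env.setArr]) (hm x ((Finset.mem_insert.1 hx).resolve_left hxw)))
        rw [hev]; exact fun h1 => hxw (Fin.ext h1)
    · exact Function.update_of_ne (by rintro rfl; exact hwD hx) _ _

/-- The state of the search along a cycle. -/
structure TraceState {N : ℕ} (h : Env) (D : Finset (Fin N)) (m : Fin N → Fin N → Fin N)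
    (C : Fin N → Fin N) (y z : Fin N) : Prop where
  flags : Flags h D
  rows : Rows h D m
  row : Row h aC 0 C
  y_eq : h.var xy = y
  z_eq : h.var xz = z

theorem TraceState.step {N : ℕ} {h : Env} {D : Finset (Fin N)} {m : Fin N → Fin N → Fin N}
    {C : Fin N → Fin N} {y z u v : Fin N} (s : TraceState h D m C y z) (hN : h.var xN = N)
    (hu : h.var xu = u) (hv : h.var xv = v) (hzu : z ≠ u) :
    ∃ m', (∀ x ∈ D, m' x = m x) ∧ (C z ∉ D → m' (C z) = exchange C y z) ∧
      (h.var xdv = 0 → TraceState (traceCmd.eval h) (insert (C z) D) m' (exchange C y z) (C z) u) ∧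
      (h.var xdv ≠ 0 → v ∈ D →
        TraceState (traceCmd.eval h) (insert (C z) D) m' (exchange C y z) (C z) (m v (C z))) := by
  obtain ⟨r1, v1⟩ := exchangeCmd_spec s.y_eq s.z_eq s.row
  have hN1 : (exchangeCmd.eval h).var xN = N := (Cmd.eval_var _ _ (by rfl)).trans hN
  obtain ⟨m', f2, r2, h1, h2⟩ := saveCmd_spec hN1 v1 r1
    (flags_congr (Cmd.eval_arr _ _ (by rfl)) s.flags) (rows_congr (Cmd.eval_arr _ _ (by rfl)) s.rows)
  refine ⟨m', h1, h2, ?_⟩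
  set g := saveCmd.eval (exchangeCmd.eval h) with hg
  have gvar : ∀ x, saveCmd.assigns x = false → exchangeCmd.assigns x = false →
      g.var x = h.var x := fun x e1 e2 => (Cmd.eval_var _ _ e1).trans (Cmd.eval_var _ _ e2)
  have gy : g.var xy = C z := (Cmd.eval_var _ _ (by rfl)).trans v1
  have gC : Row g aC 0 (exchange C y z) := row_congr (Cmd.eval_arr _ _ (by rfl)) r1
  have e : traceCmd.eval h =
      if g.var xdv ≠ 0 then g.setVar xz ((Expr.entry aM (.var xv) (.var xy)).eval g)
        else g.setVar xz (g.var xu) := by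
    rw [traceCmd, Cmd.eval, if_pos]
    · rfl
    · rw [Expr.eval_ne, Expr.eval, Expr.eval, s.z_eq, hu]; exact fun h => hzu (Fin.ext h)
  have gdv : g.var xdv = h.var xdv := gvar _ rfl rfl
  rw [e, gdv]
  constructor
  · intro hd
    rw [if_neg (by simpa using hd)]
    exact ⟨f2, r2, gC, by simpa [Env.setVar] using gy,
      by simpa [Env.setVar, hu] using gvar xu rfl rfl⟩
  · intro hd hvD
    rw [if_pos hd]
    refine ⟨f2, r2, gC, by simpa [Env.setVar] using gy, ?_⟩
    have h3 := r2 v (Finset.mem_insert_of_mem hvD) (C z)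
    rw [h1 v hvD] at h3
    have gN : g.var xN = N := (gvar xN rfl rfl).trans hN
    have gv : g.var xv = v := (gvar xv rfl rfl).trans hv
    simp only [Env.setVar, Function.update_self, Expr.entry, Expr.eval, gN, gy, gv]
    exact h3

theorem traceCmd_idle {h : Env} (hz : h.var xz = h.var xu) : traceCmd.eval h = h := by
  rw [traceCmd, Cmd.eval, if_neg]
  · rfl
  · rw [Expr.eval_ne]; exact fun h1 => h1 hz

/-- The search from the root `r` is in progress. -/
structure Searching {N : ℕ} (G : SimpleGraph (Fin N)) (f : Fin N → Fin N) (r : Fin N) (h : Env)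
    (D : Finset (Fin N)) (m : Fin N → Fin N → Fin N) : Prop where
  notFound : h.var xfound = 0
  row : Row h aF 0 f
  flags : Flags h D
  rows : Rows h D m
  forest : ∃ cls p, Forest G f r D m cls p

/-- The search cannot proceed with the pair `u`, `v`. -/
def ClosedPair {N : ℕ} (G : SimpleGraph (Fin N)) (f : Fin N → Fin N) (r : Fin N)
    (D : Finset (Fin N)) (m : Fin N → Fin N → Fin N) (u v : Fin N) : Prop :=
  u ∈ D → G.Adj u v → (v ∉ D → m u v ∈ D) ∧
    (v ∈ D → ∀ cls p, Forest G f r D m cls p → cls u = cls v)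

/-- Enlarge the forest along the edge from `u` to `v`. -/
def extendCmd : Cmd := .block
  [copyRow aC (.lit 0) aM (.var xu), .assign xy (.var xu), .assign xz (.var xv),
    .assign xdv (.arr aD (.var xv)), .loop xs xN traceCmd]

theorem TraceState.setVar {N : ℕ} {h : Env} {D : Finset (Fin N)} {m : Fin N → Fin N → Fin N}
    {C : Fin N → Fin N} {y z : Fin N} (s : TraceState h D m C y z) (i : ℕ) :
    TraceState (h.setVar xs i) D m C y z :=
  ⟨s.flags, s.rows, s.row, by simpa [Env.setVar] using s.y_eq, by simpa [Env.setVar] using s.z_eq⟩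

variable {N : ℕ} {G : SimpleGraph (Fin N)} {f : Fin N → Fin N} {r : Fin N} {h : Env}
  {D : Finset (Fin N)} {m : Fin N → Fin N → Fin N} {u v : Fin N}

/-- The loop of `extendCmd` preserves what its body preserves. -/
theorem extendCmd_induction (hN : h.var xN = N) (S : Searching G f r h D m) (hu : h.var xu = u)
    (hv : h.var xv = v) (huD : u ∈ D)
    (Q : ℕ → Finset (Fin N) → (Fin N → Fin N → Fin N) → (Fin N → Fin N) → Fin N → Fin N → Prop)
    (start : Q N D m (m u) u v)
    (step : ∀ i (g : Env) D' m' C y z, g.var xN = N → g.var xu = u → g.var xv = v →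
      (g.var xdv ≠ 0 ↔ v ∈ D) → TraceState g D' m' C y z → Q (i + 1) D' m' C y z →
      ∃ D'' m'' C' y' z', TraceState (traceCmd.eval g) D'' m'' C' y' z' ∧ Q i D'' m'' C' y' z') :
    ∃ D' m' C y z, TraceState (extendCmd.eval h) D' m' C y z ∧ Q 0 D' m' C y z := by
  let e₁ := (copyRow aC (.lit 0) aM (.var xu)).eval h
  let g := ((e₁.setVar xy u).setVar xz v).setVar xdv (h.arr aD v)
  have hvar : ∀ x, x ≠ xx → e₁.var x = h.var x := fun x hx =>
    Cmd.eval_var _ _ (by simpa [copyRow, Cmd.assigns] using hx)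
  have hC : Row e₁ aC 0 (m u) := by
    refine copyRow_spec (j := aC) (j' := aM) (by decide) (e := .lit 0) (e' := .var xu)
      (fun _ _ => rfl) (fun g hg => hg xu (by decide)) hN ?_
    rw [Expr.eval, hu]; exact S.rows u huD
  have e : extendCmd.eval h = loopEval traceCmd.eval xs N g := by
    have h1 : e₁.arr aD = h.arr aD := Cmd.eval_arr _ _ (by rfl)
    simp only [extendCmd, Cmd.block, Cmd.eval, Expr.eval, g]
    simp [Env.setVar, hvar, hu, hv, hN, h1, e₁]
  have key := loopEval_induction (x := xs) (f := traceCmd.eval)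
    (fun i g => g.var xN = N ∧ g.var xu = u ∧ g.var xv = v ∧ (g.var xdv ≠ 0 ↔ v ∈ D) ∧
      ∃ D' m' C y z, TraceState g D' m' C y z ∧ Q i D' m' C y z) ?_ ?_ N g ?_
  · rw [e]; exact key.2.2.2.2
  · rintro i g ⟨h1, h2, h3, h4, D', m', C, y, z, h5, h6⟩
    have h1' : (g.setVar xs i).var xN = N := by simpa [Env.setVar] using h1
    have h2' : (g.setVar xs i).var xu = u := by simpa [Env.setVar] using h2
    have h3' : (g.setVar xs i).var xv = v := by simpa [Env.setVar] using h3
    have h4' : (g.setVar xs i).var xdv ≠ 0 ↔ v ∈ D := by simpa [Env.setVar] using h4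
    refine ⟨(Cmd.eval_var _ _ (by rfl)).trans h1', (Cmd.eval_var _ _ (by rfl)).trans h2',
      (Cmd.eval_var _ _ (by rfl)).trans h3', ?_, step i _ D' m' C y z h1' h2' h3' h4'
        (h5.setVar i) h6⟩
    rw [Cmd.eval_var _ _ (by rfl)]; exact h4'
  · rintro g ⟨h1, h2, h3, h4, D', m', C, y, z, h5, h6⟩
    exact ⟨by simpa [Env.setVar] using h1, by simpa [Env.setVar] using h2,
      by simpa [Env.setVar] using h3, by simpa [Env.setVar] using h4, D', m', C, y, z,
      h5.setVar 0, h6⟩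
  · refine ⟨by simp [g, Env.setVar, hvar, hN], by simp [g, Env.setVar, hvar, hu],
      by simp [g, Env.setVar, hvar, hv], ?_, D, m, m u, u, v, ⟨?_, ?_, hC, ?_, ?_⟩, start⟩
    · simpa [g, Env.setVar] using S.flags v
    · exact flags_congr (Cmd.eval_arr (copyRow aC (.lit 0) aM (.var xu)) h (by rfl)) S.flags
    · exact rows_congr (Cmd.eval_arr (copyRow aC (.lit 0) aM (.var xu)) h (by rfl)) S.rows
    · simp [g, Env.setVar]
    · simp [g, Env.setVar]

theorem extendCmd_spec (hN : h.var xN = N) (S : Searching G f r h D m) (hu : h.var xu = u)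
    (hv : h.var xv = v) (huD : u ∈ D) (huv : G.Adj u v) (hne : m u v ≠ v) :
    ∃ D' m', Searching G f r (extendCmd.eval h) D' m' ∧
      (D.card < D'.card ∨ (D' = D ∧ m' = m ∧ ClosedPair G f r D m u v)) := by
  obtain ⟨cls, p, F⟩ := S.forest
  have fin : ∀ {D' m' C y z}, TraceState (extendCmd.eval h) D' m' C y z →
      (∃ cls p, Forest G f r D' m' cls p) → Searching G f r (extendCmd.eval h) D' m' :=
    fun T hF => ⟨(Cmd.eval_var _ _ (by rfl)).trans S.notFound,
      row_congr (Cmd.eval_arr _ _ (by rfl)) S.row, T.flags, T.rows, hF⟩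
  by_cases hvD : v ∈ D
  · obtain ⟨a, b, q, c⟩ := F.exists_oddCycle huD hvD huv.ne hne
    obtain ⟨D', m', C, y, z, T, t, h1, h2, h3⟩ := extendCmd_induction hN S hu hv huD
      (fun i D' m' C y z => ∃ t, OddCycle.Trace G f r D m u v a b q t D' m' C y z ∧
        t ≤ q ∧ (t = q ∨ i + t = N))
      ⟨0, F.trace_start c huD huv, by omega, .inr (by omega)⟩ (by
        rintro i g D' m' C y z gN gu gv gd T ⟨t, h1, h2, h3⟩
        by_cases htq : t = q
        · subst htq
          have hz := h1.next_eq c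
          rw [traceCmd_idle (by rw [T.z_eq, gu, hz])]
          exact ⟨D', m', C, y, z, T, t, h1, h2, .inl rfl⟩
        · have hlt : t < q := by omega
          obtain ⟨m'', g1, g2, -, g3⟩ := T.step gN gu gv (h1.next_ne c hlt)
          have hvD' : v ∈ D' := (h1.mem v).2 (.inl hvD)
          have T' := g3 (gd.2 hvD) hvD'
          rw [h1.old v hvD] at T'
          exact ⟨_, _, _, _, _, T', t + 1, h1.step c F huD hvD hlt g1 g2, by omega,
            .inr (by omega)⟩)
    have hqN : q < N := by simpa using c.lt_card
    obtain rfl : t = q := by omega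
    by_cases hDD : D' = D
    · subst hDD
      refine ⟨D', m, ⟨(Cmd.eval_var _ _ (by rfl)).trans S.notFound,
        row_congr (Cmd.eval_arr _ _ (by rfl)) S.row, T.flags, fun x hx => ?_, S.forest⟩,
        .inr ⟨rfl, rfl, fun _ _ => ⟨fun h4 => absurd hvD h4, fun _ cls' p' F' =>
          h1.cls_eq c F' huD hvD⟩⟩⟩
      have := T.rows x hx
      rwa [h1.old x hx] at this
    · refine ⟨D', m', fin T (h1.finish c F huD hvD), .inl (Finset.card_lt_card
        (lt_of_le_of_ne (fun x hx => (h1.mem x).2 (.inl hx)) (Ne.symm hDD)))⟩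
  · obtain ⟨D', m', C, y, z, T, h1⟩ := extendCmd_induction hN S hu hv huD
      (fun i D' m' C y z => (i = N ∧ D' = D ∧ m' = m ∧ C = m u ∧ y = u ∧ z = v) ∨
        (z = u ∧ D' = insert (m u v) D ∧ (∀ x ∈ D, m' x = m x) ∧
          (m u v ∉ D → m' (m u v) = exchange (m u) u v)))
      (.inl ⟨rfl, rfl, rfl, rfl, rfl, rfl⟩) (by
        rintro i g D' m' C y z gN gu gv gd T (⟨-, rfl, rfl, rfl, rfl, rfl⟩ | ⟨rfl, h1⟩)
        · obtain ⟨m'', g1, g2, g3, -⟩ := T.step gN gu gv huv.ne.symm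
          have := g3 (by by_contra hd; exact hvD (gd.1 hd))
          exact ⟨_, _, _, _, _, this, .inr ⟨rfl, rfl, g1, g2⟩⟩
        · rw [traceCmd_idle (by rw [T.z_eq, gu])]
          exact ⟨D', m', C, y, z, T, .inr ⟨rfl, h1⟩⟩)
    obtain ⟨-, rfl, h2, h3⟩ := h1.resolve_left fun h2 => by have := u.2; omega
    by_cases hw : m u v ∈ D
    · have e : insert (m u v) D = D := Finset.insert_eq_of_mem hw
      rw [e] at T
      refine ⟨D, m, ⟨(Cmd.eval_var _ _ (by rfl)).trans S.notFound,
        row_congr (Cmd.eval_arr _ _ (by rfl)) S.row, T.flags, fun x hx => ?_, S.forest⟩,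
        .inr ⟨rfl, rfl, fun _ _ => ⟨fun _ => hw, fun h4 => absurd h4 hvD⟩⟩⟩
      have := T.rows x hx
      rwa [h2 x hx] at this
    · refine ⟨_, m', fin T (F.grow huD huv hvD hne hw h2 (h3 hw)), .inl ?_⟩
      rw [Finset.card_insert_of_notMem hw]; omega

section

variable {I : Instance} {N : ℕ} {f : Fin N → Fin N} {r : Fin N} {h : Env}
  {D : Finset (Fin N)} {m : Fin N → Fin N → Fin N} {u v : Fin N}

/-- The search was successful: the array `aF` contains a matching that covers `r` and all vertices
that are covered by `f`. -/
def Found (G : SimpleGraph (Fin N)) (f : Fin N → Fin N) (r : Fin N) (h : Env) : Prop :=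
  h.var xfound ≠ 0 ∧ ∃ f', Row h aF 0 f' ∧ Mates G f' ∧ ∀ x, f' x = x → f x = x ∧ x ≠ r

theorem Ctx.setVar (c : Ctx I N h) {x : ℕ} (hx : x ≠ xN ∧ x ≠ xn ∧ x ≠ xP ∧ x ≠ xB) (i : ℕ) :
    Ctx I N (h.setVar x i) := by
  obtain ⟨h0, h1, h2, h3⟩ := hx
  exact ⟨by simpa [Env.setVar, h0.symm] using c.N_eq, by simpa [Env.setVar, h1.symm] using c.n_eq,
    by simpa [Env.setVar, h2.symm] using c.P_eq, by simpa [Env.setVar, h3.symm] using c.B_eq, c.inp⟩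

theorem Searching.setVar {G : SimpleGraph (Fin N)} (s : Searching G f r h D m) {x : ℕ}
    (hx : x ≠ xfound) (i : ℕ) : Searching G f r (h.setVar x i) D m :=
  ⟨by simpa [Env.setVar, hx.symm] using s.notFound, s.row, s.flags, s.rows, s.forest⟩

theorem Found.setVar {G : SimpleGraph (Fin N)} (s : Found G f r h) {x : ℕ}
    (hx : x ≠ xfound) (i : ℕ) : Found G f r (h.setVar x i) :=
  ⟨by simpa [Env.setVar, hx.symm] using s.1, s.2⟩

/-- Augment the matching along the edge from `u` to the exposed vertex `v`. -/
def augmentCmd : Cmd := .block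
  [copyRow aF (.lit 0) aM (.var xu), .set aF (.var xu) (.var xv), .set aF (.var xv) (.var xu),
    .assign xfound (.lit 1)]

/-- Process the pair `u`, `v`. -/
def pairCmd : Cmd := .ite (.var xfound) .skip (.ite (.arr aD (.var xu)) (.block
  [adjCmd, .ite (.var xadj) (.ite (.ne (.entry aM (.var xu) (.var xv)) (.var xv)) extendCmd
    augmentCmd) .skip]) .skip)

theorem augmentCmd_spec {G : SimpleGraph (Fin N)} (hN : h.var xN = N) (S : Searching G f r h D m)
    (hu : h.var xu = u) (hv : h.var xv = v) (huD : u ∈ D) (huv : G.Adj u v) (hne : m u v = v) :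
    Found G f r (augmentCmd.eval h) := by
  obtain ⟨cls, p, F⟩ := S.forest
  obtain ⟨h1, h2⟩ := (F.mates u huD).join_spec ((F.fixed u huD u).2 (.inl rfl)) hne huv
  refine ⟨by simp [augmentCmd, Cmd.block, Cmd.eval, Expr.eval, Env.setVar], _, ?_, h1,
    fun x hx => ?_⟩
  · have hC : Row ((copyRow aF (.lit 0) aM (.var xu)).eval h) aF 0 (m u) := by
      refine copyRow_spec (j := aF) (j' := aM) (by decide) (e := .lit 0) (e' := .var xu)
        (fun _ _ => rfl) (fun g hg => hg xu (by decide)) hN ?_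
      rw [Expr.eval, hu]; exact S.rows u huD
    have hu' := (Cmd.eval_var (z := xu) (copyRow aF (.lit 0) aM (.var xu)) h (by rfl)).trans hu
    have hv' := (Cmd.eval_var (z := xv) (copyRow aF (.lit 0) aM (.var xu)) h (by rfl)).trans hv
    intro x
    have hCx := hC x
    rw [Nat.zero_mul, Nat.zero_add] at hCx ⊢
    simp only [augmentCmd, Cmd.block, Cmd.eval, Expr.eval, Env.setVar, Env.setArr,
      Function.update_apply, hu', hv', Fin.ext_iff, if_true]
    simp [hCx, apply_ite Fin.val]
  · obtain ⟨h3, h4, -⟩ := (h2 x).1 hx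
    exact ((F.fixed u huD x).1 h3).resolve_left h4

theorem pairCmd_spec (c : Ctx I N h) (S : Searching (I.extGraph N) f r h D m) (hu : h.var xu = u)
    (hv : h.var xv = v) : Found (I.extGraph N) f r (pairCmd.eval h) ∨
      ∃ D' m', Searching (I.extGraph N) f r (pairCmd.eval h) D' m' ∧
        (D.card < D'.card ∨ (D' = D ∧ m' = m ∧ ClosedPair (I.extGraph N) f r D m u v)) := by
  have e : pairCmd.eval h = if h.arr aD u ≠ 0 then
      (if (adjCmd.eval h).var xadj ≠ 0 then
        (if (Expr.ne (.entry aM (.var xu) (.var xv)) (.var xv)).eval (adjCmd.eval h) ≠ 0 then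
          extendCmd.eval (adjCmd.eval h) else augmentCmd.eval (adjCmd.eval h))
        else adjCmd.eval h) else h := by
    rw [pairCmd, Cmd.eval, if_neg (by simpa [Expr.eval] using S.notFound)]
    simp only [Cmd.block, Cmd.eval, Expr.eval, hu]
    rfl
  have hflag := S.flags u
  by_cases huD : u ∈ D
  · rw [e, if_pos (hflag.2 huD)]
    have c1 := c.eval adjCmd (by rfl) (by rfl) (by rfl) (by rfl) (by rfl)
    have hadj := adjCmd_spec c hu hv
    have hu1 : (adjCmd.eval h).var xu = u := (Cmd.eval_var _ _ (by rfl)).trans hu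
    have hv1 : (adjCmd.eval h).var xv = v := (Cmd.eval_var _ _ (by rfl)).trans hv
    have S1 : Searching (I.extGraph N) f r (adjCmd.eval h) D m :=
      ⟨(Cmd.eval_var _ _ (by rfl)).trans S.notFound, row_congr (Cmd.eval_arr _ _ (by rfl)) S.row,
        flags_congr (Cmd.eval_arr _ _ (by rfl)) S.flags,
        rows_congr (Cmd.eval_arr _ _ (by rfl)) S.rows, S.forest⟩
    by_cases huv : (I.extGraph N).Adj u v
    · rw [if_pos (hadj.2 huv)]
      have hent : (Expr.ne (.entry aM (.var xu) (.var xv)) (.var xv)).eval (adjCmd.eval h) ≠ 0 ↔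
          m u v ≠ v := by
        rw [Expr.eval_ne]
        simp only [Expr.entry, Expr.eval, hu1, hv1, c1.N_eq]
        rw [S1.rows u huD v, Ne, Ne, Fin.ext_iff]
      by_cases hne : m u v = v
      · rw [if_neg (by rw [hent]; exact fun h1 => h1 hne)]
        exact .inl (augmentCmd_spec c1.N_eq S1 hu1 hv1 huD huv hne)
      · rw [if_pos (hent.2 hne)]
        exact .inr (extendCmd_spec c1.N_eq S1 hu1 hv1 huD huv hne)
    · rw [if_neg (by rw [hadj]; exact huv)]
      exact .inr ⟨D, m, S1, .inr ⟨rfl, rfl, fun _ h1 => absurd h1 huv⟩⟩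
  · rw [e, if_neg (by rw [hflag]; exact huD)]
    exact .inr ⟨D, m, S, .inr ⟨rfl, rfl, fun h1 => absurd h1 huD⟩⟩

/-- The search has found an augmentation, or the forest has grown beyond `k` vertices, or it
has at least `k` vertices and cannot be enlarged with the pairs in `S`. -/
def Progress (G : SimpleGraph (Fin N)) (f : Fin N → Fin N) (r : Fin N) (k : ℕ)
    (S : Fin N → Fin N → Prop) (h : Env) : Prop :=
  Found G f r h ∨ ∃ D m, Searching G f r h D m ∧
    (k < D.card ∨ (k ≤ D.card ∧ ∀ x y, S x y → ClosedPair G f r D m x y))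

theorem Progress.setVar {G : SimpleGraph (Fin N)} {k : ℕ} {S : Fin N → Fin N → Prop}
    (p : Progress G f r k S h) {x : ℕ} (hx : x ≠ xfound) (i : ℕ) :
    Progress G f r k S (h.setVar x i) :=
  p.imp (fun q => q.setVar hx i) fun ⟨D, m, s, q⟩ => ⟨D, m, s.setVar hx i, q⟩

theorem Progress.mono {G : SimpleGraph (Fin N)} {k : ℕ} {S S' : Fin N → Fin N → Prop}
    (p : Progress G f r k S h) (hS : ∀ x y, S' x y → S x y) : Progress G f r k S' h :=
  p.imp_right fun ⟨D, m, s, q⟩ => ⟨D, m, s, q.imp_right fun q => ⟨q.1, fun x y h => q.2 x y (hS x y h)⟩⟩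

theorem Progress.pair {k : ℕ} {S : Fin N → Fin N → Prop} (c : Ctx I N h)
    (p : Progress (I.extGraph N) f r k S h) (hu : h.var xu = u) (hv : h.var xv = v) :
    Progress (I.extGraph N) f r k (fun x y => S x y ∨ (x = u ∧ y = v)) (pairCmd.eval h) := by
  rcases p with p | ⟨D, m, s, p⟩
  · have : pairCmd.eval h = h := by rw [pairCmd, Cmd.eval, if_pos (by exact p.1)]; rfl
    rw [this]; exact .inl p
  · rcases pairCmd_spec c s hu hv with q | ⟨D', m', s', q⟩
    · exact .inl q
    · refine .inr ⟨D', m', s', ?_⟩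
      rcases q with q | ⟨rfl, rfl, q⟩
      · left; rcases p with p | p <;> omega
      · refine p.imp_right fun p => ⟨p.1, ?_⟩
        rintro x y (h1 | ⟨rfl, rfl⟩)
        · exact p.2 x y h1
        · exact q

/-- Process all pairs. -/
def roundCmd : Cmd := .loop xu xN (.loop xv xN pairCmd)

theorem Progress.round {k : ℕ} (c : Ctx I N h)
    (p : Progress (I.extGraph N) f r k (fun _ _ => False) h) :
    Progress (I.extGraph N) f r k (fun _ _ => True) (roundCmd.eval h) := by
  have outer := loopEval_induction (x := xu) (f := (Cmd.loop xv xN pairCmd).eval)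
    (fun i g => i ≤ N ∧ Ctx I N g ∧ Progress (I.extGraph N) f r k (fun x _ => i ≤ x) g) ?_ ?_ N h ?_
  · rw [roundCmd, Cmd.eval, c.N_eq]
    exact outer.2.2.mono fun x _ _ => Nat.zero_le _
  · rintro i g ⟨hi, cg, pg⟩
    have cg1 := cg.setVar (x := xu) (by decide) i
    have inner := loopEval_induction (x := xv) (f := pairCmd.eval)
      (fun j g' => j ≤ N ∧ Ctx I N g' ∧ g'.var xu = i ∧ Progress (I.extGraph N) f r k
        (fun x y => i + 1 ≤ x ∨ ((x : ℕ) = i ∧ j ≤ y)) g') ?_ ?_ N (g.setVar xu i) ?_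
    · rw [Cmd.eval, cg1.N_eq]
      exact ⟨by omega, inner.2.1, inner.2.2.2.mono fun x y h1 => by omega⟩
    · rintro j g' ⟨hj, cg', hu, pg'⟩
      have c1 := cg'.setVar (x := xv) (by decide) j
      have hu1 : (g'.setVar xv j).var xu = (⟨i, hi⟩ : Fin N) := by simpa [Env.setVar] using hu
      have hv1 : (g'.setVar xv j).var xv = (⟨j, hj⟩ : Fin N) := by simp [Env.setVar]
      refine ⟨by omega, c1.eval _ (by rfl) (by rfl) (by rfl) (by rfl) (by rfl),
        (Cmd.eval_var _ _ (by rfl)).trans hu1,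
        ((pg'.setVar (x := xv) (by decide) j).pair c1 hu1 hv1).mono fun x y h1 => ?_⟩
      simp only [Fin.ext_iff]
      omega
    · rintro g' ⟨hj, cg', hu, pg'⟩
      exact ⟨hj, cg'.setVar (by decide) 0, by simpa [Env.setVar] using hu,
        pg'.setVar (by decide) 0⟩
    · refine ⟨le_rfl, cg1, by simp [Env.setVar], (pg.setVar (by decide) i).mono fun x y h1 => ?_⟩
      have := y.2
      omega
  · rintro g ⟨hi, cg, pg⟩
    exact ⟨hi, cg.setVar (by decide) 0, pg.setVar (by decide) 0⟩
  · refine ⟨le_rfl, c, p.mono fun x _ h1 => ?_⟩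
    have := x.2
    omega

/-- Search for an augmenting path from `r`. -/
def searchCmd : Cmd := .block
  [.assign xfound (.lit 0), .loop xx xN (.set aD (.var xx) (.lit 0)), .set aD (.var xr) (.lit 1),
    copyRow aM (.var xr) aF (.lit 0), .loop xt xN roundCmd]

theorem searchCmd_spec (c : Ctx I N h) (hr : h.var xr = r) (hf : Mates (I.extGraph N) f)
    (hrf : f r = r) (hF : Row h aF 0 f) : Found (I.extGraph N) f r (searchCmd.eval h) ∨
      ((searchCmd.eval h).var xfound = 0 ∧ Row (searchCmd.eval h) aF 0 f ∧
        ¬ ∃ g, Mates (I.extGraph N) g ∧ ∀ x, g x ≠ x) := by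
  let initD : Cmd := .loop xx xN (.set aD (.var xx) (.lit 0))
  let h1 := initD.eval (h.setVar xfound 0)
  let h2 := h1.setArr aD r 1
  let h3 := (copyRow aM (.var xr) aF (.lit 0)).eval h2
  have c1 : Ctx I N h1 := (c.setVar (x := xfound) (by decide) 0).eval initD (by rfl) (by rfl) (by rfl)
    (by rfl) (by rfl)
  have c2 : Ctx I N h2 := ⟨c1.N_eq, c1.n_eq, c1.P_eq, c1.B_eq, c1.inp⟩
  have c3 : Ctx I N h3 := c2.eval _ (by rfl) (by rfl) (by rfl) (by rfl) (by rfl)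
  have hr1 : h1.var xr = r := (Cmd.eval_var initD _ (by rfl)).trans (by simpa [Env.setVar] using hr)
  have hD1 : ∀ x : Fin N, h1.arr aD x = 0 := by
    have := loopEval_induction (x := xx) (f := (Cmd.set aD (.var xx) (.lit 0)).eval)
      (fun i g => ∀ x < N, i ≤ x → g.arr aD x = 0) ?_ ?_ N (h.setVar xfound 0) ?_
    · intro x
      have hN : (h.setVar xfound 0).var xN = N := by simpa [Env.setVar] using c.N_eq
      simp only [h1, initD, Cmd.eval, hN]
      exact this x x.2 (Nat.zero_le _)
    · intro i g hg x hxN hx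
      simp only [Cmd.eval, Expr.eval, Env.setArr, Env.setVar, Function.update_self,
        Function.update_apply]
      split_ifs with hxi
      · rfl
      · exact hg x hxN (by omega)
    · exact fun g hg => hg
    · intro x h1 h2; omega
  have S3 : Searching (I.extGraph N) f r h3 {r} (fun _ => f) := by
    have hF2 : Row h2 aF 0 f := row_congr (h := h) ((by rfl : h2.arr aF = h1.arr aF).trans
      (Cmd.eval_arr initD _ (by rfl))) hF
    refine ⟨?_, row_congr (Cmd.eval_arr _ _ (by rfl)) hF2,
      flags_congr (h := h2) (Cmd.eval_arr _ _ (by rfl)) fun x => ?_, fun x hx => ?_, id, id,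
      Forest.init hf hrf⟩
    · refine (Cmd.eval_var _ _ (by rfl)).trans ((Cmd.eval_var (z := xfound) initD _ (by rfl)).trans ?_)
      simp [Env.setVar]
    · simp only [h2, Env.setArr, Function.update_self, Function.update_apply, hD1 x,
        Finset.mem_singleton, Fin.ext_iff]
      simp
    · obtain rfl := Finset.mem_singleton.1 hx
      have h4 := copyRow_spec (h := h2) (j := aM) (j' := aF) (by decide) (e := .var xr)
        (e' := .lit 0) (fun g hg => hg xr (by decide)) (fun _ _ => rfl) c2.N_eq hF2
      have h5 : (Expr.var xr).eval h2 = x := hr1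
      rw [h5] at h4
      exact h4
  have e : searchCmd.eval h = loopEval roundCmd.eval xt N h3 := by
    have h2_eq : h2 = h1.setArr aD (h1.var xr) 1 := by rw [hr1]
    rw [← c3.N_eq]
    simp only [h3, h2_eq]
    rfl
  have key := loopEval_induction (x := xt) (f := roundCmd.eval)
    (fun i g => Ctx I N g ∧ (Found (I.extGraph N) f r g ∨ ∃ D m, Searching (I.extGraph N) f r g D m ∧
      (N + 1 ≤ i + D.card ∨ ¬ ∃ g, Mates (I.extGraph N) g ∧ ∀ x, g x ≠ x))) ?_ ?_ N h3 ?_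
  · rw [e]
    refine key.2.imp_right ?_
    rintro ⟨D, m, s, h4⟩
    refine ⟨s.notFound, s.row, h4.resolve_left fun h5 => ?_⟩
    have := D.card_le_univ
    rw [Fintype.card_fin] at this
    omega
  · rintro i g ⟨cg, hg⟩
    have cg1 := cg.setVar (x := xt) (by decide) i
    refine ⟨cg1.eval _ (by rfl) (by rfl) (by rfl) (by rfl) (by rfl), ?_⟩
    rcases hg with hg | ⟨D, m, s, hg⟩
    · exact (Progress.round (k := N + 1) cg1 (.inl (hg.setVar (by decide) i))).imp_right
        fun ⟨D, m, s, p⟩ => ⟨D, m, s, .inl (by omega)⟩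
    · refine (Progress.round (k := D.card) cg1
        (.inr ⟨D, m, s.setVar (by decide) i, .inr ⟨le_rfl, fun _ _ => False.elim⟩⟩)).imp_right ?_
      rintro ⟨D', m', s', p⟩
      refine ⟨D', m', s', ?_⟩
      rcases p with p | ⟨-, p⟩
      · exact hg.imp_left fun h4 => by omega
      · right
        obtain ⟨cls, p', F⟩ := s'.forest
        exact F.not_perfect fun u hu v huv =>
          ⟨fun hv => (p u v trivial hu huv).1 hv, fun hv => (p u v trivial hu huv).2 hv cls p' F⟩
  · rintro g ⟨cg, hg⟩
    exact ⟨cg.setVar (by decide) 0, hg.imp (fun q => q.setVar (by decide) 0)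
      fun ⟨D, m, s, q⟩ => ⟨D, m, s.setVar (by decide) 0, q⟩⟩
  · exact ⟨c3, .inr ⟨_, _, S3, .inl (by simp)⟩⟩

/-- Find a perfect matching. -/
def matchCmd : Cmd := .block
  [.loop xx xN (.set aF (.var xx) (.var xx)),
    .assign xok (.sub (.lit 1) (.sub (.var xn) (.var xN))),
    .loop xr xN (.ite (.var xok) (.ite (.ne (.arr aF (.var xr)) (.var xr)) .skip (.block
      [searchCmd, .ite (.var xfound) .skip (.assign xok (.lit 0))])) .skip)]

theorem matchCmd_spec (c : Ctx I N h) : ((matchCmd.eval h).var xok ≠ 0 ∧ I.n ≤ N ∧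
      ∃ g : Fin N → Fin N, Row (matchCmd.eval h) aF 0 g ∧ Mates (I.extGraph N) g ∧ ∀ x, g x ≠ x) ∨
    ((matchCmd.eval h).var xok = 0 ∧
      ¬ (I.n ≤ N ∧ ∃ g : Fin N → Fin N, Mates (I.extGraph N) g ∧ ∀ x, g x ≠ x)) := by
  let initF : Cmd := .loop xx xN (.set aF (.var xx) (.var xx))
  let body : Cmd := .ite (.var xok) (.ite (.ne (.arr aF (.var xr)) (.var xr)) .skip (.block
      [searchCmd, .ite (.var xfound) .skip (.assign xok (.lit 0))])) .skip
  let h1 := initF.eval h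
  have c1 : Ctx I N h1 := c.eval initF (by rfl) (by rfl) (by rfl) (by rfl) (by rfl)
  let h2 := h1.setVar xok (1 - (I.n - N))
  have c2 : Ctx I N h2 := c1.setVar (by decide) _
  have hF1 : Row h1 aF 0 (id : Fin N → Fin N) := by
    have := loopEval_induction (x := xx) (f := (Cmd.set aF (.var xx) (.var xx)).eval)
      (fun i g => ∀ x < N, i ≤ x → g.arr aF x = x) ?_ ?_ N h ?_
    · intro x
      rw [Nat.zero_mul, Nat.zero_add]
      simp only [h1, initF, Cmd.eval, c.N_eq]
      exact this x x.2 (Nat.zero_le _)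
    · intro i g hg x hxN hx
      simp only [Cmd.eval, Expr.eval, Env.setArr, Env.setVar, Function.update_self,
        Function.update_apply]
      split_ifs with hxi
      · exact hxi.symm
      · exact hg x hxN (by omega)
    · exact fun g hg => hg
    · intro x h1 h2; omega
  have e : matchCmd.eval h = loopEval body.eval xr N h2 := by
    rw [← c2.N_eq]
    have e1 := c1.N_eq
    have e2 := c1.n_eq
    simp only [h2, ← e1, ← e2]
    rfl
  have key := loopEval_induction (x := xr) (f := body.eval)
    (fun i g => i ≤ N ∧ Ctx I N g ∧ ∃ f : Fin N → Fin N, Row g aF 0 f ∧ Mates (I.extGraph N) f ∧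
      ((g.var xok ≠ 0 ∧ I.n ≤ N ∧ ∀ x : Fin N, i ≤ x → f x ≠ x) ∨ (g.var xok = 0 ∧
        ¬ (I.n ≤ N ∧ ∃ g : Fin N → Fin N, Mates (I.extGraph N) g ∧ ∀ x, g x ≠ x)))) ?_ ?_ N h2 ?_
  · rw [e]
    obtain ⟨-, -, f, k1, k2, k3⟩ := key
    exact k3.imp_left fun k3 => ⟨k3.1, k3.2.1, f, k1, k2, fun x => k3.2.2 x (Nat.zero_le _)⟩
  · rintro i g ⟨hi, cg, f, k1, k2, k3⟩
    have cg1 := cg.setVar (x := xr) (by decide) i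
    refine ⟨by omega, cg1.eval body (by rfl) (by rfl) (by rfl) (by rfl) (by rfl), ?_⟩
    have hr : (g.setVar xr i).var xr = (⟨i, hi⟩ : Fin N) := by simp [Env.setVar]
    have hok : (g.setVar xr i).var xok = g.var xok := by simp [Env.setVar]
    have k1' : Row (g.setVar xr i) aF 0 f := k1
    generalize hr0 : (⟨i, hi⟩ : Fin N) = r at hr
    have hri : (r : ℕ) = i := by rw [← hr0]
    rcases k3 with k3 | k3
    · have hne : (Expr.ne (.arr aF (.var xr)) (.var xr)).eval (g.setVar xr i) ≠ 0 ↔ f r ≠ r := by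
        rw [Expr.eval_ne]
        have := k1' r
        rw [Nat.zero_mul, Nat.zero_add] at this
        simp only [Expr.eval, hr, this, Ne, Fin.ext_iff]
      have eb : body.eval (g.setVar xr i) =
          if (Expr.ne (.arr aF (.var xr)) (.var xr)).eval (g.setVar xr i) ≠ 0 then g.setVar xr i
          else if (searchCmd.eval (g.setVar xr i)).var xfound ≠ 0 then
            searchCmd.eval (g.setVar xr i) else (searchCmd.eval (g.setVar xr i)).setVar xok 0 := by
        simp only [body]
        rw [Cmd.eval, if_pos (by rw [Expr.eval, hok]; exact k3.1)]
        rfl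
      rw [eb]
      by_cases hfr : f r = r
      · rw [if_neg (by rw [hne]; exact fun h => h hfr)]
        rcases searchCmd_spec cg1 hr k2 hfr k1' with s | ⟨s1, s2, s3⟩
        · rw [if_pos s.1]
          obtain ⟨-, f', t1, t2, t3⟩ := s
          refine ⟨f', t1, t2, .inl ⟨?_, k3.2.1, fun x hx hx' => ?_⟩⟩
          · rw [Cmd.eval_var _ _ (by rfl), hok]; exact k3.1
          · obtain ⟨t4, t5⟩ := t3 x hx'
            refine k3.2.2 x ?_ t4
            have := Fin.val_ne_of_ne t5
            omega
        · rw [if_neg (by rw [s1]; exact fun h => h rfl)]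
          exact ⟨f, s2, k2, .inr ⟨by simp [Env.setVar], fun t => s3 t.2⟩⟩
      · rw [if_pos (hne.2 hfr)]
        refine ⟨f, k1', k2, .inl ⟨by rw [hok]; exact k3.1, k3.2.1, fun x hx => ?_⟩⟩
        by_cases hxr : x = r
        · rw [hxr]; exact hfr
        · have := Fin.val_ne_of_ne hxr
          exact k3.2.2 x (by omega)
    · have eb : body.eval (g.setVar xr i) = g.setVar xr i := by
        simp only [body]
        rw [Cmd.eval, if_neg (by rw [Expr.eval, hok, k3.1]; exact fun h => h rfl)]
        rfl
      rw [eb]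
      exact ⟨f, k1', k2, .inr ⟨by rw [hok]; exact k3.1, k3.2⟩⟩
  · rintro g ⟨hi, cg, f, k1, k2, k3⟩
    exact ⟨hi, cg.setVar (by decide) 0, f, k1, k2, by simpa [Env.setVar] using k3⟩
  · refine ⟨le_rfl, c2, id, hF1, Mates.id _, ?_⟩
    by_cases hn : I.n ≤ N
    · left
      refine ⟨by simp [h2, Env.setVar, Nat.sub_eq_zero_of_le hn], hn, fun x hx => ?_⟩
      have := x.2
      omega
    · right
      refine ⟨?_, fun t => hn t.1⟩
      simp [h2, Env.setVar]; omega

end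

section

variable {I : Instance} {N m : ℕ} {g : Fin N → Fin N} {h : Env}

/-- Number the pairs of the matching in `aF`. -/
def numberCmd : Cmd := .block [.assign xcnt (.lit 0), .loop xx xN (.ite
  (.sub (.arr aF (.var xx)) (.var xx)) (.block [.set aG (.var xx) (.var xcnt),
    .set aG (.arr aF (.var xx)) (.var xcnt), .assign xcnt (.add (.var xcnt) (.lit 1))]) .skip)]

theorem numberCmd_spec (hN : h.var xN = N) (hg : Row h aF 0 g) (h1 : ∀ x, g (g x) = x)
    (h2 : ∀ x, g x ≠ x) (x : Fin N) : (numberCmd.eval h).arr aG x = pairRank g x := by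
  have key := loopEval_induction (x := xx) (f := (Cmd.ite
      (.sub (.arr aF (.var xx)) (.var xx)) (.block [.set aG (.var xx) (.var xcnt),
      .set aG (.arr aF (.var xx)) (.var xcnt),
      .assign xcnt (.add (.var xcnt) (.lit 1))]) .skip).eval)
    (fun i e => i ≤ N ∧ e.arr aF = h.arr aF ∧
      e.var xcnt = (Finset.univ.filter fun w : Fin N => w < g w ∧ i ≤ w).card ∧
      ∀ x : Fin N, i ≤ pairMin g x → e.arr aG x = pairRank g x) ?_ ?_ N (h.setVar xcnt 0) ?_
  · have hN' : (h.setVar xcnt 0).var xN = N := hN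
    have e : numberCmd.eval h = loopEval (Cmd.ite
      (.sub (.arr aF (.var xx)) (.var xx)) (.block [.set aG (.var xx) (.var xcnt),
      .set aG (.arr aF (.var xx)) (.var xcnt),
      .assign xcnt (.add (.var xcnt) (.lit 1))]) .skip).eval xx N (h.setVar xcnt 0) := by
      rw [← hN']; rfl
    rw [e]
    exact key.2.2.2 x (Nat.zero_le _)
  · rintro i e ⟨hi, k1, k2, k3⟩
    obtain ⟨w, rfl⟩ : ∃ w : Fin N, (w : ℕ) = i := ⟨⟨i, hi⟩, rfl⟩
    have hF : h.arr aF w = g w := by simpa using hg w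
    have hv : (e.setVar xx w).var xx = w := by simp [Env.setVar]
    have hF' : (e.setVar xx w).arr aF = h.arr aF := k1
    have hc : (e.setVar xx w).var xcnt = e.var xcnt := by simp [Env.setVar]
    have hG : (e.setVar xx w).arr aG = e.arr aG := rfl
    rw [Cmd.eval]
    simp only [Expr.eval, hv, hF', hF]
    split_ifs with hw
    · have hw' : w < g w := by rw [Fin.lt_def]; omega
      have hmin : pairMin g w = w := min_eq_left hw'.le
      have hrank : pairRank g w = e.var xcnt := by
        rw [k2, pairRank, hmin]; rfl
      refine ⟨by omega, ?_, ?_, fun x hx => ?_⟩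
      · simp [Cmd.block, Cmd.eval, Env.setArr, Env.setVar, k1]
      · have : (Finset.univ.filter fun x : Fin N => x < g x ∧ (w : ℕ) ≤ x) =
            insert w (Finset.univ.filter fun x : Fin N => x < g x ∧ (w : ℕ) + 1 ≤ x) := by
          ext x
          simp only [Finset.mem_filter, Finset.mem_univ, true_and, Finset.mem_insert]
          constructor
          · rintro ⟨h3, h4⟩
            rcases eq_or_ne x w with h5 | h5
            · exact .inl h5
            · have := Fin.val_ne_of_ne h5
              exact .inr ⟨h3, by omega⟩
          · rintro (rfl | ⟨h3, h4⟩)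
            · exact ⟨hw', le_rfl⟩
            · exact ⟨h3, by omega⟩
        rw [this, Finset.card_insert_of_notMem (by simp), ← k2]
        simp [Cmd.block, Cmd.eval, Expr.eval, Env.setArr, Env.setVar]
      · simp only [Cmd.block, Cmd.eval, Expr.eval, Env.setVar, Env.setArr, Function.update_self,
          Function.update_apply, k1]
        simp only [← Fin.ext_iff, if_neg (by decide : ¬ xcnt = xx)]
        simp [hF, ← Fin.ext_iff]
        split_ifs with h3 h4
        · rw [h3, ← hrank]; exact ((pairRank_eq_iff h1 h2 w (g w)).2 (.inr rfl))
        · rw [h4, hrank]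
        · refine k3 x (Nat.lt_of_le_of_ne hx fun h5 => ?_)
          have h6 : pairMin g w = pairMin g x := by rw [hmin]; exact Fin.ext h5
          rcases (pairMin_eq_iff h1 w x).1 h6 with h7 | h7
          · exact h4 h7
          · exact h3 h7
    · have hw' : ¬ w < g w := by rw [Fin.lt_def]; omega
      refine ⟨by omega, k1, ?_, fun x hx => k3 x (Nat.lt_of_le_of_ne hx fun h5 => ?_)⟩
      · rw [Cmd.eval, hc, k2]
        congr 1
        ext x
        simp only [Finset.mem_filter, Finset.mem_univ, true_and]
        refine and_congr_right fun h3 => ⟨fun h4 => by omega, fun h4 => ?_⟩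
        rcases eq_or_ne x w with h5 | h5
        · rw [h5] at h3; exact absurd h3 hw'
        · have := Fin.val_ne_of_ne h5; omega
      · have h6 : w = pairMin g x := Fin.ext h5
        exact hw' (h6 ▸ pairMin_lt h1 h2 x)
  · rintro e ⟨hi, k1, k2, k3⟩
    exact ⟨hi, k1, by simpa [Env.setVar] using k2, k3⟩
  · refine ⟨le_rfl, rfl, ?_, fun x hx => ?_⟩
    · rw [Finset.filter_false_of_mem fun w _ h => by omega]; simp [Env.setVar]
    · omega

/-- Output the array `aG`, behind the first cell. -/
def outputCmd : Cmd := .loop xx xN (.put (.add (.var xx) (.lit 1)) (.arr aG (.var xx)))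

theorem outputCmd_spec {x : ℕ} (hx : x < h.var xN) (hl : x + 1 < h.len) :
    (outputCmd.eval h).inp (x + 1) = h.arr aG x := by
  have key := loopEval_induction (x := xx)
    (f := (Cmd.put (.add (.var xx) (.lit 1)) (.arr aG (.var xx))).eval)
    (fun i e => e.len = h.len ∧ e.arr = h.arr ∧ ∀ x, i ≤ x → x < h.var xN → x + 1 < h.len →
      e.inp (x + 1) = h.arr aG x) ?_ ?_ (h.var xN) h ?_
  · exact key.2.2 x (Nat.zero_le _) hx hl
  · rintro i e ⟨k1, k2, k3⟩
    refine ⟨k1, k2, fun x hx hxN hxl => ?_⟩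
    simp only [Cmd.eval, Expr.eval, Env.setInp, Env.setVar, Function.update_self, k1, k2]
    by_cases hxi : x = i
    · subst hxi
      rw [if_pos hxl, Function.update_self]
    · split_ifs
      · rw [Function.update_of_ne (by omega)]
        exact k3 x (by omega) hxN hxl
      · exact k3 x (by omega) hxN hxl
  · exact fun e k => k
  · exact ⟨rfl, rfl, fun x h1 h2 => absurd h1 (by omega)⟩

/-- Decide whether there is a perfect matching, and output the allocation that it defines. -/
def answerCmd : Cmd := .block [matchCmd, .ite (.var xok) (.block [numberCmd, outputCmd,
    .put (.lit 0) (.lit 1), .assign xlen (.add (.var xn) (.lit 1))]) (.block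
  [.put (.lit 0) (.lit 0), .assign xlen (.lit 1)])]

theorem answerCmd_spec (hm : m = min I.k (I.n + 1)) (c : Ctx I (2 * m) h)
    (hl : h.len = I.encode.length) : ∃ y : Option I.Allocation, I.CorrectAnswer 2 y ∧
      (answerCmd.eval h).var xlen ≤ I.encode.length ∧
      (answerCmd.eval h).inp 0 = (if y.isSome then 1 else 0) ∧
      (List.range ((answerCmd.eval h).var xlen)).map (answerCmd.eval h).inp = I.encodeAnswer y := by
  have hlen := I.length_encode
  have hl1 : (matchCmd.eval h).len = I.encode.length := (Cmd.eval_len _ _).trans hl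
  rcases matchCmd_spec c with ⟨hok, hn, g, hg, hM, hfix⟩ | ⟨hok, hno⟩
  · have h1 : ∀ x, g (g x) = x := hM.inv
    have h2 : ∀ x, (I.extGraph (2 * m)).Adj x (g x) := fun x => hM.adj x (hfix x)
    let a : I.Allocation := fun v => ⟨pairRank g (Fin.castLE hn v), by
      have := two_mul_pairRank_lt h1 hfix (Fin.castLE hn v)
      omega⟩
    let e1 := numberCmd.eval (matchCmd.eval h)
    let e2 := outputCmd.eval e1
    have c1 : Ctx I (2 * m) (matchCmd.eval h) :=
      c.eval _ (by rfl) (by rfl) (by rfl) (by rfl) (by rfl)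
    have c2 : Ctx I (2 * m) e1 := c1.eval _ (by rfl) (by rfl) (by rfl) (by rfl) (by rfl)
    have hl2 : e1.len = I.encode.length := (Cmd.eval_len _ _).trans hl1
    have hl3 : e2.len = I.encode.length := (Cmd.eval_len _ _).trans hl2
    have hn2 : e2.var xn = I.n := (Cmd.eval_var _ _ (by rfl)).trans c2.n_eq
    have e : answerCmd.eval h = (e2.setInp 0 1).setVar xlen (e2.var xn + 1) := by
      rw [answerCmd, Cmd.block, Cmd.eval, Cmd.block, Cmd.eval, Cmd.eval, if_pos (by exact hok)]
      rfl
    have hinp : ∀ v : Fin I.n, e2.inp (v + 1) = a v := fun v => by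
      have hv := v.2
      have := outputCmd_spec (h := e1) (x := v) (by rw [c2.N_eq]; omega) (by rw [hl2, hlen]; omega)
      exact this.trans (numberCmd_spec c1.N_eq hg h1 hfix (Fin.castLE hn v))
    have hinp0 : (answerCmd.eval h).inp 0 = 1 := by
      rw [e]
      simp only [Env.setVar, Env.setInp, hl3]
      rw [if_pos (by omega), Function.update_self]
    have hvar : (answerCmd.eval h).var xlen = I.n + 1 := by rw [e]; simp [Env.setVar, hn2]
    refine ⟨some a, isSolutionOfSize_of_pairing hm hn h1 h2 fun _ => rfl, ?_, hinp0, ?_⟩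
    · rw [hvar]; omega
    · rw [hvar, List.range_succ_eq_map, List.map_cons, List.map_map, hinp0, Instance.encodeAnswer]
      congr 1
      refine List.ext_getElem (by simp) fun i hi _ => ?_
      have hi' : i < I.n := by simpa using hi
      have := hinp ⟨i, hi'⟩
      simp only [List.getElem_map, List.getElem_range, Function.comp, List.getElem_ofFn, e,
        Env.setVar, Env.setInp]
      split_ifs
      · rw [Function.update_of_ne (by omega)]; exact this
      · exact this
  · have e : answerCmd.eval h = ((matchCmd.eval h).setInp 0 0).setVar xlen 1 := by
      rw [answerCmd, Cmd.block, Cmd.eval, Cmd.block, Cmd.eval, Cmd.eval,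
        if_neg (by rw [Expr.eval, hok]; exact fun h => h rfl)]
      rfl
    have hinp0 : (answerCmd.eval h).inp 0 = 0 := by
      rw [e]
      simp only [Env.setVar, Env.setInp, hl1]
      rw [if_pos (by omega), Function.update_self]
    have hvar : (answerCmd.eval h).var xlen = 1 := by rw [e]; simp [Env.setVar]
    refine ⟨none, ?_, ?_, hinp0, ?_⟩
    · rintro ⟨a, ha⟩
      obtain ⟨hn, g, h1, h2⟩ := exists_pairing_of_solution hm ha
      exact hno ⟨hn, g, ⟨h1, fun x _ => h2 x⟩, fun x => (h2 x).ne'⟩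
    · rw [hvar]; omega
    · rw [hvar]; simp [hinp0, Instance.encodeAnswer]

/-- Read the parameters of the instance, and compute the number of vertices of the extended
graph. -/
def prologue : List (ℕ × Expr) :=
  [(xn, .inp (.lit 0)), (xk, .inp (.lit 1)), (xP, .inp (.lit 2)), (xB, .inp (.lit 3)),
    (xk, .sub (.var xk) (.sub (.var xk) (.add (.var xn) (.lit 1)))),
    (xN, .add (.var xk) (.var xk))]

theorem prologue_spec (I : Instance) :
    Ctx I (2 * min I.k (I.n + 1)) ((assignAll prologue).eval (Env.start I.encode)) := by
  refine ⟨?_, ?_, ?_, ?_, fun _ => rfl⟩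
  · simp only [prologue, assignAll, Cmd.eval, Expr.eval, Env.setVar, Env.start, I.encode_zero,
      I.encode_one]
    simp
    omega
  · exact I.encode_zero
  · exact I.encode_two
  · exact I.encode_three

theorem prologue_factorsLE : ∀ a ∈ prologue, ∀ h, a.2.FactorsLE 0 h := by
  simp [prologue, Expr.FactorsLE]

theorem prologue_le (I : Instance) :
    ((assignAll prologue).eval (Env.start I.encode)).var 0 ≤ 2 * I.encode.length + 2 ∧
    ((assignAll prologue).eval (Env.start I.encode)).var 1 ≤ 2 * I.encode.length + 2 := by
  have c := prologue_spec I
  have := I.length_encode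
  exact ⟨by rw [c.N_eq]; omega, by rw [c.n_eq]; omega⟩

theorem solvableInPolyTime : SolvableInPolyTime Instance.encode
    (fun I : Instance => I.encodeAnswer) (fun I : Instance => I.CorrectAnswer 2) := by
  obtain ⟨q, hq⟩ := exists_poly_computesWithin prologue answerCmd xlen prologue_factorsLE (by rfl)
  refine ⟨program prologue answerCmd xlen, q, fun I => ?_⟩
  obtain ⟨y, h1, h2, -, h3⟩ := answerCmd_spec rfl (prologue_spec I)
    ((Cmd.eval_len _ _).trans rfl)
  have := hq I.encode (prologue_le I).1 (prologue_le I).2 h2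
  rw [h3] at this
  exact ⟨y, h1, this⟩

theorem decidableInPolyTime : DecidableInPolyTime Instance.encode
    (fun I => ∃ a : I.Allocation, I.IsSolutionOfSize 2 a) := by
  obtain ⟨q, hq⟩ := exists_poly_computesWithin prologue (.seq answerCmd (.assign xlen (.lit 1)))
    xlen prologue_factorsLE (by rfl)
  refine ⟨program prologue (.seq answerCmd (.assign xlen (.lit 1))) xlen, q, fun I => ?_⟩
  obtain ⟨y, h1, -, h3, -⟩ := answerCmd_spec rfl (prologue_spec I)
    ((Cmd.eval_len _ _).trans rfl)
  have hlen := I.length_encode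
  have hvar : ((Cmd.seq answerCmd (.assign xlen (.lit 1))).eval
      ((assignAll prologue).eval (Env.start I.encode))).var xlen = 1 := by
    simp [Cmd.eval, Expr.eval, Env.setVar]
  have hinp : ((Cmd.seq answerCmd (.assign xlen (.lit 1))).eval
      ((assignAll prologue).eval (Env.start I.encode))).inp 0 = if y.isSome then 1 else 0 := h3
  have := hq I.encode (prologue_le I).1 (prologue_le I).2 (by rw [hvar]; omega)
  rw [hvar, List.range_one, List.map_singleton, hinp] at this
  convert this using 3
  cases y with
  | none => simpa [Instance.CorrectAnswer] using h1
  | some a => simpa using ⟨a, h1⟩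

end

end Search

end RAM

/-- For bundle size two, BCFEA is decidable in polynomial time, and a solution can be found in
polynomial time; a solution with all bundles of size exactly two exists if and only if `n = 2k`
and the graph of feasible pairs has a perfect matching. -/
theorem mainTheorem10 :
    RAM.DecidableInPolyTime BCFEA.Instance.encode
      (fun I => ∃ a : I.Allocation, I.IsSolutionOfSize 2 a) ∧
    RAM.SolvableInPolyTime BCFEA.Instance.encode
      (fun I : BCFEA.Instance => I.encodeAnswer)
      (fun I : BCFEA.Instance => I.CorrectAnswer 2) ∧
    ∀ I : BCFEA.Instance,
      (∃ a : I.Allocation, I.IsSolution a ∧ ∀ i, (I.bundle a i).card = 2) ↔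
        I.n = 2 * I.k ∧ ∃ M : I.pairGraph.Subgraph, M.IsPerfectMatching :=
  ⟨RAM.decidableInPolyTime, RAM.solvableInPolyTime,
    BCFEA.Instance.exists_isSolution_card_eq_two_iff⟩
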